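/- **Setting.** Let $d\in\{1,2,3\}$ and let $\Omega\subset\mathbb R^d$ be a polyhedral domain (nonempty, open, connected, equal to the interior of its closure) with a finite conforming mesh $\mathcal T_H$ of $\overline\Omega$ by closed axis-parallel orthotopes (two elements that meet intersect in a common face) with nodes $z_1,\dots,z_m$. Let $V=H^1(\Omega)$, $V^0=H^1_0(\Omega)$, and let $\mathrm{tr}\colon V\to X=H^{1/2}(\partial\Omega)$ be the trace operator, with $\ker\mathrm{tr}=V^0$ (so $X$ is identified with $V/V^0$). Let $V_H\subset V$ be the $Q^1$ finite element space of functions that are continuous on $\overline\Omega$ and multilinear on each $T\in\mathcal T_H$, $V_H^0=V_H\cap V^0$, $X_H=\mathrm{tr}\,V_H$, and let $\Lambda_j\in V_H$ be the hat function of $z_j$, i.e. $\Lambda_j(z_i)=\delta_{ij}$. Let $\Pi_H$ be the $L^2(\Omega)$-projection onto $V_H$ and $(\cdot,\cdot)$ the $L^2(\Omega)$ inner product. Let $A\in L^\infty(\Omega;\mathbb R^{d\times d}_{\mathrm{sym}})$ satisfy, for some $0<\alpha\le\beta<\infty$ and all $\xi\in\mathbb R^d$, $\alpha|\xi|^2\le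 A(x)\xi\cdot\xi\le\beta|\xi|^2$ for almost all $x\in\Omega$. Put $a(w,v)=\int_\Omega A\nabla w\cdot\nabla v\,dx$ and $a_T(w,v)=\int_T A\nabla w\cdot\nabla v\,dx$. Let $E^b\colon X\to V$ be a linear extension operator ($\mathrm{tr}\,E^b=1$) with $E^b(X_H)\subseteq V_H$; put $E^b_H=E^b|_{X_H}\colon X_H\to V_H$, $R=1-E^b\,\mathrm{tr}$, and $R_H=R|_{V_H}\colon V_H\to V_H^0$. For $T\in\mathcal T_H$ let $\mathrm N^0(T)=T$, let $\mathrm N^{\ell}(T)$ for $\ell\ge1$ be the union of all elements that meet $\mathrm N^{\ell-1}(T)$, and put $\mathrm N(T)=\mathrm N^1(T)$. Let $I_H\colon V^0\to V_H^0$ be a linear projection (that is, $I_Hv=v$ for $v\in V_H^0$) such that for some constant $C$, all $v\in V^0$ and all $T\in\mathcal T_H$, with $H_T=\operatorname{diam}T$, $$H_T^{-1}\|v-I_Hv\|_{L^2(T)}+\|\nabla I_Hv\|_{L^2(T)}\le C\|\nabla v\|_{L^2(\mathrm N(T))}.$$ Let $W=\ker I_H$ and $\ell\in\mathbb N_0$.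 For $v\in V_H^0$, let $\mathcal C_{T,\ell}v$ be the element of $W_{T,\ell}=\{w\in W: w|_{\Omega\setminus \mathrm N^\ell(T)}=0\}$ with $a(\mathcal C_{T,\ell}v,w)=a_T(v,w)$ for all $w\in W_{T,\ell}$; for $v\in V_H$ put $\mathcal C_\ell v=\sum_{T\in\mathcal T_H}\mathcal C_{T,\ell}Rv$. **The two operators.** Let $u^0\in X_H$, $f\in L^2(\Omega)$ and $f_H=\Pi_Hf$. * $\mathfrak L^{\mathrm{eff}}_{A,\ell}(u^0,f)$ is the $u_H\in V_H$ with $u_H=R_Hu_H+E^b_Hu^0$ and $$a((1-\mathcal C_\ell)R_Hu_H,(1-\mathcal C_\ell)v_H)=(f_H,v_H)-a(E^b_Hu^0,(1-\mathcal C_\ell)v_H)\quad\text{for all }v_H\in V_H^0.$$ * Identify functions in $V_H$ with their coefficient vectors in $\mathbb R^m$ with respect to $\Lambda_1,\dots,\Lambda_m$. Let $P$ be the matrix that restricts vectors in $\mathbb R^m$ to the indices of the $m^0$ inner nodes (those $z_i\in\Omega$), and let $M_H[i,j]=(\Lambda_j,\Lambda_i)$ be the mass matrix. For $S\in\mathbb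 R^{m\times m}$, $\mathfrak L_S(u^0,f)$ is the $u_H\in V_H$ with $\mathrm{tr}\,u_H=u^0$ and $$(P S P^{T})\,P\,(R_Hu_H)=P M_Hf_H-P S\,(E^b_Hu^0).$$ Let $S_H^\ell(A)\in\mathbb R^{m\times m}$ be the LOD stiffness matrix $$S_H^\ell(A)[i,j]=a((1-\mathcal C_\ell)\Lambda_j,(1-\mathcal C_\ell)\Lambda_i).$$ **Lemma 4.3 (Alternative representation of the effective forward operator).** Suppose that $\mathcal C_\ell E^b_Hv^0=0$ for all $v^0\in X_H$. Then for all $u^0\in X_H$ and $f\in L^2(\Omega)$ the two discrete problems above (the matrix problem with $S=S_H^\ell(A)$) each have exactly one solution, so that both operators are well defined, and $$\mathfrak L_{S_H^\ell(A)}(u^0,f)=\mathfrak L^{\mathrm{eff}}_{A,\ell}(u^0,f).$$ -/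

import Mathlib

open MeasureTheory
open scoped ENNReal ContDiff Matrix

noncomputable section

namespace LOD

/-! ### Sobolev spaces -/

/-- The Euclidean space `ℝ^d`. -/
abbrev Eucl (d : ℕ) : Type := EuclideanSpace ℝ (Fin d)

variable {d : ℕ}

/-- `L²(Ω)`. -/
abbrev L2 (Ω : Set (Eucl d)) : Type := Lp ℝ 2 ((volume : Measure (Eucl d)).restrict Ω)

/-- `L²(Ω; ℝ^d)`. -/
abbrev L2vec (Ω : Set (Eucl d)) : Type := Lp (Eucl d) 2 ((volume : Measure (Eucl d)).restrict Ω)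

/-- Test functions `φ ∈ C_c^∞(Ω)`. -/
def IsTestFun (Ω : Set (Eucl d)) (φ : Eucl d → ℝ) : Prop :=
  ContDiff ℝ ∞ φ ∧ HasCompactSupport φ ∧ tsupport φ ⊆ Ω

/-- The classical partial derivative `∂φ/∂x_i`. -/
def partialDeriv (φ : Eucl d → ℝ) (i : Fin d) (x : Eucl d) : ℝ :=
  fderiv ℝ φ x (EuclideanSpace.single i 1)

/-- `g` is the weak gradient of `u` in `Ω`. -/
def IsWeakGrad (Ω : Set (Eucl d)) (u : L2 Ω) (g : L2vec Ω) : Prop :=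
  ∀ φ : Eucl d → ℝ, IsTestFun Ω φ → ∀ i : Fin d,
    ∫ x in Ω, u x * partialDeriv φ i x = -∫ x in Ω, g x i * φ x

theorem integrable_mul_testFun {Ω : Set (Eucl d)} (u : L2 Ω) {φ : Eucl d → ℝ}
    (hφ : IsTestFun Ω φ) (i : Fin d) :
    Integrable (fun x => u x * partialDeriv φ i x) ((volume : Measure (Eucl d)).restrict Ω) := by
  have hc : Continuous (partialDeriv φ i) :=
    (hφ.1.continuous_fderiv (by simp)).clm_apply continuous_const
  have hs : HasCompactSupport (partialDeriv φ i) :=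
    hφ.2.1.fderiv_apply (𝕜 := ℝ) (EuclideanSpace.single i 1)
  have h2 : MemLp (partialDeriv φ i) 2 ((volume : Measure (Eucl d)).restrict Ω) :=
    hc.memLp_of_hasCompactSupport hs
  exact (Lp.memLp u).integrable_mul h2

theorem integrable_grad_mul_testFun {Ω : Set (Eucl d)} (g : L2vec Ω) {φ : Eucl d → ℝ}
    (hφ : IsTestFun Ω φ) (i : Fin d) :
    Integrable (fun x => g x i * φ x) ((volume : Measure (Eucl d)).restrict Ω) := by
  have h1 : MemLp (fun x => g x i) 2 ((volume : Measure (Eucl d)).restrict Ω) :=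
    (EuclideanSpace.proj (𝕜 := ℝ) i).comp_memLp' (Lp.memLp g)
  have h2 : MemLp φ 2 ((volume : Measure (Eucl d)).restrict Ω) :=
    hφ.1.continuous.memLp_of_hasCompactSupport hφ.2.1
  exact h1.integrable_mul h2

/-- The Sobolev space `V = H¹(Ω)`: pairs `(u, ∇u)` of a function `u ∈ L²(Ω)` and its weak gradient
`∇u ∈ L²(Ω; ℝ^d)`. The norm inherited from the `ℓ²`-product is the `H¹`-norm. -/
def H1 (Ω : Set (Eucl d)) : Submodule ℝ (WithLp 2 (L2 Ω × L2vec Ω)) where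
  carrier := {p | IsWeakGrad Ω p.fst p.snd}
  zero_mem' := by
    intro φ _ i
    have h1 : (fun x => ((0 : L2 Ω) : Eucl d → ℝ) x * partialDeriv φ i x)
        =ᵐ[(volume : Measure (Eucl d)).restrict Ω] fun _ => (0 : ℝ) := by
      filter_upwards [Lp.coeFn_zero ℝ 2 ((volume : Measure (Eucl d)).restrict Ω)] with x hx
      rw [hx]; simp
    have h2 : (fun x => ((0 : L2vec Ω) : Eucl d → Eucl d) x i * φ x)
        =ᵐ[(volume : Measure (Eucl d)).restrict Ω] fun _ => (0 : ℝ) := by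
      filter_upwards [Lp.coeFn_zero (Eucl d) 2 ((volume : Measure (Eucl d)).restrict Ω)] with x hx
      rw [hx]; simp
    have h1' := integral_congr_ae h1
    have h2' := integral_congr_ae h2
    simp only [WithLp.zero_fst, WithLp.zero_snd]
    rw [h1', h2']; simp
  add_mem' := by
    intro p q hp hq φ hφ i
    have h1 : (fun x => ((p.fst + q.fst : L2 Ω) : Eucl d → ℝ) x * partialDeriv φ i x)
        =ᵐ[(volume : Measure (Eucl d)).restrict Ω]
          fun x => p.fst x * partialDeriv φ i x + q.fst x * partialDeriv φ i x := by
      filter_upwards [Lp.coeFn_add p.fst q.fst] with x hx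
      rw [hx]; simp [add_mul]
    have h2 : (fun x => ((p.snd + q.snd : L2vec Ω) : Eucl d → Eucl d) x i * φ x)
        =ᵐ[(volume : Measure (Eucl d)).restrict Ω]
          fun x => p.snd x i * φ x + q.snd x i * φ x := by
      filter_upwards [Lp.coeFn_add p.snd q.snd] with x hx
      rw [hx]; simp [add_mul]
    have h1' := integral_congr_ae h1
    have h2' := integral_congr_ae h2
    simp only [WithLp.add_fst, WithLp.add_snd]
    rw [h1', h2', integral_add (integrable_mul_testFun _ hφ i) (integrable_mul_testFun _ hφ i),
      integral_add (integrable_grad_mul_testFun _ hφ i) (integrable_grad_mul_testFun _ hφ i),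
      hp φ hφ i, hq φ hφ i]
    ring
  smul_mem' := by
    intro c p hp φ hφ i
    have h1 : (fun x => ((c • p.fst : L2 Ω) : Eucl d → ℝ) x * partialDeriv φ i x)
        =ᵐ[(volume : Measure (Eucl d)).restrict Ω]
          fun x => c * (p.fst x * partialDeriv φ i x) := by
      filter_upwards [Lp.coeFn_smul c p.fst] with x hx
      rw [hx]; simp [mul_assoc]
    have h2 : (fun x => ((c • p.snd : L2vec Ω) : Eucl d → Eucl d) x i * φ x)
        =ᵐ[(volume : Measure (Eucl d)).restrict Ω]
          fun x => c * (p.snd x i * φ x) := by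
      filter_upwards [Lp.coeFn_smul c p.snd] with x hx
      rw [hx]; simp [mul_assoc]
    have h1' := integral_congr_ae h1
    have h2' := integral_congr_ae h2
    simp only [WithLp.smul_fst, WithLp.smul_snd]
    rw [h1', h2', integral_const_mul, integral_const_mul, hp φ hφ i]
    ring

/-- The `L²` function underlying an element of `H¹(Ω)`. -/
def val {Ω : Set (Eucl d)} (u : H1 Ω) : L2 Ω := (u : WithLp 2 (L2 Ω × L2vec Ω)).fst

/-- The weak gradient of an element of `H¹(Ω)`. -/
def grad {Ω : Set (Eucl d)} (u : H1 Ω) : L2vec Ω := (u : WithLp 2 (L2 Ω × L2vec Ω)).snd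

/-- The elements of `H¹(Ω)` given by functions in `C_c^∞(Ω)`. -/
def smoothCompact (Ω : Set (Eucl d)) : Set (H1 Ω) :=
  {u | ∃ φ : Eucl d → ℝ, IsTestFun Ω φ ∧ val u =ᵐ[volume.restrict Ω] φ}

/-- `V⁰ = H¹₀(Ω)`, the closure of `C_c^∞(Ω)` in `H¹(Ω)` (`C_c^∞(Ω)` is a linear space, so the span
adds nothing). -/
def H10 (Ω : Set (Eucl d)) : Submodule ℝ (H1 Ω) :=
  (Submodule.span ℝ (smoothCompact Ω)).topologicalClosure

/-- The trace space `X = H^{1/2}(∂Ω)`, the range of the trace operator, whose kernel is `H¹₀(Ω)`;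
it is realized as `H¹(Ω) / H¹₀(Ω)`. -/
abbrev TraceSpace (Ω : Set (Eucl d)) : Type := H1 Ω ⧸ H10 Ω

/-- The trace operator `tr : V → X`. Two functions have the same trace iff they differ by an
element of `H¹₀(Ω)`. -/
def tr (Ω : Set (Eucl d)) : H1 Ω →ₗ[ℝ] TraceSpace Ω := (H10 Ω).mkQ

/-! ### The diffusion coefficient and the bilinear form -/

/-- `A` belongs to the set `𝒜` of admissible coefficients. -/
structure Admissible (Ω : Set (Eucl d)) (A : Eucl d → Matrix (Fin d) (Fin d) ℝ) : Prop where
  memLp : ∀ i j, MemLp (fun x => A x i j) ⊤ ((volume : Measure (Eucl d)).restrict Ω)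
  symm : ∀ᵐ x ∂(volume : Measure (Eucl d)).restrict Ω, (A x).IsSymm
  elliptic : ∃ α β : ℝ, 0 < α ∧ α ≤ β ∧ ∀ ξ : Eucl d,
    ∀ᵐ x ∂(volume : Measure (Eucl d)).restrict Ω,
      α * ‖ξ‖ ^ 2 ≤ (A x *ᵥ (fun i => ξ i)) ⬝ᵥ (fun i => ξ i) ∧
        (A x *ᵥ (fun i => ξ i)) ⬝ᵥ (fun i => ξ i) ≤ β * ‖ξ‖ ^ 2

/-- `∫_S A ∇w · ∇v dx`. -/
def energy {Ω : Set (Eucl d)} (A : Eucl d → Matrix (Fin d) (Fin d) ℝ) (S : Set (Eucl d))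
    (w v : H1 Ω) : ℝ :=
  ∫ x in S, (A x *ᵥ (fun i => grad w x i)) ⬝ᵥ (fun i => grad v x i)

/-- The bilinear form `a(w, v) = ∫_Ω A ∇w · ∇v dx`. -/
def aForm {Ω : Set (Eucl d)} (A : Eucl d → Matrix (Fin d) (Fin d) ℝ) (w v : H1 Ω) : ℝ :=
  energy A Ω w v

/-! ### Meshes of orthotopes and the finite element space `Q¹` -/

/-- A non-degenerate axis-parallel orthotope in `ℝ^d`. -/
@[ext] structure Orthotope (d : ℕ) where
  lo : Fin d → ℝ
  hi : Fin d → ℝ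
  lt : ∀ i, lo i < hi i

namespace Orthotope

/-- The closed orthotope. -/
def closed (T : Orthotope d) : Set (Eucl d) := {x | ∀ i, T.lo i ≤ x i ∧ x i ≤ T.hi i}

/-- The open orthotope. -/
def inner (T : Orthotope d) : Set (Eucl d) := {x | ∀ i, T.lo i < x i ∧ x i < T.hi i}

/-- The vertices of the orthotope. -/
def vertices (T : Orthotope d) : Set (Eucl d) := {x | ∀ i, x i = T.lo i ∨ x i = T.hi i}

/-- The (nonempty, closed) faces of all dimensions: the coordinates in `L` are fixed to their lower
bound, the coordinates in `U` to their upper bound. -/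
def IsFace (T : Orthotope d) (F : Set (Eucl d)) : Prop :=
  ∃ L U : Finset (Fin d), Disjoint L U ∧
    F = {x | x ∈ T.closed ∧ (∀ i ∈ L, x i = T.lo i) ∧ ∀ i ∈ U, x i = T.hi i}

end Orthotope

/-- A finite conforming mesh of orthotopes of (the closure of) `Ω`. -/
structure Mesh (Ω : Set (Eucl d)) where
  elems : Finset (Orthotope d)
  cover : closure Ω = ⋃ T ∈ elems, T.closed
  conforming : ∀ T ∈ elems, ∀ T' ∈ elems, (T.closed ∩ T'.closed).Nonempty →
    T.IsFace (T.closed ∩ T'.closed) ∧ T'.IsFace (T.closed ∩ T'.closed)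

variable {Ω : Set (Eucl d)}

/-- The nodes of the mesh. -/
def Mesh.nodes (𝒯 : Mesh Ω) : Set (Eucl d) := {x | ∃ T ∈ 𝒯.elems, x ∈ T.vertices}

/-- The elements in the neighborhood `N^ℓ(T)`: `N⁰(T) = T`, and each step adds all elements whose
closure meets the closure of the previous neighborhood. -/
def Mesh.patch (𝒯 : Mesh Ω) (T : Orthotope d) : ℕ → Set (Orthotope d)
  | 0 => {T}
  | ℓ + 1 => {T' | T' ∈ 𝒯.elems ∧ ∃ T'' ∈ Mesh.patch 𝒯 T ℓ, (T'.closed ∩ T''.closed).Nonempty}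

/-- The region `N^ℓ(T)`, as a closed set. -/
def Mesh.patchRegion (𝒯 : Mesh Ω) (T : Orthotope d) (ℓ : ℕ) : Set (Eucl d) :=
  ⋃ T' ∈ 𝒯.patch T ℓ, T'.closed

/-- `g` is multilinear (bilinear for `d = 2`, trilinear for `d = 3`) on `S`: there it is a
polynomial of degree at most one in every variable. -/
def IsMultilinearOn (g : Eucl d → ℝ) (S : Set (Eucl d)) : Prop :=
  ∃ c : Finset (Fin d) → ℝ, ∀ x ∈ S, g x = ∑ s : Finset (Fin d), c s * ∏ i ∈ s, x i

/-- `g` is a continuous piecewise multilinear function on the mesh. -/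
def Mesh.IsQ1 (𝒯 : Mesh Ω) (g : Eucl d → ℝ) : Prop :=
  ContinuousOn g (closure Ω) ∧ ∀ T ∈ 𝒯.elems, IsMultilinearOn g T.closed

/-- The `Q¹` finite element space `V_H ⊆ H¹(Ω)`. -/
def Mesh.VH (𝒯 : Mesh Ω) : Submodule ℝ (H1 Ω) where
  carrier := {v | ∃ g : Eucl d → ℝ, 𝒯.IsQ1 g ∧ val v =ᵐ[volume.restrict Ω] g}
  zero_mem' := ⟨fun _ => 0, ⟨continuousOn_const, fun _ _ => ⟨fun _ => 0, by simp⟩⟩,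
    Lp.coeFn_zero ℝ 2 _⟩
  add_mem' := by
    rintro v w ⟨g, ⟨hgc, hg⟩, hv⟩ ⟨k, ⟨hkc, hk⟩, hw⟩
    refine ⟨fun x => g x + k x, ⟨hgc.add hkc, fun T hT => ?_⟩, ?_⟩
    · obtain ⟨c, hc⟩ := hg T hT
      obtain ⟨e, he⟩ := hk T hT
      exact ⟨fun s => c s + e s, fun x hx => by
        simp only []
        rw [hc x hx, he x hx, ← Finset.sum_add_distrib]; simp [add_mul]⟩
    · filter_upwards [Lp.coeFn_add (val v) (val w), hv, hw] with x h1 h2 h3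
      exact h1.trans (by simp [h2, h3])
  smul_mem' := by
    rintro a v ⟨g, ⟨hgc, hg⟩, hv⟩
    refine ⟨fun x => a * g x, ⟨hgc.const_mul a, fun T hT => ?_⟩, ?_⟩
    · obtain ⟨c, hc⟩ := hg T hT
      exact ⟨fun s => a * c s, fun x hx => by
        simp only []
        rw [hc x hx, Finset.mul_sum]; simp [mul_assoc]⟩
    · filter_upwards [Lp.coeFn_smul a (val v), hv] with x h1 h2
      exact h1.trans (by simp [h2])

/-- `V_H⁰ = V_H ∩ V⁰`. -/
def Mesh.VH0 (𝒯 : Mesh Ω) : Submodule ℝ (H1 Ω) := 𝒯.VH ⊓ H10 Ω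

/-- `X_H = tr V_H`. -/
def Mesh.XH (𝒯 : Mesh Ω) : Submodule ℝ (TraceSpace Ω) := 𝒯.VH.map (tr Ω)

/-- The classical hat function `Λ_p`: the element of `V_H` that is `1` at the node `p` and `0` at
all other nodes. -/
def Mesh.hat (𝒯 : Mesh Ω) (p : 𝒯.nodes) : H1 Ω :=
  Classical.epsilon fun v : H1 Ω => ∃ g : Eucl d → ℝ, 𝒯.IsQ1 g ∧
    val v =ᵐ[volume.restrict Ω] g ∧ g p = 1 ∧ ∀ q ∈ 𝒯.nodes, q ≠ p → g q = 0

/-! ### Extension, quasi-interpolation and corrections -/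

/-- A linear extension operator `E^b : X → V` (`tr ∘ E^b = 1`) whose restriction to `X_H` is a
discrete extension operator `E_H^b : X_H → V_H`. -/
structure ExtensionOp (𝒯 : Mesh Ω) where
  toLin : TraceSpace Ω →ₗ[ℝ] H1 Ω
  tr_apply : ∀ g, tr Ω (toLin g) = g
  mem_VH : ∀ g ∈ 𝒯.XH, toLin g ∈ 𝒯.VH

/-- The restriction operator `R = 1 - E^b tr` (on `V_H` it is `R_H = 1 - E_H^b tr`). -/
def ExtensionOp.R {𝒯 : Mesh Ω} (E : ExtensionOp 𝒯) : H1 Ω →ₗ[ℝ] H1 Ω :=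
  LinearMap.id - E.toLin ∘ₗ tr Ω

/-- The `L²(S)`-norm of a scalar or vector valued function. -/
def normL2 {F : Type} [NormedAddCommGroup F] (S : Set (Eucl d)) (g : Eucl d → F) : ℝ :=
  Real.sqrt (∫ x in S, ‖g x‖ ^ 2)

/-- `I_H : V⁰ → V_H⁰` is a projective quasi-interpolation operator with local approximation and
stability properties. -/
structure IsQuasiInterpolation (𝒯 : Mesh Ω) (IH : H10 Ω →ₗ[ℝ] 𝒯.VH0) : Prop where
  proj : ∀ v : H10 Ω, (v : H1 Ω) ∈ 𝒯.VH0 → (IH v : H1 Ω) = v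
  stable : ∃ C : ℝ, ∀ v : H10 Ω, ∀ T ∈ 𝒯.elems,
    (Metric.diam T.closed)⁻¹ * normL2 T.inner (val ((v : H1 Ω) - (IH v : H1 Ω))) +
        normL2 T.inner (grad (IH v : H1 Ω)) ≤
      C * normL2 (𝒯.patchRegion T 1 ∩ Ω) (grad (v : H1 Ω))

/-- The space of all `w ∈ W = Ker I_H` with `w = 0` on `Ω \ N^ℓ(T)`. -/
def localKernel (𝒯 : Mesh Ω) (IH : H10 Ω →ₗ[ℝ] 𝒯.VH0) (ℓ : ℕ) (T : Orthotope d) : Set (H1 Ω) :=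
  {w | (∃ hw : w ∈ H10 Ω, IH ⟨w, hw⟩ = 0) ∧
    ∀ᵐ x ∂(volume : Measure (Eucl d)).restrict Ω, x ∉ 𝒯.patchRegion T ℓ → val w x = 0}

/-- The localized element correction `𝒞_{T,ℓ} v`: the solution of a variational problem on the
patch `N^ℓ(T)`. -/
def elemCorr (A : Eucl d → Matrix (Fin d) (Fin d) ℝ) (𝒯 : Mesh Ω) (IH : H10 Ω →ₗ[ℝ] 𝒯.VH0)
    (ℓ : ℕ) (T : Orthotope d) (v : H1 Ω) : H1 Ω :=
  Classical.epsilon fun c : H1 Ω => c ∈ localKernel 𝒯 IH ℓ T ∧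
    ∀ w ∈ localKernel 𝒯 IH ℓ T, aForm A c w = energy A T.inner v w

/-- The full localized correction on `V_H`: `𝒞_ℓ v = ∑_T 𝒞_{T,ℓ} R v`
(note that `R v = v` for `v ∈ V_H⁰`). -/
def corr (A : Eucl d → Matrix (Fin d) (Fin d) ℝ) (𝒯 : Mesh Ω) (IH : H10 Ω →ₗ[ℝ] 𝒯.VH0)
    (E : ExtensionOp 𝒯) (ℓ : ℕ) (v : H1 Ω) : H1 Ω :=
  ∑ T ∈ 𝒯.elems, elemCorr A 𝒯 IH ℓ T (E.R v)

/-- `(1 - 𝒞_ℓ) v`. -/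
def corrected (A : Eucl d → Matrix (Fin d) (Fin d) ℝ) (𝒯 : Mesh Ω) (IH : H10 Ω →ₗ[ℝ] 𝒯.VH0)
    (E : ExtensionOp 𝒯) (ℓ : ℕ) (v : H1 Ω) : H1 Ω :=
  v - corr A 𝒯 IH E ℓ v

/-- The `L²` inner product `(u, v)`. -/
def innerL2 (u v : L2 Ω) : ℝ := ∫ x in Ω, u x * v x

/-- The `L²` projection `f_H = Π_H f` of `f` onto `V_H`. -/
def projL2 (𝒯 : Mesh Ω) (f : L2 Ω) : H1 Ω :=
  Classical.epsilon fun fH : H1 Ω => fH ∈ 𝒯.VH ∧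
    ∀ v ∈ 𝒯.VH, innerL2 (val fH) (val v) = innerL2 f (val v)

/-! ### The effective forward operator -/

/-- `u` solves the effective discrete problem with boundary data `u0` and source `f`: `u ∈ V_H`,
`u = R_H u + E_H^b u⁰`, and
`a((1-𝒞_ℓ) R_H u, (1-𝒞_ℓ) v) = (f_H, v) - a(E_H^b u⁰, (1-𝒞_ℓ) v)` for all `v ∈ V_H⁰`. -/
def SolvesEff (A : Eucl d → Matrix (Fin d) (Fin d) ℝ) (𝒯 : Mesh Ω) (IH : H10 Ω →ₗ[ℝ] 𝒯.VH0)
    (E : ExtensionOp 𝒯) (ℓ : ℕ) (u0 : 𝒯.XH) (f : L2 Ω) (u : 𝒯.VH) : Prop :=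
  (u : H1 Ω) = E.R u + E.toLin u0 ∧
    ∀ v ∈ 𝒯.VH0,
      aForm A (corrected A 𝒯 IH E ℓ (E.R u)) (corrected A 𝒯 IH E ℓ v) =
        innerL2 (val (projL2 𝒯 f)) (val v) - aForm A (E.toLin u0) (corrected A 𝒯 IH E ℓ v)

/-- The effective forward operator `𝔏^eff_{A,ℓ} : X_H × L²(Ω) → V_H`. -/
def Leff (A : Eucl d → Matrix (Fin d) (Fin d) ℝ) (𝒯 : Mesh Ω) (IH : H10 Ω →ₗ[ℝ] 𝒯.VH0)
    (E : ExtensionOp 𝒯) (ℓ : ℕ) (u0 : 𝒯.XH) (f : L2 Ω) : 𝒯.VH :=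
  Classical.epsilon (SolvesEff A 𝒯 IH E ℓ u0 f)

/-! ### The matrix-based forward operator -/

section MatrixForm

variable {m : ℕ} {𝒯 : Mesh Ω} (z : Fin m ≃ 𝒯.nodes)

/-- The coefficient vector in `ℝ^m` of `v ∈ V_H` with respect to the hat functions. -/
def coeffs (v : H1 Ω) : Fin m → ℝ :=
  Classical.epsilon fun c : Fin m → ℝ => v = ∑ j, c j • 𝒯.hat (z j)

/-- The indices of the inner nodes. -/
abbrev InnerIdx : Type := {i : Fin m // (z i : Eucl d) ∈ Ω}

instance : Fintype (InnerIdx z) := Fintype.ofFinite _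

/-- The `m⁰ × m` matrix that restricts a vector of nodal values to the inner nodes. -/
def restrictionMatrix : Matrix (InnerIdx z) (Fin m) ℝ :=
  Matrix.of fun i j => if (i : Fin m) = j then 1 else 0

/-- The finite element mass matrix `M_H[i,j] = (Λ_{z_j}, Λ_{z_i})`. -/
def massMatrix : Matrix (Fin m) (Fin m) ℝ :=
  Matrix.of fun i j => innerL2 (val (𝒯.hat (z j))) (val (𝒯.hat (z i)))

/-- The LOD stiffness matrix `S_H^ℓ(A)[i,j] = a((1-𝒞_ℓ) Λ_{z_j}, (1-𝒞_ℓ) Λ_{z_i})`. -/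
def lodStiffness (A : Eucl d → Matrix (Fin d) (Fin d) ℝ) (IH : H10 Ω →ₗ[ℝ] 𝒯.VH0)
    (E : ExtensionOp 𝒯) (ℓ : ℕ) : Matrix (Fin m) (Fin m) ℝ :=
  Matrix.of fun i j =>
    aForm A (corrected A 𝒯 IH E ℓ (𝒯.hat (z j))) (corrected A 𝒯 IH E ℓ (𝒯.hat (z i)))

/-- `u ∈ V_H` solves the matrix problem for the `m × m` matrix `S`: `u = u⁰` on `∂Ω` and
`S₀ (R_H u) = (M_H f_H - S (E_H^b u⁰))` at the inner nodes, where `S₀` is the restriction of `S` to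
the inner nodes and functions in `V_H` and `V_H⁰` are identified with their vectors of coefficients
in `ℝ^m` and `ℝ^{m⁰}`. -/
def SolvesMat (S : Matrix (Fin m) (Fin m) ℝ) (E : ExtensionOp 𝒯) (u0 : 𝒯.XH) (f : L2 Ω)
    (u : 𝒯.VH) : Prop :=
  tr Ω (u : H1 Ω) = u0 ∧
    (restrictionMatrix z * S * (restrictionMatrix z)ᵀ) *ᵥ
        (restrictionMatrix z *ᵥ coeffs z (E.R u)) =
      restrictionMatrix z *ᵥ (massMatrix z *ᵥ coeffs z (projL2 𝒯 f)) -
        restrictionMatrix z *ᵥ (S *ᵥ coeffs z (E.toLin u0))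

/-- The matrix-based operator `𝔏_S : X_H × L²(Ω) → V_H`. -/
def Lmat (S : Matrix (Fin m) (Fin m) ℝ) (E : ExtensionOp 𝒯) (u0 : 𝒯.XH) (f : L2 Ω) : 𝒯.VH :=
  Classical.epsilon (SolvesMat z S E u0 f)

end MatrixForm

end LOD

end

noncomputable section

namespace LOD

variable {d : ℕ} {Ω : Set (Eucl d)}

/-! ### Sobolev spaces: basic structure -/

/-! Both problems fix the trace in the same way, because `tr R = 0` makes `u = R u + E u⁰`
equivalent to `tr u = u⁰`. What remains is an equation for `R u ∈ V_H⁰`. Expand `R u`, `Π_H f` and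
`E u⁰` in hat functions and use that `1 - 𝒞_ℓ` is linear: row `i` of the matrix system becomes the
effective equation tested with the hat function `Λ_i` of an inner node. The only discrepancy is
`a((1 - 𝒞_ℓ) E u⁰, ·)` in place of `a(E u⁰, ·)`, and it disappears because `𝒞_ℓ E u⁰ = 0`. As the
inner hat functions span `V_H⁰`, the two solution predicates agree (`solvesMat_iff_solvesEff`), and
so do the solutions chosen from them.

Unique solvability is finite-dimensional linear algebra once the form is definite on `V_H⁰`
(`exists_corrected_linear`): if `(1 - 𝒞_ℓ) v` has no energy, then `v = 𝒞_ℓ v` by the Poincaré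
inequality, so `I_H v = 0`, while `I_H v = v` because `I_H` is a projection.

Two facts behind this need most of the work. First, the element corrections exist, are unique and
depend linearly on their argument. This is Lax-Milgram on the local kernels, which are closed
because the approximation property bounds `I_H` from `H¹` to `L²` (`existsUnique_elemCorr`). Second,
`V_H⁰` is spanned by the hat functions of the inner nodes, although `H¹₀` is only defined as a
closure of test functions. An inner hat function is Lipschitz and vanishes on the boundary, so
truncation and mollification put it in `H¹₀` (`mem_H10_of_lipschitz`). Conversely, a `Q¹` function
in `H¹₀` vanishes at boundary nodes: in a slab of width `t` at the boundary its squared `L²`-norm is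
`O(t²)`, whereas a nonzero nodal value would force order `t` (`Mesh.eq_zero_of_mem_H10`). The mesh
geometry enters mainly through `Mesh.interval_eq_or_touch`. -/

theorem H1.ext' {u v : H1 Ω} (h1 : val u = val v) (h2 : grad u = grad v) : u = v := by
  apply Subtype.ext
  apply (WithLp.equiv 2 (L2 Ω × L2vec Ω)).injective
  exact Prod.ext h1 h2

@[simp] theorem val_add (u v : H1 Ω) : val (u + v) = val u + val v := rfl
@[simp] theorem val_sub (u v : H1 Ω) : val (u - v) = val u - val v := rfl
@[simp] theorem val_smul (c : ℝ) (u : H1 Ω) : val (c • u) = c • val u := rfl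
@[simp] theorem val_zero : val (0 : H1 Ω) = 0 := rfl
@[simp] theorem grad_add (u v : H1 Ω) : grad (u + v) = grad u + grad v := rfl
@[simp] theorem grad_sub (u v : H1 Ω) : grad (u - v) = grad u - grad v := rfl
@[simp] theorem grad_smul (c : ℝ) (u : H1 Ω) : grad (c • u) = c • grad u := rfl
@[simp] theorem grad_zero : grad (0 : H1 Ω) = 0 := rfl

theorem norm_sq_eq (u : H1 Ω) : ‖u‖ ^ 2 = ‖val u‖ ^ 2 + ‖grad u‖ ^ 2 :=
  WithLp.prod_norm_sq_eq_of_L2 (u : WithLp 2 (L2 Ω × L2vec Ω))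

theorem inner_eq (u v : H1 Ω) :
    inner ℝ u v = inner ℝ (val u) (val v) + inner ℝ (grad u) (grad v) :=
  WithLp.prod_inner_apply (u : WithLp 2 (L2 Ω × L2vec Ω)) (v : WithLp 2 (L2 Ω × L2vec Ω))

theorem norm_val_le (u : H1 Ω) : ‖val u‖ ≤ ‖u‖ := by
  refine abs_le_of_sq_le_sq' ?_ (norm_nonneg _) |>.2
  rw [norm_sq_eq]; nlinarith [sq_nonneg ‖grad u‖]

theorem norm_grad_le (u : H1 Ω) : ‖grad u‖ ≤ ‖u‖ := by
  refine abs_le_of_sq_le_sq' ?_ (norm_nonneg _) |>.2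
  rw [norm_sq_eq]; nlinarith [sq_nonneg ‖val u‖]

/-- `val` as a continuous linear map. -/
def valL (Ω : Set (Eucl d)) : H1 Ω →L[ℝ] L2 Ω :=
  LinearMap.mkContinuous { toFun := val, map_add' := val_add, map_smul' := val_smul } 1
    (fun u => by simpa using norm_val_le u)

/-- `grad` as a continuous linear map. -/
def gradL (Ω : Set (Eucl d)) : H1 Ω →L[ℝ] L2vec Ω :=
  LinearMap.mkContinuous { toFun := grad, map_add' := grad_add, map_smul' := grad_smul } 1
    (fun u => by simpa using norm_grad_le u)

@[simp] theorem valL_apply (u : H1 Ω) : valL Ω u = val u := rfl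
@[simp] theorem gradL_apply (u : H1 Ω) : gradL Ω u = grad u := rfl

/-! ### Test functions and weak gradients -/

theorem IsTestFun.continuous_partialDeriv {φ : Eucl d → ℝ} (hφ : IsTestFun Ω φ) (i : Fin d) :
    Continuous (partialDeriv φ i) :=
  (hφ.1.continuous_fderiv (by simp)).clm_apply continuous_const

theorem IsTestFun.memLp_partialDeriv {φ : Eucl d → ℝ} (hφ : IsTestFun Ω φ) (i : Fin d) :
    MemLp (partialDeriv φ i) 2 ((volume : Measure (Eucl d)).restrict Ω) :=
  (hφ.continuous_partialDeriv i).memLp_of_hasCompactSupport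
    (hφ.2.1.fderiv_apply (𝕜 := ℝ) (EuclideanSpace.single i 1))

theorem IsTestFun.memLp_field {φ : Eucl d → ℝ} (hφ : IsTestFun Ω φ) (i : Fin d) :
    MemLp (fun x => φ x • (EuclideanSpace.single i 1 : Eucl d)) 2
      ((volume : Measure (Eucl d)).restrict Ω) :=
  (hφ.1.continuous.smul continuous_const).memLp_of_hasCompactSupport hφ.2.1.smul_right

theorem integral_mul_partialDeriv_eq_inner {φ : Eucl d → ℝ} (hφ : IsTestFun Ω φ) (i : Fin d)
    (u : L2 Ω) :
    ∫ x in Ω, u x * partialDeriv φ i x = inner ℝ ((hφ.memLp_partialDeriv i).toLp _) u := by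
  rw [L2.inner_def]
  refine integral_congr_ae ?_
  filter_upwards [(hφ.memLp_partialDeriv i).coeFn_toLp] with x hx
  simp [hx]

theorem integral_grad_mul_eq_inner {φ : Eucl d → ℝ} (hφ : IsTestFun Ω φ) (i : Fin d)
    (g : L2vec Ω) :
    ∫ x in Ω, g x i * φ x = inner ℝ ((hφ.memLp_field i).toLp _) g := by
  rw [L2.inner_def]
  refine integral_congr_ae ?_
  filter_upwards [(hφ.memLp_field i).coeFn_toLp] with x hx
  rw [hx, inner_smul_left, EuclideanSpace.inner_single_left]
  simp [mul_comm]

theorem isWeakGrad_iff {u : L2 Ω} {g : L2vec Ω} : IsWeakGrad Ω u g ↔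
    ∀ (φ : Eucl d → ℝ) (hφ : IsTestFun Ω φ) (i : Fin d),
      inner ℝ ((hφ.memLp_partialDeriv i).toLp _) u =
        -inner ℝ ((hφ.memLp_field i).toLp _) g := by
  refine forall_congr' fun φ => forall_congr' fun hφ => forall_congr' fun i => ?_
  rw [integral_mul_partialDeriv_eq_inner hφ, integral_grad_mul_eq_inner hφ]

/-- Each test function and direction imposes an equality of two continuous linear functionals of the
pair, so the space is an intersection of closed sets. This makes `H¹(Ω)` complete. -/
theorem isClosed_H1 (Ω : Set (Eucl d)) : IsClosed (H1 Ω : Set (WithLp 2 (L2 Ω × L2vec Ω))) := by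
  have : (H1 Ω : Set (WithLp 2 (L2 Ω × L2vec Ω))) =
      {p | ∀ (φ : Eucl d → ℝ) (hφ : IsTestFun Ω φ) (i : Fin d),
        inner ℝ ((hφ.memLp_partialDeriv i).toLp _) p.fst =
        -inner ℝ ((hφ.memLp_field i).toLp _) p.snd} := by
    ext p
    exact isWeakGrad_iff
  rw [this]
  simp only [Set.ofPred_forall]
  refine isClosed_iInter fun φ => isClosed_iInter fun hφ => isClosed_iInter fun i => ?_
  exact isClosed_eq (by fun_prop) (by fun_prop)

instance : CompleteSpace (H1 Ω) := (isClosed_H1 Ω).completeSpace_coe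

/-- A field of `L²` that is orthogonal to all test fields vanishes. -/
theorem eq_zero_of_inner_field_eq_zero (hΩ : IsOpen Ω) {g : L2vec Ω}
    (h : ∀ (φ : Eucl d → ℝ) (hφ : IsTestFun Ω φ) (i : Fin d),
      inner ℝ ((hφ.memLp_field i).toLp _) g = 0) : g = 0 := by
  have key : ∀ i : Fin d, ∀ᵐ x ∂(volume : Measure (Eucl d)).restrict Ω, g x i = 0 := by
    intro i
    have hmem : MemLp (fun x => g x i) 2 ((volume : Measure (Eucl d)).restrict Ω) :=
      (EuclideanSpace.proj (𝕜 := ℝ) i).comp_memLp' (Lp.memLp g)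
    have hloc : LocallyIntegrable (fun x => g x i) ((volume : Measure (Eucl d)).restrict Ω) :=
      hmem.locallyIntegrable (by norm_num)
    have := hΩ.ae_eq_zero_of_integral_contDiff_smul_eq_zero (μ := volume.restrict Ω)
      (hloc.locallyIntegrableOn Ω) (fun φ h1 h2 h3 => by
        have h4 := h φ ⟨h1, h2, h3⟩ i
        rw [← integral_grad_mul_eq_inner ⟨h1, h2, h3⟩ i g] at h4
        simpa [mul_comm] using h4)
    filter_upwards [this, ae_restrict_mem hΩ.measurableSet] with x hx hm using hx hm
  apply Lp.ext
  filter_upwards [ae_all_iff.2 key, Lp.coeFn_zero (Eucl d) 2 (volume.restrict Ω)] with x hx h0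
  rw [h0]
  ext i
  simpa using hx i

/-- Uniqueness of the weak gradient. It allows elements of `H¹(Ω)` to be identified through almost
everywhere equality of their `L²` parts. -/
theorem val_injective (hΩ : IsOpen Ω) : Function.Injective (val : H1 Ω → L2 Ω) := by
  suffices h : ∀ u : H1 Ω, val u = 0 → u = 0 by
    intro u v huv
    have := h (u - v) (by rw [val_sub, huv, sub_self])
    exact sub_eq_zero.1 this
  intro u hu
  refine H1.ext' hu (eq_zero_of_inner_field_eq_zero hΩ fun φ hφ i => ?_)
  have h1 := isWeakGrad_iff.1 u.2 φ hφ i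
  change inner ℝ _ (val u) = -inner ℝ _ (grad u) at h1
  rw [hu, inner_zero_right] at h1
  linarith

/-- A closed subspace of `H¹(Ω)` contains every `L²`-limit of its elements with uniformly bounded
gradients. -/
theorem mem_of_bounded_approx (hΩ : IsOpen Ω) {K : Submodule ℝ (H1 Ω)} (hK : IsClosed (K : Set (H1 Ω)))
    {u : H1 Ω} {M : ℝ} (h : ∀ η > 0, ∃ w ∈ K, ‖grad w‖ ≤ M ∧ ‖val u - val w‖ ≤ η) : u ∈ K := by
  have : CompleteSpace K := hK.completeSpace_coe
  -- This replaces weak compactness by duality. For `k ⊥ K`, the product `⟨k, u⟩` equals `⟨k, u -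
  -- w⟩` for every approximant `w`. The gradient part is small because `grad k` is close to a
  -- combination `Ψ` of test fields, and pairing `Ψ` with a gradient costs only the `L²`-norm of the
  -- function.
  rw [← Submodule.orthogonal_orthogonal K]
  intro k hk
  set D : Submodule ℝ (L2vec Ω) := Submodule.span ℝ
    {Ψ | ∃ (φ : Eucl d → ℝ) (hφ : IsTestFun Ω φ) (i : Fin d), Ψ = (hφ.memLp_field i).toLp _} with hD
  have hDtop : D.topologicalClosure = ⊤ := by
    rw [Submodule.topologicalClosure_eq_top_iff, eq_bot_iff]
    intro g hg
    refine eq_zero_of_inner_field_eq_zero hΩ fun φ hφ i => ?_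
    exact hg _ (Submodule.subset_span ⟨φ, hφ, i, rfl⟩)
  -- on `D`, the pairing with a gradient is bounded by the `L²`-norm of the function
  have hdual : ∀ Ψ ∈ D, ∃ C : ℝ, ∀ w : H1 Ω, |inner ℝ (grad w) Ψ| ≤ C * ‖val w‖ := by
    intro Ψ hΨ
    induction hΨ using Submodule.span_induction with
    | mem Ψ h =>
      obtain ⟨φ, hφ, i, rfl⟩ := h
      refine ⟨‖(hφ.memLp_partialDeriv i).toLp _‖, fun w => ?_⟩
      have h1 := isWeakGrad_iff.1 w.2 φ hφ i
      change inner ℝ _ (val w) = -inner ℝ _ (grad w) at h1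
      rw [real_inner_comm, ← abs_neg, ← h1]
      exact abs_real_inner_le_norm _ _
    | zero => exact ⟨0, fun w => by simp⟩
    | add x y _ _ hx hy =>
      obtain ⟨C, hC⟩ := hx
      obtain ⟨C', hC'⟩ := hy
      refine ⟨C + C', fun w => ?_⟩
      rw [inner_add_right, add_mul]
      exact (abs_add_le _ _).trans (add_le_add (hC w) (hC' w))
    | smul a x _ hx =>
      obtain ⟨C, hC⟩ := hx
      refine ⟨|a| * C, fun w => ?_⟩
      rw [inner_smul_right, abs_mul, mul_assoc]
      exact mul_le_mul_of_nonneg_left (hC w) (abs_nonneg a)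
  have hM : 0 ≤ M := by
    obtain ⟨w, -, hw, -⟩ := h 1 one_pos
    exact (norm_nonneg _).trans hw
  refine abs_nonpos_iff.1 (le_of_forall_pos_le_add fun ε hε => ?_)
  rw [zero_add]
  have hdense : grad k ∈ closure (D : Set (L2vec Ω)) := by
    have : grad k ∈ D.topologicalClosure := by rw [hDtop]; trivial
    exact this
  -- `B` bounds `‖grad (u - w)‖` for every admissible `w`. Hence `Ψ` can be fixed before `w`, whose
  -- tolerance may then depend on the constant `C` of `Ψ`.
  set B := ‖grad u‖ + M + 1 with hB
  have hBpos : 0 < B := by positivity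
  obtain ⟨Ψ, hΨ, hdist⟩ := Metric.mem_closure_iff.1 hdense (ε / (2 * B)) (by positivity)
  obtain ⟨C, hC⟩ := hdual Ψ hΨ
  set E := ‖val k‖ + |C| + 1 with hE
  have hEpos : 0 < E := by positivity
  obtain ⟨w, hwK, hwM, hwη⟩ := h (ε / (2 * E)) (by positivity)
  have hkw : inner ℝ k w = 0 := by
    rw [real_inner_comm]; exact hk w hwK
  have e1 : inner ℝ k u = inner ℝ (val k) (val (u - w)) + inner ℝ (grad k - Ψ) (grad (u - w))
      + inner ℝ (grad (u - w)) Ψ := by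
    rw [inner_sub_left, real_inner_comm (grad (u - w)) Ψ]
    have : inner ℝ k (u - w) = inner ℝ k u := by rw [inner_sub_right, hkw, sub_zero]
    rw [← this, inner_eq]; ring
  have b1 : |inner ℝ (val k) (val (u - w))| ≤ ‖val k‖ * (ε / (2 * E)) :=
    (abs_real_inner_le_norm _ _).trans (mul_le_mul_of_nonneg_left hwη (norm_nonneg _))
  have b2 : |inner ℝ (grad k - Ψ) (grad (u - w))| ≤ (ε / (2 * B)) * B := by
    refine (abs_real_inner_le_norm _ _).trans (mul_le_mul ?_ ?_ (norm_nonneg _) (by positivity))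
    · rw [← dist_eq_norm]; exact hdist.le
    · rw [grad_sub]
      refine (norm_sub_le _ _).trans ?_
      rw [hB]; linarith
  have b3 : |inner ℝ (grad (u - w)) Ψ| ≤ |C| * (ε / (2 * E)) :=
    (hC _).trans (mul_le_mul (le_abs_self C) hwη (norm_nonneg _) (abs_nonneg _))
  have c1 : (ε / (2 * B)) * B = ε / 2 := by field_simp
  have c2 : ε / (2 * E) * E = ε / 2 := by field_simp
  have c3 : 0 ≤ ε / (2 * E) := by positivity
  rw [e1]
  refine (abs_add_three _ _ _).trans ?_
  rw [hE] at c2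
  nlinarith

/-! ### `L²`-norms on subsets -/

/-- Restriction of functions in `L²(Ω)` to a subset. -/
def resL {F : Type} [NormedAddCommGroup F] [NormedSpace ℝ F] (Ω S : Set (Eucl d)) :
    Lp F 2 ((volume : Measure (Eucl d)).restrict Ω) →L[ℝ]
      Lp F 2 (((volume : Measure (Eucl d)).restrict Ω).restrict S) :=
  LpToLpRestrictCLM _ F ℝ _ 2 S

theorem coeFn_resL {F : Type} [NormedAddCommGroup F] [NormedSpace ℝ F] (S : Set (Eucl d))
    (u : Lp F 2 ((volume : Measure (Eucl d)).restrict Ω)) :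
    resL Ω S u =ᵐ[(volume.restrict Ω).restrict S] u :=
  LpToLpRestrictCLM_coeFn ℝ S u

theorem norm_resL_le {F : Type} [NormedAddCommGroup F] [NormedSpace ℝ F] (S : Set (Eucl d))
    (u : Lp F 2 ((volume : Measure (Eucl d)).restrict Ω)) : ‖resL Ω S u‖ ≤ ‖u‖ :=
  norm_Lp_toLp_restrict_le S u

theorem norm_sq_eq_integral {μ : Measure (Eucl d)} {F : Type} [NormedAddCommGroup F]
    [InnerProductSpace ℝ F] (u : Lp F 2 μ) : ‖u‖ ^ 2 = ∫ x, ‖u x‖ ^ 2 ∂μ := by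
  rw [← real_inner_self_eq_norm_sq, L2.inner_def]
  simp only [real_inner_self_eq_norm_sq]

theorem restrict_restrict_subset {S : Set (Eucl d)} (hS : MeasurableSet S) (hSΩ : S ⊆ Ω) :
    ((volume : Measure (Eucl d)).restrict Ω).restrict S = volume.restrict S := by
  rw [Measure.restrict_restrict hS, Set.inter_eq_left.2 hSΩ]

theorem norm_resL_sq {F : Type} [NormedAddCommGroup F] [InnerProductSpace ℝ F]
    {S : Set (Eucl d)} (hS : MeasurableSet S) (hSΩ : S ⊆ Ω)
    (u : Lp F 2 ((volume : Measure (Eucl d)).restrict Ω)) :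
    ‖resL Ω S u‖ ^ 2 = ∫ x in S, ‖u x‖ ^ 2 := by
  rw [norm_sq_eq_integral, ← restrict_restrict_subset hS hSΩ]
  refine integral_congr_ae ?_
  filter_upwards [coeFn_resL S u] with x hx
  rw [hx]

theorem normL2_eq_norm_resL {F : Type} [NormedAddCommGroup F] [InnerProductSpace ℝ F]
    {S : Set (Eucl d)} (hS : MeasurableSet S) (hSΩ : S ⊆ Ω)
    (u : Lp F 2 ((volume : Measure (Eucl d)).restrict Ω)) :
    normL2 S u = ‖resL Ω S u‖ := by
  rw [normL2, ← norm_resL_sq hS hSΩ, Real.sqrt_sq (norm_nonneg _)]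

/-! ### Lipschitz functions belong to `H¹(Ω)` -/

/-- The directional derivatives of a Lipschitz function are bounded, hence square integrable on a
bounded set. Integration by parts against compactly supported Lipschitz functions shows that they
form the weak gradient. -/
theorem exists_H1_of_lipschitz (hΩ : IsOpen Ω) (hb : Bornology.IsBounded Ω) {K : NNReal}
    {g : Eucl d → ℝ} (hg : LipschitzWith K g) :
    ∃ v : H1 Ω, val v =ᵐ[volume.restrict Ω] g ∧
      ∀ᵐ x ∂(volume.restrict Ω), ∀ i, grad v x i = lineDeriv ℝ g x (EuclideanSpace.single i 1) := by
  have hfin : IsFiniteMeasure ((volume : Measure (Eucl d)).restrict Ω) :=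
    ⟨by rw [Measure.restrict_apply_univ]; exact hb.measure_lt_top⟩
  have hgm : MemLp g 2 ((volume : Measure (Eucl d)).restrict Ω) := by
    obtain ⟨C, hC⟩ := (hb.isCompact_closure.image hg.continuous).isBounded.exists_norm_le
    refine MemLp.of_bound hg.continuous.aestronglyMeasurable C ?_
    filter_upwards [ae_restrict_mem hΩ.measurableSet] with x hx
    exact hC _ ⟨x, subset_closure hx, rfl⟩
  let G : Eucl d → Eucl d := fun x =>
    WithLp.toLp 2 fun i => lineDeriv ℝ g x (EuclideanSpace.single i 1)
  have hGmeas : Measurable G :=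
    (WithLp.measurable_toLp 2 _).comp
      (measurable_pi_lambda _ fun i => measurable_lineDeriv hg.continuous)
  have hGm : MemLp G 2 ((volume : Measure (Eucl d)).restrict Ω) := by
    refine MemLp.of_bound hGmeas.aestronglyMeasurable (Real.sqrt (∑ _i : Fin d, (K : ℝ) ^ 2)) ?_
    refine Filter.Eventually.of_forall fun x => ?_
    rw [EuclideanSpace.norm_eq]
    refine Real.sqrt_le_sqrt (Finset.sum_le_sum fun i _ => ?_)
    refine pow_le_pow_left₀ (norm_nonneg _) ?_ 2
    simpa using norm_lineDeriv_le_of_lipschitz ℝ hg (x₀ := x) (v := EuclideanSpace.single i 1)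
  have hw : IsWeakGrad Ω (hgm.toLp g) (hGm.toLp G) := by
    intro φ hφ i
    obtain ⟨D, hD⟩ := ContDiff.lipschitzWith_of_hasCompactSupport hφ.2.1 hφ.1 (by simp)
    have hld : ∀ x, lineDeriv ℝ φ x (EuclideanSpace.single i 1) = partialDeriv φ i x := fun x =>
      (hφ.1.differentiable (by simp) x).lineDeriv_eq_fderiv
    have h0 : ∀ x, x ∉ Ω → φ x = 0 := fun x hx => by
      by_contra h
      exact hx (hφ.2.2 (subset_tsupport _ h))
    have h0' : ∀ x, x ∉ Ω → partialDeriv φ i x = 0 := fun x hx => by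
      have : fderiv ℝ φ x = 0 := by
        by_contra h
        exact hx (hφ.2.2 (support_fderiv_subset ℝ h))
      simp [partialDeriv, this]
    have e1 : ∫ x in Ω, (hgm.toLp g) x * partialDeriv φ i x = ∫ x, g x * partialDeriv φ i x := by
      rw [← setIntegral_eq_integral_of_forall_compl_eq_zero (s := Ω) (μ := volume)
        (f := fun x => g x * partialDeriv φ i x) (fun x hx => by rw [h0' x hx, mul_zero])]
      refine integral_congr_ae ?_
      filter_upwards [hgm.coeFn_toLp] with x hx
      rw [hx]
    have e2 : ∫ x in Ω, (hGm.toLp G) x i * φ x =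
        ∫ x, lineDeriv ℝ g x (EuclideanSpace.single i 1) * φ x := by
      rw [← setIntegral_eq_integral_of_forall_compl_eq_zero (s := Ω) (μ := volume)
        (f := fun x => lineDeriv ℝ g x (EuclideanSpace.single i 1) * φ x)
        (fun x hx => by rw [h0 x hx, mul_zero])]
      refine integral_congr_ae ?_
      filter_upwards [hGm.coeFn_toLp] with x hx
      rw [hx]
    rw [e1, e2, hg.integral_lineDeriv_mul_eq hD hφ.2.1, ← integral_neg]
    refine integral_congr_ae (Filter.Eventually.of_forall fun x => ?_)
    simp only [lineDeriv_neg, hld]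
    ring
  refine ⟨⟨WithLp.toLp 2 (hgm.toLp g, hGm.toLp G), hw⟩, hgm.coeFn_toLp, ?_⟩
  filter_upwards [hGm.coeFn_toLp] with x hx i
  change (hGm.toLp G) x i = _
  rw [hx]

/-- The bound depends on the Lipschitz constant alone, which supplies the uniform gradient bound
required by `mem_of_bounded_approx`. -/
theorem norm_grad_le_of_lipschitz (hΩ : IsOpen Ω) (hb : Bornology.IsBounded Ω) (K : NNReal) :
    ∃ M : ℝ, ∀ g : Eucl d → ℝ, LipschitzWith K g → ∀ v : H1 Ω, val v =ᵐ[volume.restrict Ω] g →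
      ‖grad v‖ ≤ M := by
  have hfin : IsFiniteMeasure ((volume : Measure (Eucl d)).restrict Ω) :=
    ⟨by rw [Measure.restrict_apply_univ]; exact hb.measure_lt_top⟩
  refine ⟨_, fun g hg v hv => Lp.norm_le_of_ae_bound (Real.sqrt_nonneg (∑ _i : Fin d, (K : ℝ) ^ 2)) ?_⟩
  obtain ⟨w, hw, hw'⟩ := exists_H1_of_lipschitz hΩ hb hg
  obtain rfl : v = w := val_injective hΩ (Lp.ext (hv.trans hw.symm))
  filter_upwards [hw'] with x hx
  rw [EuclideanSpace.norm_eq]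
  refine Real.sqrt_le_sqrt (Finset.sum_le_sum fun i _ => ?_)
  refine pow_le_pow_left₀ (norm_nonneg _) ?_ 2
  rw [hx i]
  simpa using norm_lineDeriv_le_of_lipschitz ℝ hg (x₀ := x) (v := EuclideanSpace.single i 1)

/-! ### Estimates for test functions -/

theorem IsTestFun.add {φ ψ : Eucl d → ℝ} (hφ : IsTestFun Ω φ) (hψ : IsTestFun Ω ψ) :
    IsTestFun Ω (φ + ψ) :=
  ⟨hφ.1.add hψ.1, hφ.2.1.add hψ.2.1,
    (tsupport_add φ ψ).trans (Set.union_subset hφ.2.2 hψ.2.2)⟩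

theorem IsTestFun.const_smul {φ : Eucl d → ℝ} (hφ : IsTestFun Ω φ) (c : ℝ) :
    IsTestFun Ω (c • φ) :=
  ⟨hφ.1.const_smul c, hφ.2.1.smul_left (f := fun _ => c),
    (tsupport_smul_subset_right (fun _ => c) φ).trans hφ.2.2⟩

theorem isTestFun_zero : IsTestFun Ω (0 : Eucl d → ℝ) :=
  ⟨contDiff_const, HasCompactSupport.zero, by simp [tsupport]⟩

/-- The elements of `H¹(Ω)` given by test functions form a linear space. -/
def testSubmodule (Ω : Set (Eucl d)) : Submodule ℝ (H1 Ω) where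
  carrier := smoothCompact Ω
  zero_mem' := ⟨0, isTestFun_zero, Lp.coeFn_zero ℝ 2 _⟩
  add_mem' := by
    rintro u v ⟨φ, hφ, hu⟩ ⟨ψ, hψ, hv⟩
    refine ⟨φ + ψ, hφ.add hψ, ?_⟩
    filter_upwards [Lp.coeFn_add (val u) (val v), hu, hv] with x h1 h2 h3
    exact h1.trans (by simp [h2, h3])
  smul_mem' := by
    rintro c u ⟨φ, hφ, hu⟩
    refine ⟨c • φ, hφ.const_smul c, ?_⟩
    filter_upwards [Lp.coeFn_smul c (val u), hu] with x h1 h2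
    exact h1.trans (by simp [h2])

theorem H10_eq : H10 Ω = (testSubmodule Ω).topologicalClosure := by
  rw [H10]
  congr 1
  exact Submodule.span_eq (testSubmodule Ω)

theorem isClosed_H10 (Ω : Set (Eucl d)) : IsClosed (H10 Ω : Set (H1 Ω)) :=
  Submodule.isClosed_topologicalClosure _

theorem smoothCompact_subset : smoothCompact Ω ⊆ H10 Ω := fun _ h =>
  Submodule.le_topologicalClosure _ (Submodule.subset_span h)

theorem H10_induction {P : H1 Ω → Prop} (hP : IsClosed {u | P u})
    (h : ∀ u ∈ smoothCompact Ω, P u) {u : H1 Ω} (hu : u ∈ H10 Ω) : P u := by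
  rw [H10_eq] at hu
  exact closure_minimal (s := (testSubmodule Ω : Set (H1 Ω))) (t := {u | P u}) h hP hu

/-! ### Translation estimates and the Poincaré inequality -/

/-- Jensen's inequality on the unit interval, from the nonnegativity of the variance. -/
theorem sq_integral_le {h : ℝ → ℝ} (hc : Continuous h) :
    (∫ s in (0 : ℝ)..1, h s) ^ 2 ≤ ∫ s in (0 : ℝ)..1, h s ^ 2 := by
  set c := ∫ s in (0 : ℝ)..1, h s with hcdef
  have h0 : 0 ≤ ∫ s in (0 : ℝ)..1, (h s - c) ^ 2 :=
    intervalIntegral.integral_nonneg zero_le_one fun _ _ => sq_nonneg _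
  have h1 : ∫ s in (0 : ℝ)..1, (h s - c) ^ 2 =
      (∫ s in (0 : ℝ)..1, h s ^ 2) - 2 * c * c + c ^ 2 := by
    have e : ∀ s, (h s - c) ^ 2 = h s ^ 2 - 2 * c * h s + c ^ 2 := fun s => by ring
    simp only [e]
    rw [intervalIntegral.integral_add, intervalIntegral.integral_sub,
      intervalIntegral.integral_const_mul, ← hcdef]
    · simp
    all_goals exact Continuous.intervalIntegrable (by fun_prop) _ _
  nlinarith

/-- The fundamental theorem of calculus along the segment from `x` to its translate, followed by
Jensen's inequality. -/
theorem sub_sq_le {φ : Eucl d → ℝ} (hφ : ContDiff ℝ ∞ φ) (i : Fin d) (τ : ℝ) (x : Eucl d) :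
    (φ x - φ (x - τ • EuclideanSpace.single i 1)) ^ 2 ≤
      τ ^ 2 * ∫ s in (0 : ℝ)..1, partialDeriv φ i (x - (s * τ) • EuclideanSpace.single i 1) ^ 2 := by
  have hpc : Continuous (partialDeriv φ i) :=
    (hφ.continuous_fderiv (by simp)).clm_apply continuous_const
  have hcont : Continuous fun s : ℝ =>
      partialDeriv φ i (x - (s * τ) • EuclideanSpace.single i 1) :=
    hpc.comp (by fun_prop)
  have hd : ∀ s : ℝ, HasDerivAt (fun s : ℝ => φ (x - (s * τ) • EuclideanSpace.single i 1))
      (-τ * partialDeriv φ i (x - (s * τ) • EuclideanSpace.single i 1)) s := by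
    intro s
    have h1 : HasDerivAt (fun s : ℝ => x - (s * τ) • (EuclideanSpace.single i 1 : Eucl d))
        (-(τ • (EuclideanSpace.single i 1 : Eucl d))) s := by
      have := (((hasDerivAt_id s).mul_const τ).smul_const
        (EuclideanSpace.single i 1 : Eucl d)).const_sub x
      simpa using this
    have h2 := ((hφ.differentiable (by simp) _).hasFDerivAt
      (x := x - (s * τ) • (EuclideanSpace.single i 1 : Eucl d))).comp_hasDerivAt s h1
    refine h2.congr_deriv ?_
    rw [map_neg, map_smul, smul_eq_mul, neg_mul, partialDeriv]
  have hint := intervalIntegral.integral_eq_sub_of_hasDerivAt (a := 0) (b := 1) (fun s _ => hd s)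
    (Continuous.intervalIntegrable (by fun_prop) _ _)
  rw [intervalIntegral.integral_const_mul] at hint
  have e : φ x - φ (x - τ • EuclideanSpace.single i 1) =
      τ * ∫ s in (0 : ℝ)..1, partialDeriv φ i (x - (s * τ) • EuclideanSpace.single i 1) := by
    have : φ (x - (1 * τ) • EuclideanSpace.single i 1) - φ (x - ((0 : ℝ) * τ) • EuclideanSpace.single i 1)
      = φ (x - τ • EuclideanSpace.single i 1) - φ x := by simp
    linarith
  rw [e, mul_pow]
  exact mul_le_mul_of_nonneg_left (sq_integral_le hcont) (sq_nonneg _)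

/-- Where the translate of `φ` vanishes, the difference quotient estimate controls `φ` itself.
Integrating over `Q`, Tonelli's theorem and translation invariance remove the parameter of the
segment. -/
theorem setLIntegral_sq_le {φ : Eucl d → ℝ} (hφ : ContDiff ℝ ∞ φ) (i : Fin d) (τ : ℝ)
    {Q : Set (Eucl d)} (hQ : MeasurableSet Q)
    (h0 : ∀ x ∈ Q, φ (x - τ • EuclideanSpace.single i 1) = 0) :
    ∫⁻ x in Q, ENNReal.ofReal (φ x ^ 2) ≤
      ENNReal.ofReal (τ ^ 2) * ∫⁻ x, ENNReal.ofReal (partialDeriv φ i x ^ 2) := by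
  have hpc : Continuous (partialDeriv φ i) :=
    (hφ.continuous_fderiv (by simp)).clm_apply continuous_const
  have hpt : ∀ x ∈ Q, ENNReal.ofReal (φ x ^ 2) ≤ ENNReal.ofReal (τ ^ 2) *
      ∫⁻ s in Set.Ioc (0 : ℝ) 1,
        ENNReal.ofReal (partialDeriv φ i (x - (s * τ) • EuclideanSpace.single i 1) ^ 2) := by
    intro x hx
    have h1 := sub_sq_le hφ i τ x
    rw [h0 x hx, sub_zero] at h1
    refine (ENNReal.ofReal_le_ofReal h1).trans ?_
    rw [ENNReal.ofReal_mul (sq_nonneg _), intervalIntegral.integral_of_le zero_le_one,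
      ofReal_integral_eq_lintegral_ofReal]
    · refine Continuous.integrableOn_Ioc ?_
      exact (hpc.comp (by fun_prop)).pow 2
    · exact Filter.Eventually.of_forall fun _ => sq_nonneg _
  calc ∫⁻ x in Q, ENNReal.ofReal (φ x ^ 2)
      ≤ ∫⁻ x in Q, ENNReal.ofReal (τ ^ 2) * ∫⁻ s in Set.Ioc (0 : ℝ) 1,
          ENNReal.ofReal (partialDeriv φ i (x - (s * τ) • EuclideanSpace.single i 1) ^ 2) :=
        setLIntegral_mono' hQ hpt
    _ ≤ ∫⁻ x, ENNReal.ofReal (τ ^ 2) * ∫⁻ s in Set.Ioc (0 : ℝ) 1,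
          ENNReal.ofReal (partialDeriv φ i (x - (s * τ) • EuclideanSpace.single i 1) ^ 2) :=
        setLIntegral_le_lintegral _ _
    _ = ENNReal.ofReal (τ ^ 2) * ∫⁻ s in Set.Ioc (0 : ℝ) 1, ∫⁻ x,
          ENNReal.ofReal (partialDeriv φ i (x - (s * τ) • EuclideanSpace.single i 1) ^ 2) := by
        rw [lintegral_const_mul' _ _ ENNReal.ofReal_ne_top, lintegral_lintegral_swap]
        refine Measurable.aemeasurable ?_
        refine ENNReal.measurable_ofReal.comp ?_
        refine Continuous.measurable ?_
        exact (hpc.comp (by fun_prop)).pow 2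
    _ = ENNReal.ofReal (τ ^ 2) * ∫⁻ x, ENNReal.ofReal (partialDeriv φ i x ^ 2) := by
        congr 1
        have : ∀ s : ℝ, ∫⁻ x, ENNReal.ofReal
            (partialDeriv φ i (x - (s * τ) • EuclideanSpace.single i 1) ^ 2) =
            ∫⁻ x, ENNReal.ofReal (partialDeriv φ i x ^ 2) := fun s =>
          lintegral_sub_right_eq_self (fun x => ENNReal.ofReal (partialDeriv φ i x ^ 2)) _
        simp [this]

/-- Functions in `H¹₀(Ω)` are small in a set from which one leaves `Ω` by a short translation. -/
theorem norm_resL_le_of_translate (hΩ : IsOpen Ω) (hb : Bornology.IsBounded Ω) (i : Fin d) (τ : ℝ)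
    {Q : Set (Eucl d)} (hQ : MeasurableSet Q) (hQΩ : Q ⊆ Ω)
    (hτ : ∀ x ∈ Q, x - τ • EuclideanSpace.single i 1 ∉ Ω) {v : H1 Ω} (hv : v ∈ H10 Ω) :
    ‖resL Ω Q (val v)‖ ≤ |τ| * ‖grad v‖ := by
  refine H10_induction (P := fun v => ‖resL Ω Q (val v)‖ ≤ |τ| * ‖grad v‖) ?_ ?_ hv
  · exact isClosed_le ((resL Ω Q).continuous.comp (valL Ω).continuous).norm
      (continuous_const.mul (gradL Ω).continuous.norm)
  rintro u ⟨φ, hφ, hu⟩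
  obtain ⟨D, hD⟩ := ContDiff.lipschitzWith_of_hasCompactSupport hφ.2.1 hφ.1 (by simp)
  obtain ⟨w, hw, hw'⟩ := exists_H1_of_lipschitz hΩ hb hD
  obtain rfl : u = w := val_injective hΩ (Lp.ext (hu.trans hw.symm))
  have hld : ∀ x, lineDeriv ℝ φ x (EuclideanSpace.single i 1) = partialDeriv φ i x := fun x =>
    (hφ.1.differentiable (by simp) x).lineDeriv_eq_fderiv
  have h0 : ∀ x, x ∉ Ω → φ x = 0 := fun x hx => by
    by_contra h
    exact hx (hφ.2.2 (subset_tsupport _ h))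
  have h0' : ∀ x, x ∉ Ω → partialDeriv φ i x = 0 := fun x hx => by
    have : fderiv ℝ φ x = 0 := by
      by_contra h
      exact hx (hφ.2.2 (support_fderiv_subset ℝ h))
    simp [partialDeriv, this]
  have key := setLIntegral_sq_le hφ.1 i τ hQ fun x hx => h0 _ (hτ x hx)
  have i1 : Integrable (fun x => φ x ^ 2) (volume : Measure (Eucl d)) :=
    (hφ.1.continuous.memLp_of_hasCompactSupport hφ.2.1).integrable_sq
  have i2 : Integrable (fun x => partialDeriv φ i x ^ 2) (volume : Measure (Eucl d)) :=
    ((hφ.continuous_partialDeriv i).memLp_of_hasCompactSupport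
      (hφ.2.1.fderiv_apply (𝕜 := ℝ) (EuclideanSpace.single i 1))).integrable_sq
  rw [← ofReal_integral_eq_lintegral_ofReal i1.integrableOn
      (Filter.Eventually.of_forall fun _ => sq_nonneg _),
    ← ofReal_integral_eq_lintegral_ofReal i2 (Filter.Eventually.of_forall fun _ => sq_nonneg _),
    ← ENNReal.ofReal_mul (sq_nonneg _), ENNReal.ofReal_le_ofReal_iff
      (mul_nonneg (sq_nonneg _) (integral_nonneg fun _ => sq_nonneg _))] at key
  have e1 : ‖resL Ω Q (val u)‖ ^ 2 = ∫ x in Q, φ x ^ 2 := by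
    rw [norm_resL_sq hQ hQΩ]
    refine integral_congr_ae ?_
    filter_upwards [ae_restrict_of_ae_restrict_of_subset hQΩ hu] with x hx
    simp [hx]
  have e2 : ∫ x, partialDeriv φ i x ^ 2 ≤ ‖grad u‖ ^ 2 := by
    rw [← setIntegral_eq_integral_of_forall_compl_eq_zero (s := Ω)
        (fun x hx => by rw [h0' x hx]; simp), norm_sq_eq_integral]
    refine integral_mono_ae i2.integrableOn
      ((memLp_two_iff_integrable_sq_norm (Lp.aestronglyMeasurable _)).1 (Lp.memLp _)) ?_
    filter_upwards [hw'] with x hx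
    rw [← hld, ← hx i, EuclideanSpace.norm_sq_eq]
    simpa using Finset.single_le_sum (f := fun j => ‖grad u x j‖ ^ 2)
      (fun j _ => sq_nonneg _) (Finset.mem_univ i)
  refine abs_le_of_sq_le_sq' ?_ (by positivity) |>.2
  rw [e1, mul_pow, sq_abs]
  exact key.trans (mul_le_mul_of_nonneg_left e2 (sq_nonneg _))

theorem exists_poincare (hd : 0 < d) (hΩ : IsOpen Ω) (hb : Bornology.IsBounded Ω) :
    ∃ C : ℝ, 0 ≤ C ∧ ∀ v ∈ H10 Ω, ‖val v‖ ≤ C * ‖grad v‖ := by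
  obtain ⟨B, hB⟩ := hb.exists_norm_le
  -- `Ω` lies in the ball of radius `|B|`, so a shift by `2|B| + 1` takes every point of `Ω`
  -- outside. The translation estimate then applies with `Q = Ω`.
  refine ⟨|2 * |B| + 1|, abs_nonneg _, fun v hv => ?_⟩
  have h := norm_resL_le_of_translate hΩ hb ⟨0, hd⟩ (2 * |B| + 1) hΩ.measurableSet subset_rfl
    (fun x hx hx' => ?_) hv
  · refine le_trans (le_of_eq ?_) h
    rw [← sq_eq_sq₀ (norm_nonneg _) (norm_nonneg _), norm_resL_sq hΩ.measurableSet subset_rfl,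
      norm_sq_eq_integral]
  · have h1 := hB x hx
    have h2 := hB _ hx'
    have h3 : ‖(2 * |B| + 1) • (EuclideanSpace.single (⟨0, hd⟩ : Fin d) (1 : ℝ))‖ = 2 * |B| + 1 := by
      rw [norm_smul]
      simp [abs_of_nonneg (by positivity : (0 : ℝ) ≤ 2 * |B| + 1)]
    have h4 := norm_sub_le x (x - (2 * |B| + 1) • EuclideanSpace.single (⟨0, hd⟩ : Fin d) (1 : ℝ))
    rw [sub_sub_cancel, h3] at h4
    have h5 := le_abs_self B
    linarith

/-! ### Lipschitz functions vanishing on the boundary belong to `H¹₀(Ω)` -/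

open scoped Convolution in
/-- Mollification of a Lipschitz function whose support is a compact subset of `Ω`. -/
theorem exists_testFun_approx (hΩ : IsOpen Ω) {K : NNReal} {f : Eucl d → ℝ} (hf : LipschitzWith K f)
    {S : Set (Eucl d)} (hS : IsCompact S) (hSΩ : S ⊆ Ω) (hfS : Function.support f ⊆ S)
    {η : ℝ} (hη : 0 < η) :
    ∃ φ : Eucl d → ℝ, IsTestFun Ω φ ∧ LipschitzWith K φ ∧ ∀ x, |φ x - f x| ≤ η := by
  obtain ⟨r, hr, hrΩ⟩ := hS.exists_cthickening_subset_open hΩ hSΩ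
  -- The mollification radius is at most `r`, which keeps the support inside `Ω`, and at most `η /
  -- (K + 1)`, which makes the uniform error at most `η`. The `+ 1` covers `K = 0`.
  have hδ : 0 < min r (η / (K + 1)) := lt_min hr (by positivity)
  set δ := min r (η / (K + 1)) with hδdef
  let b : ContDiffBump (0 : Eucl d) := ⟨δ / 2, δ, by positivity, by linarith⟩
  have hbc : Continuous (b.normed volume) := b.continuous_normed
  have hbs : HasCompactSupport (b.normed (volume : Measure (Eucl d))) := b.hasCompactSupport_normed
  have hint : ∀ x, Integrable (fun t => b.normed volume t * f (x - t))
      (volume : Measure (Eucl d)) := fun x =>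
    (hbc.mul (hf.continuous.comp (continuous_const.sub continuous_id))).integrable_of_hasCompactSupport
      hbs.mul_right
  have happ : ∀ x, (b.normed volume ⋆[ContinuousLinearMap.lsmul ℝ ℝ, volume] f) x =
      ∫ t, b.normed volume t * f (x - t) := fun x => rfl
  have hsupp : tsupport (b.normed volume ⋆[ContinuousLinearMap.lsmul ℝ ℝ, volume] f) ⊆
      Metric.cthickening r S := by
    refine closure_minimal ?_ Metric.isClosed_cthickening
    refine (support_convolution_subset _).trans ?_
    rintro _ ⟨y, hy, x, hx, rfl⟩
    rw [b.support_normed_eq, mem_ball_zero_iff] at hy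
    refine Metric.mem_cthickening_of_dist_le (y + x) x r S (hfS hx) ?_
    rw [dist_eq_norm, add_sub_cancel_right]
    exact hy.le.trans (min_le_left _ _)
  refine ⟨b.normed volume ⋆[ContinuousLinearMap.lsmul ℝ ℝ, volume] f, ⟨?_, ?_, ?_⟩, ?_, ?_⟩
  · exact hbs.contDiff_convolution_left _ b.contDiff_normed
      hf.continuous.locallyIntegrable
  · exact hS.cthickening.of_isClosed_subset (isClosed_tsupport _) hsupp
  · exact hsupp.trans hrΩ
  · refine LipschitzWith.of_dist_le_mul fun x y => ?_
    rw [happ, happ, dist_eq_norm, ← integral_sub (hint x) (hint y)]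
    have hi : Integrable (fun t => b.normed volume t * (K * dist x y))
        (volume : Measure (Eucl d)) := b.integrable_normed.mul_const _
    refine (norm_integral_le_of_norm_le hi (Filter.Eventually.of_forall fun t => ?_)).trans ?_
    · rw [← mul_sub, norm_mul, Real.norm_of_nonneg (b.nonneg_normed t)]
      refine mul_le_mul_of_nonneg_left ?_ (b.nonneg_normed t)
      rw [← dist_eq_norm]
      simpa using hf.dist_le_mul (x - t) (y - t)
    · rw [integral_mul_const, b.integral_normed, one_mul]
  · intro x
    have h := b.dist_normed_convolution_le (μ := volume) (g := f) (x₀ := x) (ε := η)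
      hf.continuous.aestronglyMeasurable (fun y hy => ?_)
    · rwa [Real.dist_eq] at h
    · refine (hf.dist_le_mul y x).trans ?_
      have h1 : dist y x ≤ η / (K + 1) := (Metric.mem_ball.1 hy).le.trans (min_le_right _ _)
      have h2 : (K : ℝ) * dist y x ≤ (K + 1) * (η / (K + 1)) :=
        mul_le_mul (by linarith) h1 dist_nonneg (by positivity)
      refine h2.trans (le_of_eq ?_)
      field_simp

theorem exists_mem_segment_frontier (hΩ : IsOpen Ω) {x y : Eucl d} (hx : x ∈ closure Ω)
    (hy : y ∉ closure Ω) : ∃ ζ ∈ segment ℝ x y, ζ ∈ frontier Ω := by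
  by_contra! hcon
  rw [hΩ.frontier_eq] at hcon
  have hxΩ : x ∈ Ω := by
    by_contra h
    exact hcon x (left_mem_segment ℝ x y) ⟨hx, h⟩
  obtain ⟨z, -, hz, hz'⟩ := (convex_segment x y).isPreconnected Ω (closure Ω)ᶜ hΩ
    isClosed_closure.isOpen_compl
    (fun z hz => by
      by_contra h
      simp only [Set.mem_union, Set.mem_compl_iff, not_or, not_not] at h
      exact hcon z hz ⟨h.2, h.1⟩)
    ⟨x, left_mem_segment ℝ x y, hxΩ⟩ ⟨y, right_mem_segment ℝ x y, hy⟩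
  exact hz' (subset_closure hz)

/-- A segment from a point of the closure to a point outside crosses the frontier, where `g` is
zero. So extension by zero does not increase the Lipschitz constant. -/
theorem lipschitzWith_indicator (hΩ : IsOpen Ω) {K : NNReal} {g : Eucl d → ℝ}
    (hg : LipschitzOnWith K g (closure Ω)) (h0 : ∀ x ∈ frontier Ω, g x = 0) :
    LipschitzWith K ((closure Ω).indicator g) := by
  have key : ∀ x ∈ closure Ω, ∀ y ∉ closure Ω, |g x| ≤ K * dist x y := by
    intro x hx y hy
    obtain ⟨ζ, hζ, hζ'⟩ := exists_mem_segment_frontier hΩ hx hy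
    have h1 := hg.dist_le_mul x hx ζ (frontier_subset_closure hζ')
    rw [h0 ζ hζ', Real.dist_eq, sub_zero] at h1
    refine h1.trans (mul_le_mul_of_nonneg_left ?_ K.2)
    have := dist_add_dist_of_mem_segment hζ
    linarith [dist_nonneg (x := ζ) (y := y)]
  refine LipschitzWith.of_dist_le_mul fun x y => ?_
  by_cases hx : x ∈ closure Ω <;> by_cases hy : y ∈ closure Ω
  · rw [Set.indicator_of_mem hx, Set.indicator_of_mem hy]
    exact hg.dist_le_mul x hx y hy
  · rw [Set.indicator_of_mem hx, Set.indicator_of_notMem hy, Real.dist_eq, sub_zero]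
    exact key x hx y hy
  · rw [Set.indicator_of_notMem hx, Set.indicator_of_mem hy, dist_comm, Real.dist_eq, sub_zero,
      dist_comm]
    exact key y hy x hx
  · rw [Set.indicator_of_notMem hx, Set.indicator_of_notMem hy, dist_self]
    positivity

/-- The truncation `max (g - ε) 0` is supported in a compact subset of `Ω`, and mollifying it gives
a test function uniformly within `2ε` of `g` on `Ω` with the same Lipschitz constant. Bounded
gradients and `L²`-convergence suffice by `mem_of_bounded_approx`. Nonnegativity of `g` makes the
one-sided truncation enough. -/
theorem mem_H10_of_lipschitz (hΩ : IsOpen Ω) (hb : Bornology.IsBounded Ω) {K : NNReal}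
    {g : Eucl d → ℝ} (hg : LipschitzOnWith K g (closure Ω)) (hpos : ∀ x ∈ closure Ω, 0 ≤ g x)
    (h0 : ∀ x ∈ frontier Ω, g x = 0) {v : H1 Ω} (hv : val v =ᵐ[volume.restrict Ω] g) :
    v ∈ H10 Ω := by
  have hfin : IsFiniteMeasure ((volume : Measure (Eucl d)).restrict Ω) :=
    ⟨by rw [Measure.restrict_apply_univ]; exact hb.measure_lt_top⟩
  obtain ⟨M, hM⟩ := norm_grad_le_of_lipschitz hΩ hb K
  refine mem_of_bounded_approx hΩ (isClosed_H10 Ω) (M := M) fun η hη => ?_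
  set m : ℝ := (measureUnivNNReal ((volume : Measure (Eucl d)).restrict Ω) : ℝ) ^
    (2 : ℝ≥0∞).toReal⁻¹ with hm
  have hm0 : 0 ≤ m := by positivity
  -- `m` is the square root of the measure of `Ω`. A uniform error `2ε` gives the `L²` error `2εm ≤
  -- η`.
  set ε := η / (2 * (m + 1)) with hε
  have hεpos : 0 < ε := by positivity
  have hLip := lipschitzWith_indicator hΩ hg h0
  set f : Eucl d → ℝ := fun x => max ((closure Ω).indicator g x - ε) 0 with hf
  have hfL : LipschitzWith K f := by
    have h1 : LipschitzWith K fun x => (closure Ω).indicator g x - ε :=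
      LipschitzWith.of_dist_le_mul fun x y => by
        rw [dist_sub_right]; exact hLip.dist_le_mul x y
    exact h1.max_const 0
  obtain ⟨φ, hφ, hφL, hφf⟩ := exists_testFun_approx hΩ hfL
    (S := closure Ω ∩ {x | ε ≤ (closure Ω).indicator g x})
    (hb.isCompact_closure.inter_right (isClosed_le continuous_const hLip.continuous))
    (fun x hx => by
      by_contra h
      have hx2 : ε ≤ (closure Ω).indicator g x := hx.2
      rw [Set.indicator_of_mem hx.1, h0 x (by rw [hΩ.frontier_eq]; exact ⟨hx.1, h⟩)] at hx2
      linarith)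
    (fun x hx => by
      have h1 : f x ≠ 0 := hx
      have h2 : ε ≤ (closure Ω).indicator g x := by
        by_contra h
        exact h1 (max_eq_right (by linarith))
      refine ⟨?_, h2⟩
      by_contra h
      rw [Set.indicator_of_notMem h] at h2
      linarith) hεpos
  obtain ⟨w, hw, -⟩ := exists_H1_of_lipschitz hΩ hb hφL
  refine ⟨w, smoothCompact_subset ⟨φ, hφ, hw⟩, hM φ hφL w hw, ?_⟩
  refine (Lp.norm_le_of_ae_bound (C := 2 * ε) (by positivity) ?_).trans ?_
  · filter_upwards [Lp.coeFn_sub (val v) (val w), hv, hw, ae_restrict_mem hΩ.measurableSet]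
      with x h1 h2 h3 hx
    rw [h1, Pi.sub_apply, h2, h3, Real.norm_eq_abs]
    have h4 := abs_le.1 (hφf x)
    have h5 : f x = max (g x - ε) 0 := by
      rw [hf]; simp only [Set.indicator_of_mem (subset_closure hx)]
    have h6 := hpos x (subset_closure hx)
    rcases max_cases (g x - ε) 0 with ⟨h7, h8⟩ | ⟨h7, h8⟩ <;>
    · rw [h7] at h5
      rw [abs_le]
      constructor <;> linarith [h4.1, h4.2]
  · rw [← hm, hε]
    have : m * (2 * (η / (2 * (m + 1)))) = η * (m / (m + 1)) := by field_simp
    rw [this]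
    have : m / (m + 1) ≤ 1 := (div_le_one (by positivity)).2 (by linarith)
    nlinarith

/-! ### Geometry of orthotopes and meshes -/

theorem Orthotope.closed_eq_image (T : Orthotope d) :
    T.closed = (WithLp.toLp 2 : (Fin d → ℝ) → Eucl d) '' Set.Icc T.lo T.hi := by
  ext x
  constructor
  · intro hx
    exact ⟨x.ofLp, ⟨fun i => (hx i).1, fun i => (hx i).2⟩, rfl⟩
  · rintro ⟨y, hy, rfl⟩ i
    exact ⟨hy.1 i, hy.2 i⟩

theorem Orthotope.isCompact_closed (T : Orthotope d) : IsCompact T.closed := by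
  rw [T.closed_eq_image]
  exact isCompact_Icc.image (PiLp.continuous_toLp 2 _)

theorem Orthotope.convex_closed (T : Orthotope d) : Convex ℝ T.closed := by
  intro x hx y hy a b ha hb hab i
  have h1 := hx i
  have h2 := hy i
  have e : (a • x + b • y) i = a * x i + b * y i := by simp
  have e1 := mul_le_mul_of_nonneg_left h1.1 ha
  have e2 := mul_le_mul_of_nonneg_left h1.2 ha
  have e3 := mul_le_mul_of_nonneg_left h2.1 hb
  have e4 := mul_le_mul_of_nonneg_left h2.2 hb
  obtain rfl : b = 1 - a := by linarith
  rw [e]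
  constructor <;> linarith

theorem Orthotope.vertices_subset (T : Orthotope d) : T.vertices ⊆ T.closed := by
  intro x hx i
  have := T.lt i
  rcases hx i with h | h <;> rw [h] <;> constructor <;> linarith

theorem Orthotope.inner_subset_closed (T : Orthotope d) : T.inner ⊆ T.closed :=
  fun _ hx i => ⟨(hx i).1.le, (hx i).2.le⟩

theorem Orthotope.isOpen_inner (T : Orthotope d) : IsOpen T.inner := by
  have : T.inner = ⋂ i, {x : Eucl d | T.lo i < x i ∧ x i < T.hi i} := by
    ext x; simp [Orthotope.inner]
  rw [this]
  refine isOpen_iInter_of_finite fun i => ?_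
  exact (isOpen_lt (f := fun _ : Eucl d => T.lo i) (g := fun x => x i)
    (by fun_prop) (by fun_prop)).inter
    (isOpen_lt (f := fun x : Eucl d => x i) (g := fun _ => T.hi i) (by fun_prop) (by fun_prop))

namespace Mesh

variable (𝒯 : Mesh Ω)

theorem closed_subset {T : Orthotope d} (hT : T ∈ 𝒯.elems) : T.closed ⊆ closure Ω := by
  rw [𝒯.cover]
  exact Set.subset_biUnion_of_mem (u := fun T : Orthotope d => T.closed) hT

theorem exists_mem_closed {x : Eucl d} (hx : x ∈ closure Ω) : ∃ T ∈ 𝒯.elems, x ∈ T.closed := by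
  rw [𝒯.cover] at hx
  simpa using hx

theorem inner_subset (hreg : interior (closure Ω) = Ω) {T : Orthotope d} (hT : T ∈ 𝒯.elems) :
    T.inner ⊆ Ω := by
  rw [← hreg]
  exact interior_maximal (T.inner_subset_closed.trans (𝒯.closed_subset hT)) T.isOpen_inner

theorem isBounded (𝒯 : Mesh Ω) : Bornology.IsBounded Ω := by
  refine Bornology.IsBounded.subset ?_ subset_closure
  rw [𝒯.cover]
  exact (𝒯.elems.finite_toSet.isCompact_biUnion fun T _ => T.isCompact_closed).isBounded

theorem nodes_subset : 𝒯.nodes ⊆ closure Ω := by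
  rintro x ⟨T, hT, hx⟩
  exact 𝒯.closed_subset hT (T.vertices_subset hx)

/-- In each coordinate, the intervals of two elements that meet are equal or touch at an endpoint. -/
theorem interval_eq_or_touch {T T' : Orthotope d} (hT : T ∈ 𝒯.elems) (hT' : T' ∈ 𝒯.elems)
    (h : (T.closed ∩ T'.closed).Nonempty) (i : Fin d) :
    (T.lo i = T'.lo i ∧ T.hi i = T'.hi i) ∨ T.hi i = T'.lo i ∨ T'.hi i = T.lo i := by
  classical
  obtain ⟨⟨L, U, -, hF⟩, ⟨L', U', -, hF'⟩⟩ := 𝒯.conforming T hT T' hT' h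
  obtain ⟨x, hx, hx'⟩ := h
  set F := T.closed ∩ T'.closed with hFdef
  -- changing one coordinate within both intervals stays in the intersection
  have upd : ∀ a, T.lo i ≤ a → a ≤ T.hi i → T'.lo i ≤ a → a ≤ T'.hi i →
      (WithLp.toLp 2 (Function.update x.ofLp i a) : Eucl d) ∈ F := by
    intro a h1 h2 h3 h4
    refine ⟨fun j => ?_, fun j => ?_⟩
    all_goals
      by_cases hj : j = i
      · subst hj; simp [*]
      · have e : (WithLp.toLp 2 (Function.update x.ofLp i a) : Eucl d) j = x j := by
          simp [Function.update_of_ne hj]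
        rw [e]
        first | exact hx j | exact hx' j
  have hlt := T.lt i
  have hlt' := T'.lt i
  have hxi := hx i
  have hxi' := hx' i
  -- If the intersection is flat in direction `i`, both endpoints of the common interval give the
  -- same coordinate. Two nondegenerate intervals with one common point touch at endpoints.
  have one : ∀ c, (∀ y ∈ F, y i = c) → T.hi i = T'.lo i ∨ T'.hi i = T.lo i := by
    intro c hc
    have h1 := hc _ (upd (max (T.lo i) (T'.lo i)) (le_max_left _ _)
      (max_le hlt.le (by linarith)) (le_max_right _ _) (max_le (by linarith) hlt'.le))
    have h2 := hc _ (upd (min (T.hi i) (T'.hi i)) (le_min hlt.le (by linarith)) (min_le_left _ _)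
      (le_min (by linarith) hlt'.le) (min_le_right _ _))
    simp only [Function.update_self] at h1 h2
    rw [← h2] at h1
    rcases max_cases (T.lo i) (T'.lo i) with ⟨e, -⟩ | ⟨e, -⟩ <;>
    rcases min_cases (T.hi i) (T'.hi i) with ⟨e', -⟩ | ⟨e', -⟩ <;>
    rw [e, e'] at h1
    · linarith
    · exact Or.inr h1.symm
    · exact Or.inl h1.symm
    · linarith
  by_cases hi : i ∈ L ∪ U ∪ L' ∪ U'
  · right
    simp only [Finset.mem_union] at hi
    rcases hi with ((hi | hi) | hi) | hi
    · exact one (T.lo i) fun y hy => by rw [hF] at hy; exact hy.2.1 i hi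
    · exact one (T.hi i) fun y hy => by rw [hF] at hy; exact hy.2.2 i hi
    · exact one (T'.lo i) fun y hy => by rw [hF'] at hy; exact hy.2.1 i hi
    · exact one (T'.hi i) fun y hy => by rw [hF'] at hy; exact hy.2.2 i hi
  · left
    simp only [Finset.mem_union, not_or] at hi
    obtain ⟨⟨⟨hL, hU⟩, hL'⟩, hU'⟩ := hi
    -- Neither face description fixes coordinate `i`, so the common face extends over the full
    -- interval of `T` and also over that of `T'`. The two intervals therefore coincide.
    have mem1 : ∀ a, T.lo i ≤ a → a ≤ T.hi i →
        (WithLp.toLp 2 (Function.update x.ofLp i a) : Eucl d) ∈ F := by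
      intro a h1 h2
      have hxF : x ∈ F := ⟨hx, hx'⟩
      rw [hF] at hxF ⊢
      have e : ∀ j, j ≠ i → (WithLp.toLp 2 (Function.update x.ofLp i a) : Eucl d) j = x j :=
        fun j hj => by simp [Function.update_of_ne hj]
      refine ⟨fun j => ?_, fun j hj => ?_, fun j hj => ?_⟩
      · by_cases hj : j = i
        · subst hj; simp [*]
        · rw [e j hj]; exact hx j
      · rw [e j (by rintro rfl; exact hL hj)]; exact hxF.2.1 j hj
      · rw [e j (by rintro rfl; exact hU hj)]; exact hxF.2.2 j hj
    have mem2 : ∀ a, T'.lo i ≤ a → a ≤ T'.hi i →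
        (WithLp.toLp 2 (Function.update x.ofLp i a) : Eucl d) ∈ F := by
      intro a h1 h2
      have hxF : x ∈ F := ⟨hx, hx'⟩
      rw [hF'] at hxF ⊢
      have e : ∀ j, j ≠ i → (WithLp.toLp 2 (Function.update x.ofLp i a) : Eucl d) j = x j :=
        fun j hj => by simp [Function.update_of_ne hj]
      refine ⟨fun j => ?_, fun j hj => ?_, fun j hj => ?_⟩
      · by_cases hj : j = i
        · subst hj; simp [*]
        · rw [e j hj]; exact hx' j
      · rw [e j (by rintro rfl; exact hL' hj)]; exact hxF.2.1 j hj
      · rw [e j (by rintro rfl; exact hU' hj)]; exact hxF.2.2 j hj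
    have a1 := (mem1 (T.lo i) le_rfl hlt.le).2 i
    have a2 := (mem1 (T.hi i) hlt.le le_rfl).2 i
    have a3 := (mem2 (T'.lo i) le_rfl hlt'.le).1 i
    have a4 := (mem2 (T'.hi i) hlt'.le le_rfl).1 i
    simp only [Function.update_self] at a1 a2 a3 a4
    exact ⟨le_antisymm a3.1 a1.1, le_antisymm a2.2 a4.2⟩

/-- There are no hanging nodes: in each coordinate the intervals agree or touch, and in either case
the coordinate of `p` is an endpoint for `T'`. -/
theorem mem_vertices {T T' : Orthotope d} (hT : T ∈ 𝒯.elems) (hT' : T' ∈ 𝒯.elems) {p : Eucl d}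
    (hp : p ∈ T.vertices) (hp' : p ∈ T'.closed) : p ∈ T'.vertices := by
  intro i
  have h1 := hp i
  have h2 := T.vertices_subset hp i
  have h3 := hp' i
  rcases 𝒯.interval_eq_or_touch hT hT' ⟨p, T.vertices_subset hp, hp'⟩ i with ⟨e1, e2⟩ | e | e
  · rwa [e1, e2] at h1
  · left; linarith
  · right; linarith

end Mesh

/-! ### Multilinear functions -/

theorem exists_affine_update (c : Finset (Fin d) → ℝ) (x : Fin d → ℝ) (i : Fin d) :
    ∃ A B : ℝ, ∀ a, ∑ s : Finset (Fin d), c s * ∏ j ∈ s, Function.update x i a j = A + a * B := by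
  classical
  have h : ∀ s : Finset (Fin d), ∃ A B : ℝ, ∀ a,
      c s * ∏ j ∈ s, Function.update x i a j = A + a * B := by
    intro s
    by_cases hi : i ∈ s
    · refine ⟨0, c s * ∏ j ∈ s \ {i}, x j, fun a => ?_⟩
      rw [Finset.prod_update_of_mem hi]; ring
    · refine ⟨c s * ∏ j ∈ s, x j, 0, fun a => ?_⟩
      rw [Finset.prod_update_of_notMem hi]; ring
  choose A B hAB using h
  refine ⟨∑ s, A s, ∑ s, B s, fun a => ?_⟩
  rw [Finset.mul_sum, ← Finset.sum_add_distrib]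
  exact Finset.sum_congr rfl fun s _ => hAB s a

/-- Coordinates are released from the endpoints one at a time. In a single variable the function is
affine, and an affine function with two zeros vanishes. -/
theorem multilinear_eq_zero {c : Finset (Fin d) → ℝ} {lo hi : Fin d → ℝ} (hlt : ∀ i, lo i < hi i)
    (h : ∀ x : Fin d → ℝ, (∀ i, x i = lo i ∨ x i = hi i) →
      ∑ s : Finset (Fin d), c s * ∏ j ∈ s, x j = 0) (x : Fin d → ℝ) :
    ∑ s : Finset (Fin d), c s * ∏ j ∈ s, x j = 0 := by
  classical
  suffices H : ∀ (U : Finset (Fin d)) (x : Fin d → ℝ), (∀ i, i ∉ U → x i = lo i ∨ x i = hi i) →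
      ∑ s : Finset (Fin d), c s * ∏ j ∈ s, x j = 0 from
    H Finset.univ x fun i hi => absurd (Finset.mem_univ i) hi
  intro U
  induction U using Finset.induction_on with
  | empty => exact fun x hx => h x fun i => hx i (Finset.notMem_empty i)
  | insert i U hiU ih =>
    intro x hx
    obtain ⟨A, B, hAB⟩ := exists_affine_update c x i
    have hz : ∀ a, a = lo i ∨ a = hi i → A + a * B = 0 := by
      intro a ha
      rw [← hAB]
      refine ih _ fun j hj => ?_
      by_cases hji : j = i
      · subst hji; simpa using ha
      · rw [Function.update_of_ne hji]
        exact hx j (by simp [hji, hj])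
    have h1 := hz (lo i) (Or.inl rfl)
    have h2 := hz (hi i) (Or.inr rfl)
    have hB : B = 0 := by
      have : (hi i - lo i) * B = 0 := by linarith
      rcases mul_eq_zero.1 this with h3 | h3
      · linarith [hlt i]
      · exact h3
    have := hAB (x i)
    rw [Function.update_eq_self] at this
    rw [this]
    subst hB
    linarith

/-- A `Q¹` function is determined by its nodal values. -/
theorem Mesh.IsQ1.eq_zero {𝒯 : Mesh Ω} {g : Eucl d → ℝ} (hg : 𝒯.IsQ1 g)
    (h0 : ∀ q ∈ 𝒯.nodes, g q = 0) : ∀ x ∈ closure Ω, g x = 0 := by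
  intro x hx
  obtain ⟨T, hT, hxT⟩ := 𝒯.exists_mem_closed hx
  obtain ⟨c, hc⟩ := hg.2 T hT
  rw [hc x hxT]
  refine multilinear_eq_zero T.lt (fun y hy => ?_) x
  have hyv : (WithLp.toLp 2 y : Eucl d) ∈ T.vertices := hy
  have := hc _ (T.vertices_subset hyv)
  rw [h0 _ ⟨T, hT, hyv⟩] at this
  exact this.symm

theorem Mesh.IsQ1.add {𝒯 : Mesh Ω} {g k : Eucl d → ℝ} (hg : 𝒯.IsQ1 g) (hk : 𝒯.IsQ1 k) :
    𝒯.IsQ1 fun x => g x + k x := by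
  refine ⟨hg.1.add hk.1, fun T hT => ?_⟩
  obtain ⟨c, hc⟩ := hg.2 T hT
  obtain ⟨e, he⟩ := hk.2 T hT
  refine ⟨fun s => c s + e s, fun x hx => ?_⟩
  simp only [hc x hx, he x hx, ← Finset.sum_add_distrib, add_mul]

theorem Mesh.IsQ1.const_mul {𝒯 : Mesh Ω} {g : Eucl d → ℝ} (hg : 𝒯.IsQ1 g) (a : ℝ) :
    𝒯.IsQ1 fun x => a * g x := by
  refine ⟨hg.1.const_mul a, fun T hT => ?_⟩
  obtain ⟨c, hc⟩ := hg.2 T hT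
  refine ⟨fun s => a * c s, fun x hx => ?_⟩
  simp only [hc x hx, Finset.mul_sum, mul_assoc]

theorem Mesh.isQ1_zero {𝒯 : Mesh Ω} : 𝒯.IsQ1 fun _ => 0 :=
  ⟨continuousOn_const, fun _ _ => ⟨fun _ => 0, by simp⟩⟩

theorem Mesh.isQ1_sum {𝒯 : Mesh Ω} {ι : Type*} (s : Finset ι) {g : ι → Eucl d → ℝ}
    (hg : ∀ i ∈ s, 𝒯.IsQ1 (g i)) : 𝒯.IsQ1 fun x => ∑ i ∈ s, g i x := by
  classical
  induction s using Finset.induction_on with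
  | empty => simpa using Mesh.isQ1_zero
  | insert i s hi ih =>
    simp only [Finset.sum_insert hi]
    exact (hg i (by simp)).add (ih fun j hj => hg j (by simp [hj]))

/-! ### Piecewise multilinear functions are Lipschitz continuous -/

theorem IsMultilinearOn.exists_lipschitzOnWith {g : Eucl d → ℝ} {T : Orthotope d}
    (hg : IsMultilinearOn g T.closed) : ∃ K, LipschitzOnWith K g T.closed := by
  obtain ⟨c, hc⟩ := hg
  have hs : ContDiff ℝ 1 fun x : Eucl d => ∑ s : Finset (Fin d), c s * ∏ i ∈ s, x i := by
    refine ContDiff.sum fun s _ => contDiff_const.mul (contDiff_prod fun i _ => ?_)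
    fun_prop
  obtain ⟨K, hK⟩ := hs.contDiffOn.exists_lipschitzOnWith (by simp) T.convex_closed T.isCompact_closed
  refine ⟨K, fun x hx y hy => ?_⟩
  rw [hc x hx, hc y hy]
  exact hK hx hy

/-- Two points in orthotopes that meet are joined through the intersection at a cost comparable to
their distance. -/
theorem exists_mem_inter_dist_le {T T' : Orthotope d} (h : (T.closed ∩ T'.closed).Nonempty)
    {x y : Eucl d} (hx : x ∈ T.closed) (hy : y ∈ T'.closed) :
    ∃ w ∈ T.closed ∩ T'.closed, dist x w ≤ dist x y := by
  obtain ⟨q, hq, hq'⟩ := h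
  -- The witness is `x` clamped to `T'` coordinate by coordinate. It stays in `T` because the two
  -- intervals overlap, and no coordinate moves farther than the distance to `y`.
  refine ⟨WithLp.toLp 2 fun i => max (T'.lo i) (min (x i) (T'.hi i)), ⟨fun i => ?_, fun i => ?_⟩, ?_⟩
  · have h1 := hx i
    have h2 := hq i
    have h3 := hq' i
    exact ⟨le_max_of_le_right (le_min h1.1 (h2.1.trans h3.2)),
      max_le (h3.1.trans h2.2) ((min_le_left _ _).trans h1.2)⟩
  · exact ⟨le_max_left _ _, max_le (T'.lt i).le (min_le_right _ _)⟩
  · rw [EuclideanSpace.dist_eq, EuclideanSpace.dist_eq]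
    refine Real.sqrt_le_sqrt (Finset.sum_le_sum fun i _ => ?_)
    refine pow_le_pow_left₀ dist_nonneg ?_ 2
    have h1 := hy i
    simp only [Real.dist_eq]
    rcases le_total (x i) (T'.hi i) with h2 | h2
    · rw [min_eq_left h2]
      rcases le_total (T'.lo i) (x i) with h3 | h3
      · rw [max_eq_right h3]; simp
      · rw [max_eq_left h3, abs_sub_comm, abs_of_nonneg (by linarith), abs_sub_comm,
          abs_of_nonneg (by linarith)]
        linarith
    · rw [min_eq_right h2, max_eq_right (T'.lt i).le, abs_of_nonneg (by linarith),
        abs_of_nonneg (by linarith)]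
      linarith

theorem Mesh.exists_lipschitzOnWith (𝒯 : Mesh Ω) {g : Eucl d → ℝ}
    (hg : ∀ T ∈ 𝒯.elems, IsMultilinearOn g T.closed) : ∃ K, LipschitzOnWith K g (closure Ω) := by
  have hpair : ∀ T ∈ 𝒯.elems, ∀ T' ∈ 𝒯.elems, ∀ᶠ K : NNReal in Filter.atTop,
      ∀ x ∈ T.closed, ∀ y ∈ T'.closed, dist (g x) (g y) ≤ K * dist x y := by
    intro T hT T' hT'
    obtain ⟨K, hK⟩ := (hg T hT).exists_lipschitzOnWith
    obtain ⟨K', hK'⟩ := (hg T' hT').exists_lipschitzOnWith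
    suffices h : ∃ B : NNReal, ∀ x ∈ T.closed, ∀ y ∈ T'.closed, dist (g x) (g y) ≤ B * dist x y by
      obtain ⟨B, hB⟩ := h
      filter_upwards [Filter.eventually_ge_atTop B] with k hk x hx y hy
      exact (hB x hx y hy).trans (mul_le_mul_of_nonneg_right (by exact_mod_cast hk) dist_nonneg)
    by_cases hne : (T.closed ∩ T'.closed).Nonempty
    -- The intermediate point satisfies `dist x w ≤ dist x y`, hence `dist w y ≤ 2 * dist x y`.
    · refine ⟨K + 2 * K', fun x hx y hy => ?_⟩
      obtain ⟨w, hw, hxw⟩ := exists_mem_inter_dist_le hne hx hy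
      have h1 := hK.dist_le_mul x hx w hw.1
      have h2 := hK'.dist_le_mul w hw.2 y hy
      have h3 := dist_triangle (g x) (g w) (g y)
      have h4 := dist_triangle w x y
      rw [dist_comm w x] at h4
      have h5 : (K : ℝ) * dist x w ≤ K * dist x y := mul_le_mul_of_nonneg_left hxw K.2
      have h6 : (K' : ℝ) * dist w y ≤ K' * (2 * dist x y) :=
        mul_le_mul_of_nonneg_left (by linarith) K'.2
      push_cast
      linarith
    · have hdisj : Disjoint T.closed T'.closed := by
        rw [Set.disjoint_iff_inter_eq_empty]
        exact Set.not_nonempty_iff_eq_empty.1 hne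
      obtain ⟨r, hr, hrd⟩ := Metric.exists_pos_forall_lt_edist T.isCompact_closed
        T'.isCompact_closed.isClosed hdisj
      obtain ⟨M, hM⟩ := (T.isCompact_closed.image_of_continuousOn hK.continuousOn).isBounded.exists_norm_le
      obtain ⟨M', hM'⟩ :=
        (T'.isCompact_closed.image_of_continuousOn hK'.continuousOn).isBounded.exists_norm_le
      refine ⟨(|M| + |M'|).toNNReal / r, fun x hx y hy => ?_⟩
      have h1 : (r : ℝ) < dist x y := by
        have := hrd x hx y hy
        rw [edist_nndist] at this
        exact_mod_cast this
      have h2 := hM _ ⟨x, hx, rfl⟩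
      have h3 := hM' _ ⟨y, hy, rfl⟩
      have hr' : (0 : ℝ) < r := by exact_mod_cast hr
      rw [NNReal.coe_div, Real.coe_toNNReal _ (by positivity)]
      have h4 : dist (g x) (g y) ≤ |M| + |M'| := by
        rw [dist_eq_norm]
        exact (norm_sub_le _ _).trans (add_le_add (h2.trans (le_abs_self _)) (h3.trans (le_abs_self _)))
      refine h4.trans ?_
      rw [div_mul_eq_mul_div, le_div_iff₀ hr']
      exact mul_le_mul_of_nonneg_left h1.le (by positivity)
  have hall : ∀ᶠ K : NNReal in Filter.atTop, ∀ T ∈ 𝒯.elems, ∀ T' ∈ 𝒯.elems,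
      ∀ x ∈ T.closed, ∀ y ∈ T'.closed, dist (g x) (g y) ≤ K * dist x y := by
    rw [Filter.eventually_all_finset]
    intro T hT
    rw [Filter.eventually_all_finset]
    exact hpair T hT
  obtain ⟨K, hK⟩ := hall.exists
  refine ⟨K, LipschitzOnWith.of_dist_le_mul fun x hx y hy => ?_⟩
  obtain ⟨T, hT, hxT⟩ := 𝒯.exists_mem_closed hx
  obtain ⟨T', hT', hyT'⟩ := 𝒯.exists_mem_closed hy
  exact hK T hT T' hT' x hxT y hyT'

theorem Mesh.IsQ1.exists_H1 {𝒯 : Mesh Ω} (hΩ : IsOpen Ω) {g : Eucl d → ℝ} (hg : 𝒯.IsQ1 g) :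
    ∃ v : H1 Ω, val v =ᵐ[volume.restrict Ω] g := by
  obtain ⟨K, hK⟩ := 𝒯.exists_lipschitzOnWith hg.2
  obtain ⟨f, hf, hfg⟩ := hK.extend_real
  obtain ⟨v, hv, -⟩ := exists_H1_of_lipschitz hΩ 𝒯.isBounded hf
  refine ⟨v, hv.trans ?_⟩
  filter_upwards [ae_restrict_mem hΩ.measurableSet] with x hx
  exact (hfg (subset_closure hx)).symm

/-! ### Hat functions -/

open Classical in
/-- The hat function of `p` on the element `T`. -/
def localHat (p : Eucl d) (T : Orthotope d) (x : Eucl d) : ℝ :=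
  if p ∈ T.vertices then ∏ i, (1 - |x i - p i| / (T.hi i - T.lo i)) else 0

theorem localHat_factor_eq_zero {T : Orthotope d} {p x : Eucl d} (hp : p ∈ T.vertices) {i : Fin d}
    (hx : x i = T.lo i ∨ x i = T.hi i) (hne : x i ≠ p i) :
    1 - |x i - p i| / (T.hi i - T.lo i) = 0 := by
  have hlt := T.lt i
  have : |x i - p i| = T.hi i - T.lo i := by
    rcases hx with h1 | h1 <;> rcases hp i with h2 | h2
    · exact absurd (h1.trans h2.symm) hne
    · rw [h1, h2, abs_sub_comm, abs_of_pos (by linarith)]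
    · rw [h1, h2, abs_of_pos (by linarith)]
    · exact absurd (h1.trans h2.symm) hne
  rw [this, div_self (by linarith), sub_self]

theorem localHat_eq_zero {T : Orthotope d} {p x : Eucl d} {i : Fin d}
    (hx : x i = T.lo i ∨ x i = T.hi i) (hne : x i ≠ p i) : localHat p T x = 0 := by
  unfold localHat
  split_ifs with hp
  · exact Finset.prod_eq_zero (Finset.mem_univ i) (localHat_factor_eq_zero hp hx hne)
  · rfl

theorem localHat_nonneg {T : Orthotope d} {p x : Eucl d} (hx : x ∈ T.closed) :
    0 ≤ localHat p T x := by
  unfold localHat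
  split_ifs with hp
  · refine Finset.prod_nonneg fun i _ => ?_
    have hlt := T.lt i
    have h1 := hx i
    have h2 := T.vertices_subset hp i
    rw [sub_nonneg, div_le_one (by linarith), abs_le]
    constructor <;> linarith
  · exact le_rfl

/-- As `p i` is an endpoint, `x i - p i` has constant sign on `T` and each factor is affine.
Expanding the product gives the coefficients. -/
theorem isMultilinearOn_localHat (p : Eucl d) (T : Orthotope d) :
    IsMultilinearOn (localHat p T) T.closed := by
  classical
  by_cases hp : p ∈ T.vertices
  · have h : ∀ i, ∃ a b : ℝ, ∀ x ∈ T.closed,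
        1 - |x i - p i| / (T.hi i - T.lo i) = b * x i + a := by
      intro i
      have hlt := T.lt i
      have hne : T.hi i - T.lo i ≠ 0 := by linarith
      rcases hp i with h | h
      · refine ⟨1 + T.lo i / (T.hi i - T.lo i), -1 / (T.hi i - T.lo i), fun x hx => ?_⟩
        rw [h, abs_of_nonneg (by linarith [(hx i).1])]
        field_simp
        ring
      · refine ⟨1 - T.hi i / (T.hi i - T.lo i), 1 / (T.hi i - T.lo i), fun x hx => ?_⟩
        rw [h, abs_sub_comm, abs_of_nonneg (by linarith [(hx i).2])]
        field_simp
        ring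
    choose a b hab using h
    refine ⟨fun s => (∏ i ∈ s, b i) * ∏ i ∈ Finset.univ \ s, a i, fun x hx => ?_⟩
    rw [localHat, if_pos hp, Finset.prod_congr rfl fun i _ => hab i x hx, Finset.prod_add,
      Finset.powerset_univ]
    refine Finset.sum_congr rfl fun s _ => ?_
    rw [Finset.prod_mul_distrib]
    ring
  · exact ⟨fun _ => 0, fun x _ => by simp [localHat, hp]⟩

/-- This makes the piecewise definition consistent on common faces. If `p` is a vertex of both
elements, directions with equal intervals give equal factors, and in touching directions `x i = p
i`, so both factors are 1. If `p` is a vertex of only one, the intervals touch in some direction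
with `x i ≠ p i`, and a factor vanishes. -/
theorem Mesh.localHat_eq (𝒯 : Mesh Ω) {T T' : Orthotope d} (hT : T ∈ 𝒯.elems) (hT' : T' ∈ 𝒯.elems)
    (p : Eucl d) {x : Eucl d} (hx : x ∈ T.closed) (hx' : x ∈ T'.closed) :
    localHat p T x = localHat p T' x := by
  have hmeet : (T.closed ∩ T'.closed).Nonempty := ⟨x, hx, hx'⟩
  have aux : ∀ {T T' : Orthotope d}, T ∈ 𝒯.elems → T' ∈ 𝒯.elems → x ∈ T.closed → x ∈ T'.closed →
      p ∈ T.vertices → p ∉ T'.vertices → localHat p T x = 0 := by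
    intro T T' hT hT' hx hx' hp hp'
    simp only [Orthotope.vertices, Set.mem_ofPred_eq, not_forall, not_or] at hp'
    obtain ⟨i, hi1, hi2⟩ := hp'
    have h1 := hx i
    have h2 := hx' i
    rcases 𝒯.interval_eq_or_touch hT hT' ⟨x, hx, hx'⟩ i with ⟨e1, e2⟩ | e | e
    · rw [← e1] at hi1
      rw [← e2] at hi2
      rcases hp i with h | h
      · exact absurd h hi1
      · exact absurd h hi2
    · have hxi : x i = T.hi i := by linarith
      exact localHat_eq_zero (Or.inr hxi) (by rw [hxi, e]; exact Ne.symm hi1)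
    · have hxi : x i = T.lo i := by linarith
      exact localHat_eq_zero (Or.inl hxi) (by rw [hxi, ← e]; exact Ne.symm hi2)
  by_cases hp : p ∈ T.vertices <;> by_cases hp' : p ∈ T'.vertices
  · rw [localHat, localHat, if_pos hp, if_pos hp']
    refine Finset.prod_congr rfl fun i _ => ?_
    have h1 := hx i
    have h2 := hx' i
    have h3 := T.vertices_subset hp i
    have h4 := T'.vertices_subset hp' i
    rcases 𝒯.interval_eq_or_touch hT hT' hmeet i with ⟨e1, e2⟩ | e | e
    · rw [e1, e2]
    · have : x i = p i := by linarith
      simp [this]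
    · have : x i = p i := by linarith
      simp [this]
  · rw [aux hT hT' hx hx' hp hp', localHat, if_neg hp']
  · rw [aux hT' hT hx' hx hp' hp, localHat, if_neg hp]
  · rw [localHat, localHat, if_neg hp, if_neg hp']

open Classical in
/-- The hat function of `p`. -/
def Mesh.hatFun (𝒯 : Mesh Ω) (p : Eucl d) (x : Eucl d) : ℝ :=
  if h : ∃ T ∈ 𝒯.elems, x ∈ T.closed then localHat p h.choose x else 0

namespace Mesh

variable (𝒯 : Mesh Ω)

theorem hatFun_eq (p : Eucl d) {T : Orthotope d} (hT : T ∈ 𝒯.elems) {x : Eucl d}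
    (hx : x ∈ T.closed) : 𝒯.hatFun p x = localHat p T x := by
  have h : ∃ T ∈ 𝒯.elems, x ∈ T.closed := ⟨T, hT, hx⟩
  rw [hatFun, dif_pos h]
  exact 𝒯.localHat_eq h.choose_spec.1 hT p h.choose_spec.2 hx

theorem isMultilinearOn_hatFun (p : Eucl d) {T : Orthotope d} (hT : T ∈ 𝒯.elems) :
    IsMultilinearOn (𝒯.hatFun p) T.closed := by
  obtain ⟨c, hc⟩ := isMultilinearOn_localHat p T
  exact ⟨c, fun x hx => by rw [𝒯.hatFun_eq p hT hx, hc x hx]⟩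

theorem isQ1_hatFun (p : Eucl d) : 𝒯.IsQ1 (𝒯.hatFun p) := by
  obtain ⟨K, hK⟩ := 𝒯.exists_lipschitzOnWith fun T hT => 𝒯.isMultilinearOn_hatFun p hT
  exact ⟨hK.continuousOn, fun T hT => 𝒯.isMultilinearOn_hatFun p hT⟩

theorem hatFun_nonneg (p x : Eucl d) : 0 ≤ 𝒯.hatFun p x := by
  unfold hatFun
  split_ifs with h
  · exact localHat_nonneg h.choose_spec.2
  · exact le_rfl

theorem hatFun_self {p : Eucl d} (hp : p ∈ 𝒯.nodes) : 𝒯.hatFun p p = 1 := by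
  obtain ⟨T, hT, hpT⟩ := hp
  rw [𝒯.hatFun_eq p hT (T.vertices_subset hpT), localHat, if_pos hpT]
  simp

theorem hatFun_of_ne {p q : Eucl d} (hq : q ∈ 𝒯.nodes) (hne : q ≠ p) : 𝒯.hatFun p q = 0 := by
  obtain ⟨T, hT, hqT⟩ := hq
  rw [𝒯.hatFun_eq p hT (T.vertices_subset hqT)]
  obtain ⟨i, hi⟩ : ∃ i, q i ≠ p i := by
    by_contra! h
    exact hne (by ext i; exact h i)
  exact localHat_eq_zero (hqT i) hi

end Mesh

/-! ### Behaviour at the boundary -/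

theorem isOpen_box (p : Eucl d) (s : ℝ) : IsOpen {x : Eucl d | ∀ i, |x i - p i| < s} := by
  have : {x : Eucl d | ∀ i, |x i - p i| < s} = ⋂ i, {x : Eucl d | |x i - p i| < s} := by
    ext x; simp
  rw [this]
  exact isOpen_iInter_of_finite fun i =>
    isOpen_lt (f := fun x : Eucl d => |x i - p i|) (g := fun _ => s) (by fun_prop) (by fun_prop)

theorem exists_box_subset {p : Eucl d} {U : Set (Eucl d)} (hU : U ∈ nhds p) :
    ∃ s > 0, ∀ x : Eucl d, (∀ i, |x i - p i| < s) → x ∈ U := by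
  have h1 : (WithLp.toLp 2 : (Fin d → ℝ) → Eucl d) ⁻¹' U ∈ nhds p.ofLp :=
    (PiLp.continuous_toLp 2 (fun _ : Fin d => ℝ)).continuousAt.preimage_mem_nhds hU
  obtain ⟨s, hs, hball⟩ := Metric.mem_nhds_iff.1 h1
  refine ⟨s, hs, fun x hx => ?_⟩
  have : x.ofLp ∈ Metric.ball p.ofLp s := by
    rw [Metric.mem_ball, dist_pi_lt_iff hs]
    exact fun i => by rw [Real.dist_eq]; exact hx i
  exact hball this

theorem Mesh.eventually_mem_closed (𝒯 : Mesh Ω) (p : Eucl d) :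
    ∀ᶠ x in nhds p, ∀ T ∈ 𝒯.elems, x ∈ T.closed → p ∈ T.closed := by
  rw [Filter.eventually_all_finset]
  intro T _
  by_cases hp : p ∈ T.closed
  · exact Filter.Eventually.of_forall fun _ _ => hp
  · filter_upwards [T.isCompact_closed.isClosed.isOpen_compl.mem_nhds hp] with x hx hx'
    exact absurd hx' hx

/-- The hat function of an inner node vanishes on the boundary. -/
theorem Mesh.hatFun_eq_zero_of_mem_frontier (hΩ : IsOpen Ω) (hreg : interior (closure Ω) = Ω)
    (𝒯 : Mesh Ω) {p : Eucl d} (hp : p ∈ Ω) {x : Eucl d} (hx : x ∈ frontier Ω) :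
    𝒯.hatFun p x = 0 := by
  rw [hΩ.frontier_eq] at hx
  obtain ⟨T, hT, hxT⟩ := 𝒯.exists_mem_closed hx.1
  by_contra hne
  rw [𝒯.hatFun_eq p hT hxT] at hne
  have hpT : p ∈ T.vertices := by
    by_contra h
    exact hne (by rw [localHat, if_neg h])
  -- Nonvanishing at `x` means that each coordinate of `x` agrees with that of `p` or is interior to
  -- `T`. Contracting the interior coordinates towards `p` carries points near `x` into `Ω`; an
  -- element found there also contains the original point. Thus a neighbourhood of `x` lies in the
  -- closure of `Ω`, against `x ∉ Ω`.
  have hcoord : ∀ i, x i = p i ∨ (T.lo i < x i ∧ x i < T.hi i) := by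
    intro i
    by_contra! h
    have h1 := hxT i
    refine hne (localHat_eq_zero (i := i) ?_ h.1)
    by_cases h2 : T.lo i < x i
    · exact Or.inr (le_antisymm h1.2 (h.2 h2))
    · exact Or.inl (le_antisymm (not_lt.1 h2) h1.1)
  obtain ⟨s, hs, hbox⟩ := exists_box_subset
    (Filter.inter_mem (hΩ.mem_nhds hp) (𝒯.eventually_mem_closed p))
  -- a neighbourhood of `x` in which the strict inequalities persist
  have hnear : ∀ᶠ y in nhds x, ∀ i, |y i - x i| < s ∧
      ((T.lo i < x i ∧ x i < T.hi i) → (T.lo i < y i ∧ y i < T.hi i)) := by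
    rw [Filter.eventually_all]
    intro i
    have hc : ContinuousAt (fun y : Eucl d => y i) x := by fun_prop
    refine Filter.Eventually.and ?_ ?_
    · have : Filter.Tendsto (fun y : Eucl d => |y i - x i|) (nhds x) (nhds 0) := by
        have h : ContinuousAt (fun y : Eucl d => |y i - x i|) x := by fun_prop
        simpa [ContinuousAt] using h
      exact this.eventually_lt_const hs
    · by_cases h : T.lo i < x i ∧ x i < T.hi i
      · filter_upwards [hc.eventually_const_lt h.1, hc.eventually_lt_const h.2] with y h1 h2 _
        exact ⟨h1, h2⟩
      · exact Filter.Eventually.of_forall fun _ h' => absurd h' h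
  refine hx.2 ?_
  rw [← hreg, mem_interior_iff_mem_nhds]
  filter_upwards [hnear] with y hy
  -- move `y` towards `p` in the directions in which `x` is interior
  classical
  obtain ⟨ε, hε0, hε1, hεs⟩ : ∃ ε : ℝ, 0 < ε ∧ ε < 1 ∧ ∀ i, ε * (T.hi i - T.lo i) < s := by
    have h1 : ∀ᶠ ε : ℝ in nhdsWithin 0 (Set.Ioi 0), ∀ i, ε * (T.hi i - T.lo i) < s := by
      rw [Filter.eventually_all]
      intro i
      have hc : ContinuousAt (fun ε : ℝ => ε * (T.hi i - T.lo i)) 0 := by fun_prop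
      exact Filter.Eventually.filter_mono nhdsWithin_le_nhds
        (hc.eventually_lt_const (by simpa using hs))
    obtain ⟨ε, h2, h3, h4⟩ := (h1.and ((eventually_lt_nhds (zero_lt_one (α := ℝ))
      |>.filter_mono nhdsWithin_le_nhds).and self_mem_nhdsWithin)).exists
    exact ⟨ε, h4, h3, h2⟩
  let y' : Eucl d := WithLp.toLp 2 fun i =>
    if T.lo i < x i ∧ x i < T.hi i then p i + ε * (y i - p i) else y i
  have hy'1 : ∀ i, (T.lo i < x i ∧ x i < T.hi i) → y' i = p i + ε * (y i - p i) := fun i h => by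
    change (if _ then _ else _) = _
    rw [if_pos h]
  have hy'2 : ∀ i, ¬(T.lo i < x i ∧ x i < T.hi i) → y' i = y i := fun i h => by
    change (if _ then _ else _) = _
    rw [if_neg h]
  have hstrict : ∀ i, (T.lo i < x i ∧ x i < T.hi i) → T.lo i < y' i ∧ y' i < T.hi i := by
    intro i hi
    have h1 := (hy i).2 hi
    have h2 := T.vertices_subset hpT i
    rw [hy'1 i hi]
    constructor <;> nlinarith
  obtain ⟨hy'Ω, hy'T⟩ := hbox y' (fun i => by
    by_cases hi : T.lo i < x i ∧ x i < T.hi i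
    · rw [hy'1 i hi, add_sub_cancel_left, abs_mul, abs_of_pos hε0]
      refine lt_of_le_of_lt (mul_le_mul_of_nonneg_left ?_ hε0.le) (hεs i)
      have h1 := (hy i).2 hi
      have h2 := T.vertices_subset hpT i
      rw [abs_le]
      constructor <;> linarith
    · rw [hy'2 i hi, ← (hcoord i).resolve_right hi]
      exact (hy i).1)
  obtain ⟨T', hT', hy'T'⟩ := 𝒯.exists_mem_closed (subset_closure hy'Ω)
  have hpT' : p ∈ T'.closed := hy'T T' hT' hy'T'
  refine 𝒯.closed_subset hT' fun i => ?_
  by_cases hi : T.lo i < x i ∧ x i < T.hi i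
  · have h1 := (hy i).2 hi
    have h2 := hstrict i hi
    have h3 := hy'T' i
    -- The coordinate `y' i` is strictly inside the interval of `T` and belongs to that of `T'`.
    -- Touching intervals are impossible, so they are equal and contain `y i` too.
    rcases 𝒯.interval_eq_or_touch hT hT' ⟨p, T.vertices_subset hpT, hpT'⟩ i with ⟨e1, e2⟩ | e | e
    · rw [← e1, ← e2]; exact ⟨h1.1.le, h1.2.le⟩
    · linarith
    · linarith
  · rw [← hy'2 i hi]
    exact hy'T' i

/-! ### Orthants at boundary nodes and vanishing nodal values -/

/-- A subset of a cube that is occupied, next to one that is not. -/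
theorem exists_adjacent {P : Finset (Fin d) → Prop} {U V : Finset (Fin d)} (hU : P U) (hV : ¬ P V) :
    ∃ (U : Finset (Fin d)) (i : Fin d), P U ∧ ¬ P (symmDiff U {i}) := by
  classical
  by_contra! h
  refine hV ?_
  -- If no single flip left `P`, then `P` would pass from `U` to every vertex of the cube, and `W =
  -- symmDiff U V` would reach `V`.
  have key : ∀ W : Finset (Fin d), P (symmDiff U W) := by
    intro W
    induction W using Finset.induction_on with
    | empty => rwa [← Finset.bot_eq_empty, symmDiff_bot]
    | insert i W hi ih =>
      have h1 := h _ i ih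
      have h2 : insert i W = symmDiff W {i} := by
        ext j
        simp only [Finset.mem_insert, Finset.mem_symmDiff, Finset.mem_singleton]
        constructor
        · rintro (rfl | hj)
          · exact Or.inr ⟨rfl, hi⟩
          · exact Or.inl ⟨hj, fun e => hi (e ▸ hj)⟩
        · rintro (⟨hj, -⟩ | ⟨hj, -⟩)
          · exact Or.inr hj
          · exact Or.inl hj
      rwa [h2, ← symmDiff_assoc]
  have := key (symmDiff U V)
  rwa [symmDiff_symmDiff_cancel_left] at this

/-- The sign of the `i`-th coordinate in the orthant with positive directions `U`. -/
def orthantSign (U : Finset (Fin d)) (i : Fin d) : ℝ := if i ∈ U then 1 else -1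

/-- The box with corner `p` and side lengths `l` in the orthant given by `U`. -/
def cornerBox (p : Eucl d) (U : Finset (Fin d)) (l : Fin d → ℝ) : Set (Eucl d) :=
  {x | ∀ i, 0 < orthantSign U i * (x i - p i) ∧ orthantSign U i * (x i - p i) < l i}

theorem cornerBox_eq (p : Eucl d) (U : Finset (Fin d)) (l : Fin d → ℝ) :
    cornerBox p U l = WithLp.ofLp ⁻¹' (Set.univ.pi fun i =>
      Set.Ioo (if i ∈ U then p i else p i - l i) (if i ∈ U then p i + l i else p i)) := by
  ext x
  simp only [cornerBox, orthantSign, Set.mem_ofPred_eq, Set.mem_preimage, Set.mem_pi, Set.mem_univ,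
    true_implies, Set.mem_Ioo]
  refine forall_congr' fun i => ?_
  split_ifs
  · constructor <;> rintro ⟨h1, h2⟩ <;> constructor <;> linarith
  · constructor <;> rintro ⟨h1, h2⟩ <;> constructor <;> linarith

theorem measurableSet_cornerBox (p : Eucl d) (U : Finset (Fin d)) (l : Fin d → ℝ) :
    MeasurableSet (cornerBox p U l) := by
  rw [cornerBox_eq]
  exact (PiLp.volume_preserving_ofLp (Fin d)).measurable
    (MeasurableSet.univ_pi fun _ => measurableSet_Ioo)

theorem volume_cornerBox (p : Eucl d) (U : Finset (Fin d)) (l : Fin d → ℝ) :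
    volume (cornerBox p U l) = ∏ i, ENNReal.ofReal (l i) := by
  rw [cornerBox_eq, (PiLp.volume_preserving_ofLp (Fin d)).measure_preimage
    (MeasurableSet.univ_pi fun _ => measurableSet_Ioo).nullMeasurableSet, Real.volume_pi_Ioo]
  refine Finset.prod_congr rfl fun i _ => ?_
  split_ifs <;> congr 1 <;> ring

/-- Near a boundary node there are two adjacent orthants, one in `Ω` and one outside. -/
theorem Mesh.exists_adjacent_orthants (hreg : interior (closure Ω) = Ω) (𝒯 : Mesh Ω) {p : Eucl d}
    (hp : p ∈ 𝒯.nodes) (hpΩ : p ∉ Ω) :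
    ∃ (U : Finset (Fin d)) (i : Fin d) (s : ℝ), 0 < s ∧
      cornerBox p U (fun _ => s) ⊆ Ω ∧
      Disjoint (cornerBox p (symmDiff U {i}) fun _ => s) (closure Ω) := by
  classical
  obtain ⟨T₀, hT₀, hpT₀⟩ := hp
  have hvert : ∀ T ∈ 𝒯.elems, p ∈ T.closed → p ∈ T.vertices := fun T hT h =>
    𝒯.mem_vertices hT₀ hT hpT₀ h
  obtain ⟨s₀, hs₀, hbox⟩ := exists_box_subset (𝒯.eventually_mem_closed p)
  -- `s < s₀` ensures that an element meeting the box around `p` contains `p`. Being shorter than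
  -- every edge, a corner box of side `s` fits inside an element that has `p` as the matching
  -- corner.
  obtain ⟨s, hs, hss₀, hsT⟩ : ∃ s > 0, s < s₀ ∧ ∀ T ∈ 𝒯.elems, ∀ i, s < T.hi i - T.lo i := by
    have h1 : ∀ᶠ s : ℝ in nhdsWithin 0 (Set.Ioi 0), ∀ T ∈ 𝒯.elems, ∀ i, s < T.hi i - T.lo i := by
      rw [Filter.eventually_all_finset]
      intro T _
      rw [Filter.eventually_all]
      intro i
      exact (eventually_lt_nhds (sub_pos.2 (T.lt i))).filter_mono nhdsWithin_le_nhds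
    obtain ⟨s, h2, h3, h4⟩ := (h1.and (((eventually_lt_nhds hs₀).filter_mono
      nhdsWithin_le_nhds).and self_mem_nhdsWithin)).exists
    exact ⟨s, h4, h3, h2⟩
  -- `P U` says that an element fills the orthant `U` at `p`. If every orthant were filled, `p`
  -- would be interior to the closure of `Ω`, hence in `Ω`.
  let P : Finset (Fin d) → Prop := fun U => ∃ T ∈ 𝒯.elems, p ∈ T.closed ∧
    ∀ i, (i ∈ U → p i = T.lo i) ∧ (i ∉ U → p i = T.hi i)
  have hP0 : P (Finset.univ.filter fun i => p i = T₀.lo i) := by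
    refine ⟨T₀, hT₀, T₀.vertices_subset hpT₀, fun i => ⟨fun h => by simpa using h, fun h => ?_⟩⟩
    rcases hpT₀ i with h' | h'
    · exact absurd (by simpa using h') h
    · exact h'
  have hP1 : ∃ V, ¬ P V := by
    by_contra! hall
    refine hpΩ ?_
    rw [← hreg, mem_interior_iff_mem_nhds]
    refine Filter.mem_of_superset ((isOpen_box p s).mem_nhds fun i => by simpa using hs) fun x hx => ?_
    obtain ⟨T, hT, -, hTp⟩ := hall (Finset.univ.filter fun i => p i ≤ x i)
    refine 𝒯.closed_subset hT fun i => ?_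
    have h1 := abs_lt.1 (hx i)
    have h2 := hsT T hT i
    by_cases h : p i ≤ x i
    · have h3 := (hTp i).1 (by simpa using h)
      constructor <;> linarith
    · have h3 := (hTp i).2 (by simpa using h)
      constructor <;> linarith
  obtain ⟨V, hV⟩ := hP1
  obtain ⟨U, i, hU, hUi⟩ := exists_adjacent hP0 hV
  refine ⟨U, i, s, hs, ?_, ?_⟩
  · obtain ⟨T, hT, -, hTp⟩ := hU
    suffices h : cornerBox p U (fun _ => s) ⊆ T.inner from h.trans (𝒯.inner_subset hreg hT)
    intro x hx j
    have h1 := hx j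
    have h2 := hsT T hT j
    unfold orthantSign at h1
    split_ifs at h1 with h
    · have h3 := (hTp j).1 h
      constructor <;> linarith
    · have h3 := (hTp j).2 h
      constructor <;> linarith
  · rw [Set.disjoint_left]
    intro x hx hxΩ
    obtain ⟨T, hT, hxT⟩ := 𝒯.exists_mem_closed hxΩ
    have hpT : p ∈ T.closed := by
      refine hbox x (fun j => ?_) T hT hxT
      have h1 := hx j
      unfold orthantSign at h1
      rw [abs_lt]
      split_ifs at h1 <;> constructor <;> linarith
    refine hUi ⟨T, hT, hpT, fun j => ?_⟩
    have h1 := hx j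
    have h2 := hxT j
    have h3 := hvert T hT hpT j
    unfold orthantSign at h1
    constructor <;> intro h
    · rw [if_pos h] at h1
      exact h3.resolve_right fun h4 => by linarith
    · rw [if_neg h] at h1
      exact h3.resolve_left fun h4 => by linarith

/-- A continuous function in `H¹₀(Ω)` vanishes at the nodes on the boundary. -/
theorem Mesh.eq_zero_of_mem_H10 (hΩ : IsOpen Ω) (hreg : interior (closure Ω) = Ω) (𝒯 : Mesh Ω)
    {g : Eucl d → ℝ} (hg : ContinuousOn g (closure Ω)) {v : H1 Ω}
    (hv : val v =ᵐ[volume.restrict Ω] g) (hv0 : v ∈ H10 Ω) {p : Eucl d} (hp : p ∈ 𝒯.nodes)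
    (hpΩ : p ∉ Ω) : g p = 0 := by
  classical
  by_contra hne
  have hγ : 0 < |g p| := abs_pos.2 hne
  -- Shifting a slab of width `t` in the orthant `U` by `t` across the face normal to direction `i`
  -- lands in the empty orthant. The translation estimate gives the upper bound `t² ‖grad v‖²`,
  -- while continuity at `p` gives a lower bound proportional to `t`.
  obtain ⟨U, i, s₁, hs₁, hU, hUi⟩ := 𝒯.exists_adjacent_orthants hreg hp hpΩ
  obtain ⟨s₂, hs₂, hclose⟩ : ∃ s > 0, ∀ x ∈ closure Ω, (∀ i, |x i - p i| < s) →
      |g p| / 2 ≤ |g x| := by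
    have h1 : ∀ᶠ x in nhdsWithin p (closure Ω), |g p| / 2 < |g x| :=
      ((hg p (𝒯.nodes_subset hp)).abs).eventually_const_lt (by linarith)
    obtain ⟨s, hs, hbox⟩ := exists_box_subset (mem_nhdsWithin_iff_eventually.1 h1)
    exact ⟨s, hs, fun x hx hxs => (hbox x hxs hx).le⟩
  set s := min s₁ s₂ with hs
  have hspos : 0 < s := lt_min hs₁ hs₂
  -- the estimate in a slab of width `t`
  have hslab : ∀ t, 0 < t → t ≤ s →
      (|g p| / 2) ^ 2 * (t * s ^ (Finset.univ \ {i}).card) ≤ t ^ 2 * ‖grad v‖ ^ 2 := by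
    intro t ht hts
    set l : Fin d → ℝ := Function.update (fun _ => s) i t with hl
    have hli : l i = t := by simp [hl]
    have hlj : ∀ j, j ≠ i → l j = s := fun j hj => by simp [hl, Function.update_of_ne hj]
    have hls : ∀ j, l j ≤ s := fun j => by
      by_cases hj : j = i
      · rw [hj, hli]; exact hts
      · rw [hlj j hj]
    have hlpos : ∀ j, 0 < l j := fun j => by
      by_cases hj : j = i
      · rw [hj, hli]; exact ht
      · rw [hlj j hj]; exact hspos
    set Q := cornerBox p U l with hQ
    have hQm : MeasurableSet Q := measurableSet_cornerBox p U l
    have hQΩ : Q ⊆ Ω := fun x hx => hU fun j =>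
      ⟨(hx j).1, (hx j).2.trans_le ((hls j).trans (min_le_left _ _))⟩
    have habs : ∀ x ∈ Q, ∀ j, |x j - p j| < s := by
      intro x hx j
      have h1 := hx j
      have h2 := hls j
      unfold orthantSign at h1
      rw [abs_lt]
      split_ifs at h1 <;> constructor <;> linarith
    have h1 := norm_resL_le_of_translate hΩ 𝒯.isBounded i (t * orthantSign U i) hQm hQΩ
      (fun x hx hx' => Set.disjoint_left.1 hUi (fun j => ?_) (subset_closure hx')) hv0
    · have h2 : ‖resL Ω Q (val v)‖ ^ 2 ≤ t ^ 2 * ‖grad v‖ ^ 2 := by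
        have : |t * orthantSign U i| = t := by
          unfold orthantSign
          split_ifs <;> simp [abs_of_pos ht]
        rw [this] at h1
        rw [← mul_pow]
        exact pow_le_pow_left₀ (norm_nonneg _) h1 2
      refine le_trans ?_ h2
      rw [norm_resL_sq hQm hQΩ]
      have hvol : (volume : Measure (Eucl d)).real Q = t * s ^ (Finset.univ \ {i}).card := by
        rw [Measure.real, hQ, volume_cornerBox, ENNReal.toReal_prod,
          Finset.prod_congr rfl fun j _ => ENNReal.toReal_ofReal (hlpos j).le, hl,
          Finset.prod_update_of_mem (Finset.mem_univ i), Finset.prod_const]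
      have hfinQ : volume Q ≠ ⊤ := (𝒯.isBounded.subset hQΩ).measure_lt_top.ne
      have hconst : ∫ _x in Q, (|g p| / 2) ^ 2 = (|g p| / 2) ^ 2 * (t * s ^ (Finset.univ \ {i}).card) := by
        rw [setIntegral_const, hvol, smul_eq_mul, mul_comm]
      rw [← hconst]
      refine integral_mono_ae (integrableOn_const hfinQ) ?_ ?_
      · have := ((memLp_two_iff_integrable_sq_norm (Lp.aestronglyMeasurable (val v))).1
          (Lp.memLp _))
        exact IntegrableOn.mono_set (s := Q) (t := Ω) this hQΩ
      · filter_upwards [ae_restrict_of_ae_restrict_of_subset hQΩ hv, ae_restrict_mem hQm] with x hx hxQ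
        rw [hx, Real.norm_eq_abs]
        refine pow_le_pow_left₀ (by positivity) ?_ 2
        exact hclose x (subset_closure (hQΩ hxQ)) fun j =>
          (habs x hxQ j).trans_le (min_le_right _ _)
    · have h1 := hx j
      have h3 := hls j
      have h4 : s ≤ s₁ := min_le_left _ _
      by_cases hj : j = i
      · subst hj
        rw [hli] at h1
        have e : (x - (t * orthantSign U j) • EuclideanSpace.single j 1 : Eucl d) j =
            x j - t * orthantSign U j := by simp
        have e2 : orthantSign (symmDiff U {j}) j = - orthantSign U j := by
          unfold orthantSign
          by_cases h : j ∈ U <;> simp [Finset.mem_symmDiff, h]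
        have e3 : orthantSign U j * orthantSign U j = 1 := by
          unfold orthantSign
          split_ifs <;> norm_num
        rw [e, e2]
        have e4 : -orthantSign U j * (x j - t * orthantSign U j - p j) =
            t * (orthantSign U j * orthantSign U j) - orthantSign U j * (x j - p j) := by ring
        rw [e4, e3]
        constructor <;> linarith
      · have e : (x - (t * orthantSign U i) • EuclideanSpace.single i 1 : Eucl d) j = x j := by
          simp [hj]
        have e2 : orthantSign (symmDiff U {i}) j = orthantSign U j := by
          unfold orthantSign
          simp [Finset.mem_symmDiff, hj]
        rw [e, e2]
        exact ⟨h1.1, by linarith⟩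
  set κ := (|g p| / 2) ^ 2 * s ^ (Finset.univ \ {i}).card with hκ
  have hκpos : 0 < κ := by positivity
  set G := ‖grad v‖ ^ 2 with hG
  have hG0 : 0 ≤ G := by positivity
  -- For this `t` one has `t * G < κ`, whereas the slab estimate divided by `t` yields `κ ≤ t * G`.
  have ht : 0 < min s (κ / (2 * (G + 1))) := lt_min hspos (by positivity)
  set t := min s (κ / (2 * (G + 1))) with htdef
  have h1 := hslab t ht (min_le_left _ _)
  have h2 : t * (2 * (G + 1)) ≤ κ := by
    rw [← le_div_iff₀ (by positivity)]
    exact min_le_right _ _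
  have h3 : t * κ ≤ t * (t * G) := by
    calc t * κ = (|g p| / 2) ^ 2 * (t * s ^ (Finset.univ \ {i}).card) := by rw [hκ]; ring
      _ ≤ t ^ 2 * G := h1
      _ = t * (t * G) := by ring
  have h4 := le_of_mul_le_mul_left h3 ht
  nlinarith

/-! ### The energy form -/

variable {A : Eucl d → Matrix (Fin d) (Fin d) ℝ}

theorem Admissible.exists_bound (hA : Admissible Ω A) : ∃ M : ℝ, 0 ≤ M ∧
    ∀ᵐ x ∂(volume : Measure (Eucl d)).restrict Ω, ∀ i j, |A x i j| ≤ M := by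
  have h : ∀ i j, ∃ M : ℝ, ∀ᵐ x ∂(volume : Measure (Eucl d)).restrict Ω, |A x i j| ≤ M := by
    intro i j
    refine ⟨(eLpNormEssSup (fun x => A x i j) ((volume : Measure (Eucl d)).restrict Ω)).toReal, ?_⟩
    have hfin : eLpNormEssSup (fun x => A x i j) ((volume : Measure (Eucl d)).restrict Ω) ≠ ⊤ := by
      have := (hA.memLp i j).2.ne
      rwa [eLpNorm_exponent_top] at this
    filter_upwards [ae_le_eLpNormEssSup (f := fun x => A x i j)
      (μ := (volume : Measure (Eucl d)).restrict Ω)] with x hx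
    have := ENNReal.toReal_mono hfin hx
    simpa using this
  choose M hM using h
  refine ⟨∑ i, ∑ j, |M i j|, by positivity, ?_⟩
  filter_upwards [ae_all_iff.2 fun i => ae_all_iff.2 fun j => hM i j] with x hx i j
  calc |A x i j| ≤ |M i j| := (hx i j).trans (le_abs_self _)
    _ ≤ ∑ j, |M i j| := Finset.single_le_sum (f := fun j => |M i j|) (fun _ _ => abs_nonneg _)
        (Finset.mem_univ j)
    _ ≤ ∑ i, ∑ j, |M i j| := Finset.single_le_sum (f := fun i => ∑ j, |M i j|)
        (fun _ _ => Finset.sum_nonneg fun _ _ => abs_nonneg _) (Finset.mem_univ i)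

/-- In the hypothesis the exceptional null set may depend on `ξ`. A countable dense set of vectors
and continuity in `ξ` give one null set for all. -/
theorem Admissible.ae_elliptic (hA : Admissible Ω A) : ∃ α : ℝ, 0 < α ∧
    ∀ᵐ x ∂(volume : Measure (Eucl d)).restrict Ω, ∀ ξ : Eucl d,
      α * ‖ξ‖ ^ 2 ≤ (A x *ᵥ (fun i => ξ i)) ⬝ᵥ (fun i => ξ i) := by
  obtain ⟨α, β, hα, -, h⟩ := hA.elliptic
  refine ⟨α, hα, ?_⟩
  filter_upwards [ae_all_iff.2 fun n => h (TopologicalSpace.denseSeq (Eucl d) n)] with x hx ξ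
  refine (TopologicalSpace.denseRange_denseSeq (Eucl d)).induction_on
    (p := fun ξ : Eucl d => α * ‖ξ‖ ^ 2 ≤ (A x *ᵥ (fun i => ξ i)) ⬝ᵥ (fun i => ξ i)) ξ ?_
    fun n => (hx n).1
  refine isClosed_le (by fun_prop) ?_
  simp only [dotProduct, Matrix.mulVec]
  fun_prop

theorem Admissible.integrable (hA : Admissible Ω A) {S : Set (Eucl d)} (hS : S ⊆ Ω) (w v : H1 Ω) :
    Integrable (fun x => (A x *ᵥ (fun i => grad w x i)) ⬝ᵥ (fun i => grad v x i))
      ((volume : Measure (Eucl d)).restrict S) := by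
  have hc : ∀ (u : H1 Ω) i, MemLp (fun x => grad u x i) 2
      ((volume : Measure (Eucl d)).restrict Ω) := fun u i =>
    (EuclideanSpace.proj (𝕜 := ℝ) i).comp_memLp' (Lp.memLp (grad u))
  refine IntegrableOn.mono_set (t := Ω) ?_ hS
  simp only [dotProduct, Matrix.mulVec]
  refine integrable_finsetSum _ fun i _ => ?_
  refine MemLp.integrable_mul (p := 2) (q := 2) ?_ (hc v i)
  exact memLp_finsetSum _ fun j _ => (hc w j).mul (hA.memLp i j)

/-- The constant is uniform in `S`, so the forms on `Ω` and on single elements share it. -/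
theorem Admissible.exists_energy_bound (hA : Admissible Ω A) : ∃ M : ℝ, ∀ S ⊆ Ω, ∀ w v : H1 Ω,
    |energy A S w v| ≤ M * ‖w‖ * ‖v‖ := by
  obtain ⟨M, hM0, hM⟩ := hA.exists_bound
  refine ⟨∑ _i : Fin d, ∑ _j : Fin d, M, fun S hS w v => ?_⟩
  set C : ℝ := ∑ _i : Fin d, ∑ _j : Fin d, M with hC
  have hC0 : 0 ≤ C := by positivity
  have hn : ∀ u : H1 Ω, MemLp (fun x => ‖grad u x‖) 2 ((volume : Measure (Eucl d)).restrict Ω) :=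
    fun u => (Lp.memLp (grad u)).norm
  have hint : Integrable (fun x => C * (‖grad w x‖ * ‖grad v x‖))
      ((volume : Measure (Eucl d)).restrict Ω) := ((hn w).integrable_mul (hn v)).const_mul _
  have h1 : ∀ᵐ x ∂(volume : Measure (Eucl d)).restrict Ω,
      |(A x *ᵥ (fun i => grad w x i)) ⬝ᵥ (fun i => grad v x i)| ≤
        C * (‖grad w x‖ * ‖grad v x‖) := by
    filter_upwards [hM] with x hx
    simp only [dotProduct, Matrix.mulVec, Finset.sum_mul]
    rw [hC, Finset.sum_mul]
    refine (Finset.abs_sum_le_sum_abs _ _).trans (Finset.sum_le_sum fun i _ => ?_)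
    rw [Finset.sum_mul]
    refine (Finset.abs_sum_le_sum_abs _ _).trans (Finset.sum_le_sum fun j _ => ?_)
    rw [abs_mul, abs_mul, mul_assoc]
    have h2 : |grad w x j| ≤ ‖grad w x‖ := PiLp.norm_apply_le (grad w x) j
    have h3 : |grad v x i| ≤ ‖grad v x‖ := PiLp.norm_apply_le (grad v x) i
    exact mul_le_mul (hx i j) (mul_le_mul h2 h3 (abs_nonneg _) (norm_nonneg _))
      (by positivity) hM0
  have h2 : ∫ x in Ω, ‖grad w x‖ * ‖grad v x‖ ≤ ‖grad w‖ * ‖grad v‖ := by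
    have h3 : ∫ x in Ω, ‖grad w x‖ * ‖grad v x‖ =
        inner ℝ ((hn w).toLp _) ((hn v).toLp _) := by
      rw [L2.inner_def]
      refine integral_congr_ae ?_
      filter_upwards [(hn w).coeFn_toLp, (hn v).coeFn_toLp] with x hx hx'
      rw [hx, hx']
      simp [mul_comm]
    have h4 : ∀ u : H1 Ω, ‖(hn u).toLp _‖ = ‖grad u‖ := fun u => by
      rw [Lp.norm_toLp, Lp.norm_def, eLpNorm_norm]
    rw [h3, ← h4 w, ← h4 v]
    exact real_inner_le_norm _ _
  have h3 : |energy A S w v| ≤ ∫ x in S, C * (‖grad w x‖ * ‖grad v x‖) := by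
    rw [energy, ← Real.norm_eq_abs]
    refine norm_integral_le_of_norm_le (IntegrableOn.mono_set (t := Ω) hint hS) ?_
    exact ae_restrict_of_ae_restrict_of_subset hS h1
  have h4 : ∫ x in S, C * (‖grad w x‖ * ‖grad v x‖) ≤ ∫ x in Ω, C * (‖grad w x‖ * ‖grad v x‖) :=
    setIntegral_mono_set hint (Filter.Eventually.of_forall fun x => by positivity)
      (Filter.Eventually.of_forall hS)
  rw [integral_const_mul (μ := (volume : Measure (Eucl d)).restrict Ω)] at h4
  calc |energy A S w v| ≤ C * (‖grad w‖ * ‖grad v‖) :=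
        h3.trans (h4.trans (mul_le_mul_of_nonneg_left h2 hC0))
    _ ≤ C * (‖w‖ * ‖v‖) := by
        refine mul_le_mul_of_nonneg_left ?_ hC0
        exact mul_le_mul (norm_grad_le w) (norm_grad_le v) (norm_nonneg _) (norm_nonneg _)
    _ = C * ‖w‖ * ‖v‖ := by ring

/-- The energy on `S ⊆ Ω` as a bilinear form. -/
def energyBilin (hA : Admissible Ω A) {S : Set (Eucl d)} (hS : S ⊆ Ω) :
    H1 Ω →ₗ[ℝ] H1 Ω →ₗ[ℝ] ℝ :=
  LinearMap.mk₂ ℝ (energy A S)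
    (fun w w' v => by
      rw [energy, energy, energy, ← integral_add (hA.integrable hS _ _) (hA.integrable hS _ _)]
      refine integral_congr_ae (ae_restrict_of_ae_restrict_of_subset hS ?_)
      filter_upwards [Lp.coeFn_add (grad w) (grad w')] with x hx
      rw [← add_dotProduct, ← Matrix.mulVec_add, grad_add, hx]
      rfl)
    (fun c w v => by
      rw [energy, energy, smul_eq_mul, ← integral_const_mul]
      refine integral_congr_ae (ae_restrict_of_ae_restrict_of_subset hS ?_)
      filter_upwards [Lp.coeFn_smul c (grad w)] with x hx
      rw [← smul_eq_mul, ← smul_dotProduct, ← Matrix.mulVec_smul, grad_smul, hx]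
      rfl)
    (fun w v v' => by
      rw [energy, energy, energy, ← integral_add (hA.integrable hS _ _) (hA.integrable hS _ _)]
      refine integral_congr_ae (ae_restrict_of_ae_restrict_of_subset hS ?_)
      filter_upwards [Lp.coeFn_add (grad v) (grad v')] with x hx
      rw [← dotProduct_add, grad_add, hx]
      rfl)
    (fun c w v => by
      rw [energy, energy, smul_eq_mul, ← integral_const_mul]
      refine integral_congr_ae (ae_restrict_of_ae_restrict_of_subset hS ?_)
      filter_upwards [Lp.coeFn_smul c (grad v)] with x hx
      rw [← smul_eq_mul, ← dotProduct_smul, grad_smul, hx]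
      rfl)

@[simp] theorem energyBilin_apply (hA : Admissible Ω A) {S : Set (Eucl d)} (hS : S ⊆ Ω)
    (w v : H1 Ω) : energyBilin hA hS w v = energy A S w v := rfl

/-- The energy on `S ⊆ Ω` as a continuous bilinear form. -/
def energyL (hA : Admissible Ω A) {S : Set (Eucl d)} (hS : S ⊆ Ω) : H1 Ω →L[ℝ] H1 Ω →L[ℝ] ℝ :=
  LinearMap.mkContinuous₂ (energyBilin hA hS) hA.exists_energy_bound.choose
    fun w v => hA.exists_energy_bound.choose_spec S hS w v

@[simp] theorem energyL_apply (hA : Admissible Ω A) {S : Set (Eucl d)} (hS : S ⊆ Ω)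
    (w v : H1 Ω) : energyL hA hS w v = energy A S w v := rfl

theorem Admissible.exists_coercive (hA : Admissible Ω A) : ∃ α : ℝ, 0 < α ∧ ∀ v : H1 Ω,
    α * ‖grad v‖ ^ 2 ≤ aForm A v v := by
  obtain ⟨α, hα, h⟩ := hA.ae_elliptic
  refine ⟨α, hα, fun v => ?_⟩
  rw [norm_sq_eq_integral, ← integral_const_mul]
  refine integral_mono_ae ?_ (hA.integrable subset_rfl v v) ?_
  · exact ((memLp_two_iff_integrable_sq_norm (Lp.aestronglyMeasurable (grad v))).1
      (Lp.memLp _)).const_mul _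
  · filter_upwards [h] with x hx using hx _

/-! ### The local kernels -/

theorem Mesh.finite_patch (𝒯 : Mesh Ω) (T : Orthotope d) (ℓ : ℕ) : (𝒯.patch T ℓ).Finite := by
  cases ℓ with
  | zero => exact Set.finite_singleton T
  | succ ℓ => exact 𝒯.elems.finite_toSet.subset fun _ h => h.1

theorem Mesh.measurableSet_patchRegion (𝒯 : Mesh Ω) (T : Orthotope d) (ℓ : ℕ) :
    MeasurableSet (𝒯.patchRegion T ℓ) :=
  (𝒯.finite_patch T ℓ).measurableSet_biUnion fun T _ => T.isCompact_closed.isClosed.measurableSet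

theorem Orthotope.volume_closed_diff_inner (T : Orthotope d) : volume (T.closed \ T.inner) = 0 := by
  have h : T.closed \ T.inner ⊆ ⋃ i : Fin d, ({x : Eucl d | x i = T.lo i} ∪ {x | x i = T.hi i}) := by
    rintro x ⟨hx, hx'⟩
    simp only [Orthotope.inner, Set.mem_ofPred_eq, not_forall] at hx'
    obtain ⟨i, hi⟩ := hx'
    refine Set.mem_iUnion.2 ⟨i, ?_⟩
    have h1 := hx i
    by_contra h2
    simp only [Set.mem_union, Set.mem_ofPred_eq, not_or] at h2
    exact hi ⟨lt_of_le_of_ne h1.1 (Ne.symm h2.1), lt_of_le_of_ne h1.2 h2.2⟩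
  have hplane : ∀ (i : Fin d) (a : ℝ), volume {x : Eucl d | x i = a} = 0 := by
    intro i a
    have e : {x : Eucl d | x i = a} = WithLp.ofLp ⁻¹' {y : Fin d → ℝ | y i = a} := rfl
    have hm : MeasurableSet {y : Fin d → ℝ | y i = a} :=
      measurableSet_eq_fun (measurable_pi_apply i) measurable_const
    rw [e, (PiLp.volume_preserving_ofLp (Fin d)).measure_preimage hm.nullMeasurableSet]
    exact Measure.pi_hyperplane (fun _ : Fin d => (volume : Measure ℝ)) i a
  refine measure_mono_null h ?_
  rw [measure_iUnion_null_iff]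
  exact fun i => measure_union_null (hplane i _) (hplane i _)

theorem Orthotope.diam_pos (hd : 0 < d) (T : Orthotope d) : 0 < Metric.diam T.closed := by
  have hlo : (WithLp.toLp 2 T.lo : Eucl d) ∈ T.closed := fun i => ⟨le_rfl, (T.lt i).le⟩
  have hhi : (WithLp.toLp 2 T.hi : Eucl d) ∈ T.closed := fun i => ⟨(T.lt i).le, le_rfl⟩
  refine lt_of_lt_of_le ?_ (Metric.dist_le_diam_of_mem T.isCompact_closed.isBounded hlo hhi)
  rw [dist_pos]
  intro h
  have := congrArg (fun x : Eucl d => x ⟨0, hd⟩) h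
  exact (T.lt ⟨0, hd⟩).ne this

/-- Write `I_H v = v - (v - I_H v)`: the approximation term of the hypothesis bounds the difference,
and the gradient term is dropped. The diameter is positive because `d > 0`. -/
theorem IsQuasiInterpolation.exists_local_bound (hd : 0 < d) (hreg : interior (closure Ω) = Ω)
    {𝒯 : Mesh Ω} {IH : H10 Ω →ₗ[ℝ] 𝒯.VH0} (hIH : IsQuasiInterpolation 𝒯 IH) :
    ∃ C : ℝ, ∀ T ∈ 𝒯.elems, ∀ v : H10 Ω, ‖resL Ω T.inner (val (IH v : H1 Ω))‖ ≤
      (Metric.diam T.closed * |C| + 1) * ‖(v : H1 Ω)‖ := by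
  have hΩ : IsOpen Ω := hreg ▸ isOpen_interior
  obtain ⟨C, hC⟩ := hIH.stable
  refine ⟨C, fun T hT v => ?_⟩
  have hin : T.inner ⊆ Ω := 𝒯.inner_subset hreg hT
  have h1 := hC v T hT
  generalize (IH v : H1 Ω) = I at h1 ⊢
  generalize (v : H1 Ω) = u at h1 ⊢
  rw [normL2_eq_norm_resL T.isOpen_inner.measurableSet hin,
    normL2_eq_norm_resL T.isOpen_inner.measurableSet hin,
    normL2_eq_norm_resL ((𝒯.measurableSet_patchRegion T 1).inter hΩ.measurableSet)
      Set.inter_subset_right] at h1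
  have hD := T.diam_pos hd
  have h2 : (Metric.diam T.closed)⁻¹ * ‖resL Ω T.inner (val (u - I))‖ ≤ |C| * ‖u‖ := by
    have h3 := norm_resL_le (Ω := Ω) (𝒯.patchRegion T 1 ∩ Ω) (grad u)
    have h4 : C * ‖resL Ω (𝒯.patchRegion T 1 ∩ Ω) (grad u)‖ ≤ |C| * ‖u‖ :=
      mul_le_mul (le_abs_self C) (h3.trans (norm_grad_le u)) (norm_nonneg _) (abs_nonneg _)
    have h5 := norm_nonneg (resL Ω T.inner (grad I))
    linarith
  rw [inv_mul_le_iff₀ hD] at h2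
  have h3 : resL Ω T.inner (val I) = resL Ω T.inner (val u) - resL Ω T.inner (val (u - I)) := by
    rw [← map_sub, val_sub, sub_sub_cancel]
  rw [h3]
  refine (norm_sub_le _ _).trans ?_
  have h4 := (norm_resL_le (Ω := Ω) T.inner (val u)).trans (norm_val_le u)
  linarith

/-- The open elements cover `Ω` up to the null set of their faces. Only subadditivity is needed, so
disjointness of the interiors plays no role. -/
theorem Mesh.norm_val_sq_le_sum (hreg : interior (closure Ω) = Ω) (𝒯 : Mesh Ω) (u : L2 Ω) :
    ‖u‖ ^ 2 ≤ ∑ T ∈ 𝒯.elems, ‖resL Ω T.inner u‖ ^ 2 := by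
  have hnn : 0 ≤ fun x => ‖u x‖ ^ 2 := fun x => sq_nonneg _
  have hfi : IntegrableOn (fun x => ‖u x‖ ^ 2) Ω volume :=
    (memLp_two_iff_integrable_sq_norm (Lp.aestronglyMeasurable u)).1 (Lp.memLp u)
  rw [norm_sq_eq_integral, Finset.sum_congr rfl fun T hT =>
    norm_resL_sq T.isOpen_inner.measurableSet (𝒯.inner_subset hreg hT) u]
  generalize (fun x => ‖u x‖ ^ 2) = f at hnn hfi ⊢
  have hΩae : (Ω : Set (Eucl d)) ≤ᵐ[volume] ⋃ T ∈ 𝒯.elems, T.inner := by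
    have hnull : volume (⋃ T ∈ 𝒯.elems, T.closed \ T.inner) = 0 :=
      (measure_biUnion_null_iff 𝒯.elems.countable_toSet).2 fun T _ => T.volume_closed_diff_inner
    filter_upwards [measure_eq_zero_iff_ae_notMem.1 hnull] with x hx hxΩ
    obtain ⟨T, hT, hxT⟩ := 𝒯.exists_mem_closed (subset_closure hxΩ)
    refine Set.mem_biUnion (s := {T | T ∈ 𝒯.elems}) (t := fun T : Orthotope d => T.inner) hT ?_
    by_contra h
    exact hx (Set.mem_biUnion (s := {T | T ∈ 𝒯.elems})
      (t := fun T : Orthotope d => T.closed \ T.inner) hT ⟨hxT, h⟩)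
  have hsub : ∀ s : Finset (Orthotope d), s ⊆ 𝒯.elems →
      ∫ x in ⋃ T ∈ s, T.inner, f x ≤ ∑ T ∈ s, ∫ x in T.inner, f x := by
    classical
    intro s
    induction s using Finset.induction_on with
    | empty => simp
    | insert T s hTs ih =>
      intro hs
      have hT : T ∈ 𝒯.elems := hs (Finset.mem_insert_self _ _)
      have hs' : s ⊆ 𝒯.elems := fun x hx => hs (Finset.mem_insert_of_mem hx)
      rw [Finset.set_biUnion_insert, Finset.sum_insert hTs]
      have hi1 : IntegrableOn f T.inner volume := hfi.mono_set (𝒯.inner_subset hreg hT)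
      have hi2 : IntegrableOn f (⋃ T ∈ s, T.inner) volume :=
        hfi.mono_set (Set.iUnion₂_subset fun T hT => 𝒯.inner_subset hreg (hs' hT))
      have hle : volume.restrict (T.inner ∪ ⋃ T ∈ s, T.inner) ≤
          volume.restrict T.inner + volume.restrict (⋃ T ∈ s, T.inner) :=
        Measure.restrict_union_le _ _
      refine (integral_mono_measure hle (Filter.Eventually.of_forall hnn)
        (Integrable.add_measure hi1 hi2)).trans ?_
      rw [integral_add_measure hi1 hi2]
      exact add_le_add le_rfl (ih hs')
  refine le_trans ?_ (hsub _ subset_rfl)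
  exact setIntegral_mono_set (hfi.mono_set (Set.iUnion₂_subset fun T hT => 𝒯.inner_subset hreg hT))
    (Filter.Eventually.of_forall hnn) hΩae

theorem IsQuasiInterpolation.exists_bound (hd : 0 < d) (hreg : interior (closure Ω) = Ω)
    {𝒯 : Mesh Ω} {IH : H10 Ω →ₗ[ℝ] 𝒯.VH0} (hIH : IsQuasiInterpolation 𝒯 IH) :
    ∃ B : ℝ, ∀ v : H10 Ω, ‖val (IH v : H1 Ω)‖ ≤ B * ‖(v : H1 Ω)‖ := by
  obtain ⟨C, hloc⟩ := hIH.exists_local_bound hd hreg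
  refine ⟨Real.sqrt (∑ T ∈ 𝒯.elems, (Metric.diam T.closed * |C| + 1) ^ 2), fun v => ?_⟩
  refine abs_le_of_sq_le_sq' ?_ (by positivity) |>.2
  rw [mul_pow, Real.sq_sqrt (Finset.sum_nonneg fun _ _ => sq_nonneg _), Finset.sum_mul]
  refine (𝒯.norm_val_sq_le_sum hreg _).trans (Finset.sum_le_sum fun T hT => ?_)
  rw [← mul_pow]
  exact pow_le_pow_left₀ (norm_nonneg _) (hloc T hT v) 2

theorem resL_eq_zero_iff {S : Set (Eucl d)} (hS : MeasurableSet S) (u : L2 Ω) :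
    resL Ω S u = 0 ↔ ∀ᵐ x ∂(volume : Measure (Eucl d)).restrict Ω, x ∈ S → u x = 0 := by
  rw [← ae_restrict_iff' hS, Lp.eq_zero_iff_ae_eq_zero]
  have h := coeFn_resL S u
  constructor <;> intro h'
  · filter_upwards [h, h'] with x hx hx'
    rw [← hx, hx']; rfl
  · filter_upwards [h, h'] with x hx hx'
    rw [hx, hx']; rfl

/-- The local kernel as a linear space. -/
def localKernelSubmodule (𝒯 : Mesh Ω) (IH : H10 Ω →ₗ[ℝ] 𝒯.VH0) (ℓ : ℕ) (T : Orthotope d) :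
    Submodule ℝ (H1 Ω) :=
  (LinearMap.ker IH).map (H10 Ω).subtype ⊓
    LinearMap.ker ((resL Ω (𝒯.patchRegion T ℓ)ᶜ).comp (valL Ω) : H1 Ω →L[ℝ] _).toLinearMap

theorem mem_localKernelSubmodule {𝒯 : Mesh Ω} {IH : H10 Ω →ₗ[ℝ] 𝒯.VH0} {ℓ : ℕ}
    {T : Orthotope d} {w : H1 Ω} :
    w ∈ localKernelSubmodule 𝒯 IH ℓ T ↔ w ∈ localKernel 𝒯 IH ℓ T := by
  rw [localKernelSubmodule, Submodule.mem_inf]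
  refine and_congr ?_ ?_
  · simp
  · exact resL_eq_zero_iff (𝒯.measurableSet_patchRegion T ℓ).compl (val w)

/-- By injectivity of `val`, the kernel of `I_H` is the zero set of `v ↦ val (I_H v)`, which is
continuous into `L²`. The support condition is the kernel of a continuous restriction map. -/
theorem isClosed_localKernelSubmodule (hd : 0 < d) (hreg : interior (closure Ω) = Ω)
    {𝒯 : Mesh Ω} {IH : H10 Ω →ₗ[ℝ] 𝒯.VH0} (hIH : IsQuasiInterpolation 𝒯 IH) (ℓ : ℕ)
    (T : Orthotope d) : IsClosed (localKernelSubmodule 𝒯 IH ℓ T : Set (H1 Ω)) := by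
  have hΩ : IsOpen Ω := hreg ▸ isOpen_interior
  obtain ⟨B, hB⟩ := hIH.exists_bound hd hreg
  let Φ : H10 Ω →L[ℝ] L2 Ω :=
    LinearMap.mkContinuous ((valL Ω).toLinearMap ∘ₗ 𝒯.VH0.subtype ∘ₗ IH) B hB
  have hker : (LinearMap.ker IH : Set (H10 Ω)) = Φ ⁻¹' {0} := by
    ext v
    simp only [SetLike.mem_coe, LinearMap.mem_ker, Set.mem_preimage, Set.mem_singleton_iff]
    constructor
    · intro h
      change val (IH v : H1 Ω) = 0
      rw [h]; rfl
    · intro h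
      change val (IH v : H1 Ω) = 0 at h
      exact Subtype.ext (val_injective hΩ h)
  have h1 : IsClosed (LinearMap.ker IH : Set (H10 Ω)) := by
    rw [hker]
    exact isClosed_singleton.preimage Φ.continuous
  refine IsClosed.inter ?_ (ContinuousLinearMap.isClosed_ker _)
  rw [Submodule.map_coe]
  exact (isClosed_H10 Ω).isClosedEmbedding_subtypeVal.isClosedMap _ h1

/-! ### The corrections -/

/-- The Lax-Milgram theorem on a closed subspace. -/
theorem exists_laxMilgram {H : Type*} [NormedAddCommGroup H] [InnerProductSpace ℝ H]
    [CompleteSpace H] (a : H →L[ℝ] H →L[ℝ] ℝ) (F : H →L[ℝ] ℝ) {W : Submodule ℝ H}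
    (hW : IsClosed (W : Set H)) {κ : ℝ} (hκ : 0 < κ) (hcoer : ∀ w ∈ W, κ * ‖w‖ ^ 2 ≤ a w w) :
    ∃ c ∈ W, ∀ w ∈ W, a c w = F w := by
  have : CompleteSpace W := hW.completeSpace_coe
  let B : W →L[ℝ] W →L[ℝ] ℝ := a.bilinearComp W.subtypeL W.subtypeL
  have hBc : IsCoercive B := by
    refine ⟨κ, hκ, fun w => ?_⟩
    rw [mul_assoc, ← sq]
    exact hcoer w w.2
  let F' : W →L[ℝ] ℝ := F.comp W.subtypeL
  let c : W := hBc.continuousLinearEquivOfBilin.symm ((InnerProductSpace.toDual ℝ W).symm F')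
  have hc : ∀ w : W, B c w = F' w := by
    intro w
    rw [← hBc.continuousLinearEquivOfBilin_apply, ContinuousLinearEquiv.apply_symm_apply,
      InnerProductSpace.toDual_symm_apply]
  exact ⟨c, c.2, fun w hw => hc ⟨w, hw⟩⟩

/-- Functions in `H¹₀(Ω)` without energy vanish. -/
theorem eq_zero_of_aForm_self (hd : 0 < d) (hΩ : IsOpen Ω) (hb : Bornology.IsBounded Ω)
    (hA : Admissible Ω A) {v : H1 Ω} (hv : v ∈ H10 Ω) (h : aForm A v v = 0) : v = 0 := by
  obtain ⟨α, hα, hcoer⟩ := hA.exists_coercive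
  obtain ⟨C, -, hC⟩ := exists_poincare hd hΩ hb
  have h2 := hcoer v
  rw [h] at h2
  have h3 : ‖grad v‖ = 0 := by
    have : ‖grad v‖ ^ 2 ≤ 0 := by
      by_contra! h
      nlinarith
    exact pow_eq_zero_iff two_ne_zero |>.1 (le_antisymm this (sq_nonneg _))
  have h4 := hC _ hv
  rw [h3, mul_zero] at h4
  exact H1.ext' (norm_le_zero_iff.1 h4) (norm_eq_zero.1 h3)

theorem existsUnique_elemCorr (hd : 0 < d) (hreg : interior (closure Ω) = Ω) (hA : Admissible Ω A)
    {𝒯 : Mesh Ω} {IH : H10 Ω →ₗ[ℝ] 𝒯.VH0} (hIH : IsQuasiInterpolation 𝒯 IH) (ℓ : ℕ)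
    {T : Orthotope d} (hT : T ∈ 𝒯.elems) (v : H1 Ω) :
    ∃! c : H1 Ω, c ∈ localKernel 𝒯 IH ℓ T ∧
      ∀ w ∈ localKernel 𝒯 IH ℓ T, aForm A c w = energy A T.inner v w := by
  have hΩ : IsOpen Ω := hreg ▸ isOpen_interior
  have hW10 : ∀ w ∈ localKernelSubmodule 𝒯 IH ℓ T, w ∈ H10 Ω := fun w hw =>
    (mem_localKernelSubmodule.1 hw).1.1
  obtain ⟨α, hα, hcoer⟩ := hA.exists_coercive
  obtain ⟨C, -, hC⟩ := exists_poincare hd hΩ 𝒯.isBounded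
  obtain ⟨c, hcW, hc⟩ := exists_laxMilgram (energyL hA subset_rfl)
    (energyL hA (𝒯.inner_subset hreg hT) v) (isClosed_localKernelSubmodule hd hreg hIH ℓ T)
    -- The Poincaré inequality gives `‖w‖² ≤ (C² + 1) ‖grad w‖²`, which turns control of the
    -- gradient into coercivity in the full norm.
    (κ := α / (C ^ 2 + 1)) (by positivity) (fun w hw => by
      refine le_trans ?_ (hcoer w)
      have h1 : ‖w‖ ^ 2 ≤ (C ^ 2 + 1) * ‖grad w‖ ^ 2 := by
        have := pow_le_pow_left₀ (norm_nonneg _) (hC w (hW10 w hw)) 2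
        rw [norm_sq_eq]
        linarith [mul_pow C ‖grad w‖ 2]
      rw [div_mul_eq_mul_div, div_le_iff₀ (by positivity)]
      calc α * ‖w‖ ^ 2 ≤ α * ((C ^ 2 + 1) * ‖grad w‖ ^ 2) := mul_le_mul_of_nonneg_left h1 hα.le
        _ = α * ‖grad w‖ ^ 2 * (C ^ 2 + 1) := by ring)
  refine ⟨c, ⟨mem_localKernelSubmodule.1 hcW, fun w hw =>
    hc w (mem_localKernelSubmodule.2 hw)⟩, ?_⟩
  rintro c' ⟨hc', hc'eq⟩
  have hmem := Submodule.sub_mem _ (mem_localKernelSubmodule.2 hc') hcW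
  refine sub_eq_zero.1 (eq_zero_of_aForm_self hd hΩ 𝒯.isBounded hA (hW10 _ hmem) ?_)
  have h2 := hc'eq (c' - c) (mem_localKernelSubmodule.1 hmem)
  have h3 := hc (c' - c) hmem
  change energyBilin hA subset_rfl (c' - c) (c' - c) = 0
  rw [LinearMap.map_sub₂, energyBilin_apply, energyBilin_apply]
  exact sub_eq_zero.2 (h2.trans h3.symm)

theorem elemCorr_spec (hd : 0 < d) (hreg : interior (closure Ω) = Ω) (hA : Admissible Ω A)
    {𝒯 : Mesh Ω} {IH : H10 Ω →ₗ[ℝ] 𝒯.VH0} (hIH : IsQuasiInterpolation 𝒯 IH) (ℓ : ℕ)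
    {T : Orthotope d} (hT : T ∈ 𝒯.elems) (v : H1 Ω) :
    elemCorr A 𝒯 IH ℓ T v ∈ localKernel 𝒯 IH ℓ T ∧
      ∀ w ∈ localKernel 𝒯 IH ℓ T, aForm A (elemCorr A 𝒯 IH ℓ T v) w = energy A T.inner v w :=
  Classical.epsilon_spec (existsUnique_elemCorr hd hreg hA hIH ℓ hT v).exists

/-- The element correction as a linear map. -/
theorem exists_elemCorr_linear (hd : 0 < d) (hreg : interior (closure Ω) = Ω) (hA : Admissible Ω A)
    {𝒯 : Mesh Ω} {IH : H10 Ω →ₗ[ℝ] 𝒯.VH0} (hIH : IsQuasiInterpolation 𝒯 IH) (ℓ : ℕ)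
    {T : Orthotope d} (hT : T ∈ 𝒯.elems) :
    ∃ L : H1 Ω →ₗ[ℝ] H1 Ω, ∀ v, L v = elemCorr A 𝒯 IH ℓ T v := by
  have hspec := elemCorr_spec hd hreg hA hIH ℓ hT
  refine ⟨{ toFun := elemCorr A 𝒯 IH ℓ T, map_add' := fun v w => ?_, map_smul' := fun a v => ?_ },
    fun _ => rfl⟩
  -- Linearity follows from uniqueness: the sum of the corrections solves the problem for the sum.
  · refine (existsUnique_elemCorr hd hreg hA hIH ℓ hT (v + w)).unique (hspec _) ⟨?_, fun y hy => ?_⟩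
    · exact mem_localKernelSubmodule.1 (Submodule.add_mem _
        (mem_localKernelSubmodule.2 (hspec v).1) (mem_localKernelSubmodule.2 (hspec w).1))
    · change energyBilin hA subset_rfl _ _ = energyBilin hA (𝒯.inner_subset hreg hT) _ _
      rw [map_add, map_add, LinearMap.add_apply, LinearMap.add_apply]
      exact congrArg₂ (· + ·) ((hspec v).2 y hy) ((hspec w).2 y hy)
  · refine (existsUnique_elemCorr hd hreg hA hIH ℓ hT (a • v)).unique (hspec _) ⟨?_, fun y hy => ?_⟩
    · exact mem_localKernelSubmodule.1 (Submodule.smul_mem _ a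
        (mem_localKernelSubmodule.2 (hspec v).1))
    · change energyBilin hA subset_rfl _ _ = energyBilin hA (𝒯.inner_subset hreg hT) _ _
      rw [RingHom.id_apply, map_smul, map_smul, LinearMap.smul_apply, LinearMap.smul_apply]
      exact congrArg (a • ·) ((hspec v).2 y hy)

/-- The full correction as a linear map, with values in the kernel of `I_H`. -/
theorem exists_corr_linear (hd : 0 < d) (hreg : interior (closure Ω) = Ω) (hA : Admissible Ω A)
    {𝒯 : Mesh Ω} {IH : H10 Ω →ₗ[ℝ] 𝒯.VH0} (hIH : IsQuasiInterpolation 𝒯 IH) (E : ExtensionOp 𝒯)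
    (ℓ : ℕ) : ∃ L : H1 Ω →ₗ[ℝ] H1 Ω, (∀ v, L v = corr A 𝒯 IH E ℓ v) ∧
      ∀ v, ∃ h : L v ∈ H10 Ω, IH ⟨L v, h⟩ = 0 := by
  have hlin := fun T : 𝒯.elems => exists_elemCorr_linear hd hreg hA hIH ℓ T.2
  choose L hL using hlin
  have hsum : ∀ v, (∑ T ∈ 𝒯.elems.attach, L T ∘ₗ E.R) v = corr A 𝒯 IH E ℓ v := by
    intro v
    rw [corr, LinearMap.sum_apply, ← Finset.sum_attach 𝒯.elems]
    exact Finset.sum_congr rfl fun T _ => hL T _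
  refine ⟨∑ T ∈ 𝒯.elems.attach, L T ∘ₗ E.R, hsum, fun v => ?_⟩
  have hmem : (∑ T ∈ 𝒯.elems.attach, L T ∘ₗ E.R) v ∈ (LinearMap.ker IH).map (H10 Ω).subtype := by
    rw [hsum, corr]
    refine Submodule.sum_mem _ fun T hT => ?_
    obtain ⟨⟨h1, h2⟩, -⟩ := (elemCorr_spec hd hreg hA hIH ℓ hT (E.R v)).1
    exact ⟨⟨_, h1⟩, h2, rfl⟩
  obtain ⟨w, hw, hwv⟩ := hmem
  have e : (w : H1 Ω) = (∑ T ∈ 𝒯.elems.attach, L T ∘ₗ E.R) v := hwv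
  rw [← e]
  exact ⟨w.2, hw⟩

/-! ### The restriction operator -/

namespace ExtensionOp

variable {𝒯 : Mesh Ω} (E : ExtensionOp 𝒯)

theorem R_apply (v : H1 Ω) : E.R v = v - E.toLin (tr Ω v) := rfl

theorem tr_eq_zero_iff {v : H1 Ω} : tr Ω v = 0 ↔ v ∈ H10 Ω :=
  Submodule.Quotient.mk_eq_zero (H10 Ω)

theorem R_mem_H10 (v : H1 Ω) : E.R v ∈ H10 Ω := by
  rw [← tr_eq_zero_iff, R_apply, map_sub, E.tr_apply, sub_self]

theorem R_of_mem_H10 {v : H1 Ω} (hv : v ∈ H10 Ω) : E.R v = v := by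
  rw [R_apply, tr_eq_zero_iff.2 hv, map_zero, sub_zero]

theorem R_mem_VH0 {v : H1 Ω} (hv : v ∈ 𝒯.VH) : E.R v ∈ 𝒯.VH0 :=
  ⟨Submodule.sub_mem _ hv (E.mem_VH _ ⟨v, hv, rfl⟩), E.R_mem_H10 v⟩

/-- The reason is `tr R = 0`. This identifies the boundary conditions of the two discrete problems.
-/
theorem eq_R_add_iff {v : H1 Ω} {g : TraceSpace Ω} : v = E.R v + E.toLin g ↔ tr Ω v = g := by
  constructor
  · intro h
    have := congrArg (tr Ω) h
    rwa [map_add, tr_eq_zero_iff.2 (E.R_mem_H10 v), zero_add, E.tr_apply] at this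
  · rintro rfl
    rw [R_apply, sub_add_cancel]

end ExtensionOp

/-! ### The hat functions as a basis -/

/-- The explicit hat function shows that the choice in `Mesh.hat` is not a default value, and nodal
values determine a `Q¹` function. -/
theorem Mesh.val_hat (hΩ : IsOpen Ω) (𝒯 : Mesh Ω) (p : 𝒯.nodes) :
    val (𝒯.hat p) =ᵐ[volume.restrict Ω] 𝒯.hatFun p := by
  have hex : ∃ v : H1 Ω, ∃ g : Eucl d → ℝ, 𝒯.IsQ1 g ∧ val v =ᵐ[volume.restrict Ω] g ∧ g p = 1 ∧
      ∀ q ∈ 𝒯.nodes, q ≠ p → g q = 0 := by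
    obtain ⟨v, hv⟩ := (𝒯.isQ1_hatFun p).exists_H1 hΩ
    exact ⟨v, _, 𝒯.isQ1_hatFun p, hv, 𝒯.hatFun_self p.2, fun q hq hne => 𝒯.hatFun_of_ne hq hne⟩
  obtain ⟨g, hg, hv, h1, h0⟩ := Classical.epsilon_spec hex
  refine hv.trans ?_
  have hz := (hg.add ((𝒯.isQ1_hatFun p).const_mul (-1))).eq_zero fun q hq => by
    by_cases hqp : q = p
    · rw [hqp, h1, 𝒯.hatFun_self p.2]; norm_num
    · rw [h0 q hq hqp, 𝒯.hatFun_of_ne hq hqp]; norm_num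
  filter_upwards [ae_restrict_mem hΩ.measurableSet] with x hx
  linarith [hz x (subset_closure hx)]

theorem Mesh.hat_mem_VH (hΩ : IsOpen Ω) (𝒯 : Mesh Ω) (p : 𝒯.nodes) : 𝒯.hat p ∈ 𝒯.VH :=
  ⟨_, 𝒯.isQ1_hatFun p, 𝒯.val_hat hΩ p⟩

theorem Mesh.hat_mem_VH0 (hΩ : IsOpen Ω) (hreg : interior (closure Ω) = Ω) (𝒯 : Mesh Ω)
    {p : 𝒯.nodes} (hp : (p : Eucl d) ∈ Ω) : 𝒯.hat p ∈ 𝒯.VH0 := by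
  obtain ⟨K, hK⟩ := 𝒯.exists_lipschitzOnWith fun T hT => 𝒯.isMultilinearOn_hatFun p hT
  exact ⟨𝒯.hat_mem_VH hΩ p, mem_H10_of_lipschitz hΩ 𝒯.isBounded hK
    (fun x _ => 𝒯.hatFun_nonneg p x)
    (fun x hx => 𝒯.hatFun_eq_zero_of_mem_frontier hΩ hreg hp hx) (𝒯.val_hat hΩ p)⟩

section Coefficients

variable {m : ℕ} {𝒯 : Mesh Ω} (z : Fin m ≃ 𝒯.nodes)

theorem val_sum_hat (hΩ : IsOpen Ω) (c : Fin m → ℝ) :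
    val (∑ j, c j • 𝒯.hat (z j)) =ᵐ[volume.restrict Ω] fun x => ∑ j, c j * 𝒯.hatFun (z j) x := by
  classical
  suffices h : ∀ s : Finset (Fin m), val (∑ j ∈ s, c j • 𝒯.hat (z j)) =ᵐ[volume.restrict Ω]
      fun x => ∑ j ∈ s, c j * 𝒯.hatFun (z j) x from h _
  intro s
  induction s using Finset.induction_on with
  | empty =>
    simp only [Finset.sum_empty]
    exact Lp.coeFn_zero ℝ 2 _
  | insert j s hj ih =>
    simp only [Finset.sum_insert hj]
    filter_upwards [ih, Lp.coeFn_add (val (c j • 𝒯.hat (z j))) (val (∑ j ∈ s, c j • 𝒯.hat (z j))),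
      Lp.coeFn_smul (c j) (val (𝒯.hat (z j))), 𝒯.val_hat hΩ (z j)] with x h1 h2 h3 h4
    rw [val_add, h2, Pi.add_apply, h1, val_smul, h3, Pi.smul_apply, h4, smul_eq_mul]

theorem sum_hatFun_node (c : Fin m → ℝ) (i : Fin m) :
    ∑ j, c j * 𝒯.hatFun (z j) (z i) = c i := by
  rw [Finset.sum_eq_single i]
  · rw [𝒯.hatFun_self (z i).2, mul_one]
  · intro j _ hj
    rw [𝒯.hatFun_of_ne (z i).2 (fun h => hj (z.injective (Subtype.ext h.symm))), mul_zero]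
  · intro h
    exact absurd (Finset.mem_univ i) h

theorem isQ1_sum_hatFun (c : Fin m → ℝ) : 𝒯.IsQ1 fun x => ∑ j, c j * 𝒯.hatFun (z j) x :=
  Mesh.isQ1_sum _ fun j _ => (𝒯.isQ1_hatFun (z j)).const_mul (c j)

/-- Nodal values serve as coefficients: a `Q¹` function and its nodal interpolant agree at all
nodes, hence everywhere on the closure. -/
theorem coeffs_spec (hΩ : IsOpen Ω) {v : H1 Ω} (hv : v ∈ 𝒯.VH) :
    v = ∑ j, coeffs z v j • 𝒯.hat (z j) := by
  have hex : ∃ c : Fin m → ℝ, v = ∑ j, c j • 𝒯.hat (z j) := by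
    obtain ⟨g, hg, hvg⟩ := hv
    refine ⟨fun j => g (z j), val_injective hΩ (Lp.ext (hvg.trans ?_))⟩
    refine Filter.EventuallyEq.trans ?_ (val_sum_hat z hΩ _).symm
    have hz := (hg.add ((isQ1_sum_hatFun z fun j => g (z j)).const_mul (-1))).eq_zero
      fun q hq => by
        obtain ⟨i, hi⟩ := z.surjective ⟨q, hq⟩
        obtain rfl : (z i : Eucl d) = q := by rw [hi]
        rw [sum_hatFun_node z (fun j => g (z j)) i]
        ring
    filter_upwards [ae_restrict_mem hΩ.measurableSet] with x hx
    linarith [hz x (subset_closure hx)]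
  exact Classical.epsilon_spec hex

theorem coeffs_eq_zero (hΩ : IsOpen Ω) (hreg : interior (closure Ω) = Ω) {v : H1 Ω}
    (hv : v ∈ 𝒯.VH0) {i : Fin m} (hi : (z i : Eucl d) ∉ Ω) : coeffs z v i = 0 := by
  rw [← sum_hatFun_node z (coeffs z v) i]
  refine 𝒯.eq_zero_of_mem_H10 hΩ hreg (isQ1_sum_hatFun z (coeffs z v)).1 ?_ hv.2 (z i).2 hi
  conv_lhs => rw [coeffs_spec z hΩ hv.1]
  exact val_sum_hat z hΩ _

/-- Boundary coefficients of functions in `V_H⁰` vanish, so testing with inner hat functions is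
enough. -/
theorem eqOn_VH0_of_hat (hΩ : IsOpen Ω) (hreg : interior (closure Ω) = Ω) {F G : H1 Ω →ₗ[ℝ] ℝ}
    (h : ∀ i : InnerIdx z, F (𝒯.hat (z i)) = G (𝒯.hat (z i))) : ∀ v ∈ 𝒯.VH0, F v = G v := by
  intro v hv
  rw [coeffs_spec z hΩ hv.1, map_sum, map_sum]
  refine Finset.sum_congr rfl fun j _ => ?_
  rw [map_smul, map_smul]
  by_cases hj : (z j : Eucl d) ∈ Ω
  · rw [h ⟨j, hj⟩]
  · rw [coeffs_eq_zero z hΩ hreg hv hj, zero_smul, zero_smul]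

theorem finiteDimensional_VH (z : Fin m ≃ 𝒯.nodes) (hΩ : IsOpen Ω) : FiniteDimensional ℝ 𝒯.VH := by
  have hle : 𝒯.VH ≤ Submodule.span ℝ (Set.range fun j => 𝒯.hat (z j)) := by
    intro v hv
    rw [coeffs_spec z hΩ hv]
    exact Submodule.sum_mem _ fun j _ => Submodule.smul_mem _ _ (Submodule.subset_span ⟨j, rfl⟩)
  have : FiniteDimensional ℝ (Submodule.span ℝ (Set.range fun j => 𝒯.hat (z j))) :=
    FiniteDimensional.span_of_finite ℝ (Set.finite_range _)
  exact Submodule.finiteDimensional_of_le hle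

theorem innerL2_eq (u v : L2 Ω) : innerL2 u v = inner ℝ u v := by
  rw [innerL2, L2.inner_def]
  simp [mul_comm]

theorem projL2_mem (z : Fin m ≃ 𝒯.nodes) (hΩ : IsOpen Ω) (f : L2 Ω) : projL2 𝒯 f ∈ 𝒯.VH := by
  have := finiteDimensional_VH z hΩ
  have : FiniteDimensional ℝ (𝒯.VH.map (valL Ω).toLinearMap) := inferInstance
  have hex : ∃ fH : H1 Ω, fH ∈ 𝒯.VH ∧
      ∀ v ∈ 𝒯.VH, innerL2 (val fH) (val v) = innerL2 f (val v) := by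
    set U := 𝒯.VH.map (valL Ω).toLinearMap with hU
    -- The orthogonal projection onto the finite-dimensional image of `V_H` in `L²` is lifted back
    -- to `V_H`.
    obtain ⟨w, hw, hwf⟩ := U.starProjection_apply_mem f
    refine ⟨w, hw, fun v hv => ?_⟩
    have h1 : inner ℝ (f - U.starProjection f) (val v) = 0 :=
      U.starProjection_inner_eq_zero f _ ⟨v, hv, rfl⟩
    have h2 : val w = U.starProjection f := hwf
    rw [innerL2_eq, innerL2_eq, h2]
    rw [inner_sub_left] at h1
    linarith
  exact (Classical.epsilon_spec hex).1

/-! ### The matrices -/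

theorem restrictionMatrix_mulVec (w : Fin m → ℝ) (i : InnerIdx z) :
    (restrictionMatrix z *ᵥ w) i = w i := by
  simp [restrictionMatrix, Matrix.mulVec, dotProduct]

/-- `PᵀP` merely deletes boundary entries. This turns `P S Pᵀ P` into `P S` on coefficient vectors
from `V_H⁰`. -/
theorem restrictionMatrix_transpose_mulVec {w : Fin m → ℝ}
    (hw : ∀ i, (z i : Eucl d) ∉ Ω → w i = 0) :
    (restrictionMatrix z)ᵀ *ᵥ (restrictionMatrix z *ᵥ w) = w := by
  classical
  ext j
  have e : ((restrictionMatrix z)ᵀ *ᵥ (restrictionMatrix z *ᵥ w)) j =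
      ∑ i : InnerIdx z, if (i : Fin m) = j then w i else 0 := by
    simp only [Matrix.mulVec, dotProduct, Matrix.transpose_apply]
    refine Finset.sum_congr rfl fun i _ => ?_
    have := restrictionMatrix_mulVec z w i
    simp only [Matrix.mulVec, dotProduct] at this
    rw [this]
    simp [restrictionMatrix]
  rw [e]
  by_cases hj : (z j : Eucl d) ∈ Ω
  · rw [Finset.sum_eq_single (⟨j, hj⟩ : InnerIdx z)]
    · simp
    · intro i _ hi
      rw [if_neg fun h => hi (Subtype.ext h)]
    · intro h
      exact absurd (Finset.mem_univ _) h
  · rw [hw j hj]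
    refine Finset.sum_eq_zero fun i _ => ?_
    rw [if_neg]
    rintro rfl
    exact hj i.2

theorem massMatrix_mulVec (hΩ : IsOpen Ω) {v : H1 Ω} (hv : v ∈ 𝒯.VH) (i : Fin m) :
    (massMatrix z *ᵥ coeffs z v) i = innerL2 (val v) (val (𝒯.hat (z i))) := by
  conv_rhs => rw [coeffs_spec z hΩ hv, innerL2_eq, ← valL_apply, map_sum, sum_inner]
  simp only [massMatrix, Matrix.mulVec, dotProduct, Matrix.of_apply]
  refine Finset.sum_congr rfl fun j _ => ?_
  rw [innerL2_eq, map_smul, real_inner_smul_left, valL_apply, mul_comm]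

theorem lodStiffness_mulVec (hΩ : IsOpen Ω) (hA : Admissible Ω A) {IH : H10 Ω →ₗ[ℝ] 𝒯.VH0}
    {E : ExtensionOp 𝒯} {ℓ : ℕ} {L : H1 Ω →ₗ[ℝ] H1 Ω} (hL : ∀ v, L v = corrected A 𝒯 IH E ℓ v)
    {v : H1 Ω} (hv : v ∈ 𝒯.VH) (i : Fin m) :
    (lodStiffness z A IH E ℓ *ᵥ coeffs z v) i = aForm A (L v) (L (𝒯.hat (z i))) := by
  change _ = energyBilin hA subset_rfl (L v) (L (𝒯.hat (z i)))
  conv_rhs => rw [coeffs_spec z hΩ hv, map_sum, map_sum, LinearMap.sum_apply]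
  simp only [lodStiffness, Matrix.mulVec, dotProduct, Matrix.of_apply]
  refine Finset.sum_congr rfl fun j _ => ?_
  rw [map_smul, LinearMap.map_smul₂, smul_eq_mul, mul_comm, hL, hL]
  rfl

end Coefficients

/-! ### Unique solvability and equivalence of the two problems -/

/-- A definite bilinear form on a finite-dimensional space represents every functional. -/
theorem existsUnique_of_definite {V : Type*} [AddCommGroup V] [Module ℝ V] [FiniteDimensional ℝ V]
    (b : V →ₗ[ℝ] V →ₗ[ℝ] ℝ) (hb : ∀ v, b v v = 0 → v = 0) (F : V →ₗ[ℝ] ℝ) :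
    ∃! w, ∀ v, b w v = F v := by
  have hinj : Function.Injective b := by
    rw [← LinearMap.ker_eq_bot, LinearMap.ker_eq_bot']
    intro w hw
    exact hb w (by rw [hw]; rfl)
  have hsurj : Function.Surjective b :=
    (LinearMap.injective_iff_surjective_of_finrank_eq_finrank
      (Subspace.dual_finrank_eq (K := ℝ) (V := V)).symm).1 hinj
  obtain ⟨w, hw⟩ := hsurj F
  exact ⟨w, fun v => by rw [hw], fun w' hw' => hinj (by rw [hw]; exact LinearMap.ext hw')⟩

/-- Definiteness is the complementarity of `V_H⁰` and the kernel of `I_H`: zero energy forces `v =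
𝒞_ℓ v`, and then `v = I_H v = 0`. -/
theorem exists_corrected_linear (hd : 0 < d) (hreg : interior (closure Ω) = Ω)
    (hA : Admissible Ω A) {𝒯 : Mesh Ω} {IH : H10 Ω →ₗ[ℝ] 𝒯.VH0}
    (hIH : IsQuasiInterpolation 𝒯 IH) (E : ExtensionOp 𝒯) (ℓ : ℕ) :
    ∃ L : H1 Ω →ₗ[ℝ] H1 Ω, (∀ v, L v = corrected A 𝒯 IH E ℓ v) ∧
      ∀ v ∈ 𝒯.VH0, aForm A (L v) (L v) = 0 → v = 0 := by
  have hΩ : IsOpen Ω := hreg ▸ isOpen_interior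
  obtain ⟨C, hC, hker⟩ := exists_corr_linear hd hreg hA hIH E ℓ
  refine ⟨(LinearMap.id : H1 Ω →ₗ[ℝ] H1 Ω) - C, fun v => by rw [corrected, ← hC]; rfl, fun v hv h => ?_⟩
  obtain ⟨h1, h2⟩ := hker v
  have h3 : ((LinearMap.id : H1 Ω →ₗ[ℝ] H1 Ω) - C) v = v - C v := rfl
  have h4 : v - C v = 0 := by
    rw [h3] at h
    exact eq_zero_of_aForm_self hd hΩ 𝒯.isBounded hA (Submodule.sub_mem _ hv.2 h1) h
  have h5 : v = C v := sub_eq_zero.1 h4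
  have h6 := hIH.proj ⟨v, hv.2⟩ hv
  have h7 : (⟨v, hv.2⟩ : H10 Ω) = ⟨C v, h1⟩ := Subtype.ext h5
  rw [h7, h2] at h6
  exact h5.trans h6.symm

/-- The unknown is `w = R u` in `V_H⁰`, determined by a definite form in finite dimensions; the
solution is `w + E u⁰`, and `R E = 0` recovers `w` from it. -/
theorem existsUnique_solvesEff (hd : 0 < d) (hreg : interior (closure Ω) = Ω)
    (hA : Admissible Ω A) {𝒯 : Mesh Ω} {m : ℕ} (z : Fin m ≃ 𝒯.nodes) {IH : H10 Ω →ₗ[ℝ] 𝒯.VH0}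
    (hIH : IsQuasiInterpolation 𝒯 IH) (E : ExtensionOp 𝒯) (ℓ : ℕ) (u0 : 𝒯.XH) (f : L2 Ω) :
    ∃! u : 𝒯.VH, SolvesEff A 𝒯 IH E ℓ u0 f u := by
  have hΩ : IsOpen Ω := hreg ▸ isOpen_interior
  obtain ⟨L, hL, hdef⟩ := exists_corrected_linear hd hreg hA hIH E ℓ
  have := finiteDimensional_VH z hΩ
  have : FiniteDimensional ℝ 𝒯.VH0 := Submodule.finiteDimensional_of_le inf_le_left
  let K : 𝒯.VH0 →ₗ[ℝ] H1 Ω := L ∘ₗ 𝒯.VH0.subtype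
  let b : 𝒯.VH0 →ₗ[ℝ] 𝒯.VH0 →ₗ[ℝ] ℝ := (energyBilin hA subset_rfl).compl₁₂ K K
  let F : 𝒯.VH0 →ₗ[ℝ] ℝ :=
    (innerₗ (L2 Ω) (val (projL2 𝒯 f))) ∘ₗ (valL Ω).toLinearMap ∘ₗ 𝒯.VH0.subtype -
      energyBilin hA subset_rfl (E.toLin u0) ∘ₗ K
  have hb : ∀ w v : 𝒯.VH0, b w v =
      aForm A (corrected A 𝒯 IH E ℓ w) (corrected A 𝒯 IH E ℓ v) := fun w v => by
    rw [← hL, ← hL]; rfl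
  have hF : ∀ v : 𝒯.VH0, F v = innerL2 (val (projL2 𝒯 f)) (val (v : H1 Ω)) -
      aForm A (E.toLin u0) (corrected A 𝒯 IH E ℓ v) := fun v => by
    rw [← hL, innerL2_eq]; rfl
  obtain ⟨w, hw, huniq⟩ := existsUnique_of_definite b
    (fun v hv => Subtype.ext (hdef v v.2 hv)) F
  have hEmem : E.toLin u0 ∈ 𝒯.VH := E.mem_VH _ u0.2
  have hRE : E.R ((w : H1 Ω) + E.toLin u0) = w := by
    rw [map_add, E.R_of_mem_H10 w.2.2, E.R_apply, E.tr_apply, sub_self, add_zero]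
  refine ⟨⟨(w : H1 Ω) + E.toLin u0, Submodule.add_mem _ w.2.1 hEmem⟩, ⟨?_, fun v hv => ?_⟩, ?_⟩
  · change (w : H1 Ω) + E.toLin u0 = E.R ((w : H1 Ω) + E.toLin u0) + E.toLin u0
    rw [hRE]
  · change aForm A (corrected A 𝒯 IH E ℓ (E.R ((w : H1 Ω) + E.toLin u0))) _ = _
    rw [hRE]
    have := hw ⟨v, hv⟩
    rwa [hb, hF] at this
  · rintro u ⟨hu1, hu2⟩
    have h1 : (⟨E.R u, E.R_mem_VH0 u.2⟩ : 𝒯.VH0) = w := by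
      refine huniq _ fun v => ?_
      rw [hb, hF]
      exact hu2 v v.2
    apply Subtype.ext
    change (u : H1 Ω) = (w : H1 Ω) + E.toLin u0
    rw [← h1]
    exact hu1

theorem solvesMat_iff_solvesEff (hd : 0 < d) (hreg : interior (closure Ω) = Ω)
    (hA : Admissible Ω A) {𝒯 : Mesh Ω} {m : ℕ} (z : Fin m ≃ 𝒯.nodes) {IH : H10 Ω →ₗ[ℝ] 𝒯.VH0}
    (hIH : IsQuasiInterpolation 𝒯 IH) (E : ExtensionOp 𝒯) (ℓ : ℕ)
    (hE : ∀ v0 ∈ 𝒯.XH, corr A 𝒯 IH E ℓ (E.toLin v0) = 0) (u0 : 𝒯.XH) (f : L2 Ω) (u : 𝒯.VH) :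
    SolvesMat z (lodStiffness z A IH E ℓ) E u0 f u ↔ SolvesEff A 𝒯 IH E ℓ u0 f u := by
  have hΩ : IsOpen Ω := hreg ▸ isOpen_interior
  obtain ⟨L, hL, -⟩ := exists_corrected_linear hd hreg hA hIH E ℓ
  -- The vanishing correction of the extension replaces `a((1 - 𝒞_ℓ) E u⁰, ·)`, which the stiffness
  -- matrix produces, by `a(E u⁰, ·)`.
  have hLE : L (E.toLin u0) = E.toLin u0 := by
    rw [hL, corrected, hE _ u0.2, sub_zero]
  have hR := E.R_mem_VH0 u.2
  let F : H1 Ω →ₗ[ℝ] ℝ := energyBilin hA subset_rfl (L (E.R u)) ∘ₗ L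
  let G : H1 Ω →ₗ[ℝ] ℝ := (innerₗ (L2 Ω) (val (projL2 𝒯 f))) ∘ₗ (valL Ω).toLinearMap -
    energyBilin hA subset_rfl (E.toLin u0) ∘ₗ L
  have hF : ∀ v, F v = aForm A (corrected A 𝒯 IH E ℓ (E.R u)) (corrected A 𝒯 IH E ℓ v) :=
    fun v => by rw [← hL, ← hL]; rfl
  have hG : ∀ v, G v = innerL2 (val (projL2 𝒯 f)) (val v) -
      aForm A (E.toLin u0) (corrected A 𝒯 IH E ℓ v) := fun v => by
    rw [← hL, innerL2_eq]; rfl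
  rw [SolvesMat, SolvesEff, E.eq_R_add_iff]
  refine and_congr Iff.rfl ?_
  rw [← Matrix.mulVec_mulVec, ← Matrix.mulVec_mulVec, restrictionMatrix_transpose_mulVec z
    (w := coeffs z (E.R u)) (fun i hi => coeffs_eq_zero z hΩ hreg hR hi)]
  constructor
  · intro h
    have := eqOn_VH0_of_hat z hΩ hreg (F := F) (G := G) fun i => by
      have hi := congrFun h i
      rw [Pi.sub_apply, restrictionMatrix_mulVec, restrictionMatrix_mulVec,
        restrictionMatrix_mulVec, massMatrix_mulVec z hΩ (projL2_mem z hΩ f),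
        lodStiffness_mulVec z hΩ hA hL hR.1, lodStiffness_mulVec z hΩ hA hL (E.mem_VH _ u0.2),
        hLE] at hi
      rw [hG, ← hL]
      exact hi
    intro v hv
    rw [← hF, ← hG]
    exact this v hv
  · intro h
    ext i
    rw [Pi.sub_apply, restrictionMatrix_mulVec, restrictionMatrix_mulVec,
      restrictionMatrix_mulVec, massMatrix_mulVec z hΩ (projL2_mem z hΩ f),
      lodStiffness_mulVec z hΩ hA hL hR.1, lodStiffness_mulVec z hΩ hA hL (E.mem_VH _ u0.2), hLE]
    have := h _ (𝒯.hat_mem_VH0 hΩ hreg i.2)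
    rwa [← hL, ← hL] at this

end LOD

end

open LOD in
theorem lemma4p3 {d : ℕ} (hd : d = 1 ∨ d = 2 ∨ d = 3)
    (Ω : Set (Eucl d)) (hΩ : IsOpen Ω) (hconn : IsConnected Ω) (hreg : interior (closure Ω) = Ω)
    (𝒯 : Mesh Ω) {m : ℕ} (z : Fin m ≃ 𝒯.nodes)
    (A : Eucl d → Matrix (Fin d) (Fin d) ℝ) (hA : Admissible Ω A)
    (IH : H10 Ω →ₗ[ℝ] 𝒯.VH0) (hIH : IsQuasiInterpolation 𝒯 IH)
    (E : ExtensionOp 𝒯) (ℓ : ℕ)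
    (hE : ∀ v0 ∈ 𝒯.XH, corr A 𝒯 IH E ℓ (E.toLin v0) = 0) :
    ∀ (u0 : 𝒯.XH) (f : L2 Ω),
      (∃! u : 𝒯.VH, SolvesMat z (lodStiffness z A IH E ℓ) E u0 f u) ∧
      (∃! u : 𝒯.VH, SolvesEff A 𝒯 IH E ℓ u0 f u) ∧
      Lmat z (lodStiffness z A IH E ℓ) E u0 f = Leff A 𝒯 IH E ℓ u0 f := by
  intro u0 f
  have hd0 : 0 < d := by omega
  -- Equality of the predicates, rather than of particular solutions, transfers unique existence and
  -- also identifies the two `Classical.epsilon` choices.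
  have heq : SolvesMat z (lodStiffness z A IH E ℓ) E u0 f = SolvesEff A 𝒯 IH E ℓ u0 f :=
    funext fun u => propext (solvesMat_iff_solvesEff hd0 hreg hA z hIH E ℓ hE u0 f u)
  have hex := existsUnique_solvesEff hd0 hreg hA z hIH E ℓ u0 f
  exact ⟨heq ▸ hex, hex, by rw [Lmat, Leff, heq]⟩
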